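/- Let $\mathbb R_+=[0,\infty)$. For an integer $m\ge 0$, $C^m(\mathbb R_+)$ denotes the space of functions $f:\mathbb R_+\to\mathbb R$ whose derivatives up to order $m$ exist (one-sided at $0$) and are continuous and bounded on $\mathbb R_+$, with norm $\sum_{k\le m}\|\partial_y^k f\|_{L^\infty}$; $W^{m,1}(\mathbb R_+)$ is the Sobolev space of functions with $\partial_y^kf\in L^1(\mathbb R_+)$ for $0\le k\le m$, with norm $\sum_{k\le m}\|\partial_y^k f\|_{L^1}$. Let $a_0\in C^6(\mathbb R_+)\cap W^{4,1}(\mathbb R_+)$ satisfy $\partial_y^m a_0(0)=0$ for $m=0,1,4,5$. Consider the restricted fourth-order Prandtl problem $$a_t=-a_{yyyy}+a^2-a_y\int_0^y a(t,\eta)\,d\eta\qquad (0<t<T,\ y>0),$$ $$a(0,y)=a_0(y)\ (y\ge 0),\qquad a(t,0)=a_y(t,0)=0,\qquad \lim_{y\to\infty}\partial_y^m a(t,y)=0\quad(0\le m\le 3,\ 0\le t\le T),$$ where the equation holds pointwise in the classical sense. Then there is $T>0$ for which this problem has a solution $a$ such that $a\in C([0,T];W^{4,1}(\mathbb R_+))$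 and the derivatives $\partial_y^k a$, $0\le k\le 6$, exist and are bounded and continuous on $[0,T]\times\mathbb R_+$; it is the only solution on $[0,T]$ in this class. Moreover $a\in C([0,T];C^5(\mathbb R_+))\cap C((0,T];C^6(\mathbb R_+))$, and if $\partial_y^6a_0$ is uniformly continuous on $\mathbb R_+$, then $a\in C([0,T];C^6(\mathbb R_+))$. (Here $C(I;X)$ refers to continuity in the norm of $X$.) -/

import Mathlib

open Set Filter Topology MeasureTheory
open scoped ENNReal

namespace Prandtl

/-- The `k`-th derivative of `f` on the closed half-line `[0, ∞)` (one-sided at `0`). It depends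
only on the values of `f` on `[0, ∞)`. -/
noncomputable def dy (k : ℕ) (f : ℝ → ℝ) : ℝ → ℝ := iteratedDerivWithin k f (Ici 0)

/-- `f ∈ C^m(ℝ₊)`: the derivatives of `f` up to order `m` exist, are continuous and are bounded
on `[0, ∞)`. -/
def MemC (m : ℕ) (f : ℝ → ℝ) : Prop :=
  ContDiffOn ℝ m f (Ici 0) ∧ ∀ k ≤ m, ∃ M : ℝ, ∀ y ∈ Ici (0 : ℝ), |dy k f y| ≤ M

/-- The norm of `C^m(ℝ₊)`: the sum of the sup norms of the derivatives up to order `m`. -/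
noncomputable def normC (m : ℕ) (f : ℝ → ℝ) : ℝ≥0∞ :=
  ∑ k ∈ Finset.range (m + 1), ⨆ y ∈ Ici (0 : ℝ), ‖dy k f y‖ₑ

/-- `f ∈ W^{m,1}(ℝ₊)`, for functions that are `m` times continuously differentiable on `[0, ∞)`
(whose weak derivatives up to order `m` are the classical ones): the derivatives up to order `m`
are integrable. -/
def MemW (m : ℕ) (f : ℝ → ℝ) : Prop :=
  ∀ k ≤ m, IntegrableOn (dy k f) (Ici 0)

/-- The norm of `W^{m,1}(ℝ₊)`: the sum of the `L¹` norms of the derivatives up to order `m`. -/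
noncomputable def normW (m : ℕ) (f : ℝ → ℝ) : ℝ≥0∞ :=
  ∑ k ∈ Finset.range (m + 1), ∫⁻ y in Ici (0 : ℝ), ‖dy k f y‖ₑ

/-- `t ↦ a t` is continuous on `I` with respect to the distance `N (a t - a s)`. -/
def ContInNorm (N : (ℝ → ℝ) → ℝ≥0∞) (I : Set ℝ) (a : ℝ → ℝ → ℝ) : Prop :=
  ∀ s ∈ I, Tendsto (fun t => N (fun y => a t y - a s y)) (𝓝[I] s) (𝓝 0)

/-- `a ∈ C(I; C^m(ℝ₊))`, with respect to the norm of `C^m(ℝ₊)`. -/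
def MemCC (m : ℕ) (I : Set ℝ) (a : ℝ → ℝ → ℝ) : Prop :=
  (∀ t ∈ I, MemC m (a t)) ∧ ContInNorm (normC m) I a

/-- `a ∈ C(I; W^{m,1}(ℝ₊))`, for functions whose time slices are `m` times continuously
differentiable on `[0, ∞)`. -/
def MemCW (m : ℕ) (I : Set ℝ) (a : ℝ → ℝ → ℝ) : Prop :=
  (∀ t ∈ I, MemW m (a t)) ∧ ContInNorm (normW m) I a

/-- The time slices of `a` belong to `C^m(ℝ₊)`, and the space derivatives of `a` up to order `m`
are bounded and (jointly) continuous on `I × [0, ∞)`. -/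
def MemBC (m : ℕ) (I : Set ℝ) (a : ℝ → ℝ → ℝ) : Prop :=
  (∀ t ∈ I, MemC m (a t)) ∧
  ∀ k ≤ m, (∃ M : ℝ, ∀ t ∈ I, ∀ y ∈ Ici (0 : ℝ), |dy k (a t) y| ≤ M) ∧
    ContinuousOn (fun p : ℝ × ℝ => dy k (a p.1) p.2) (I ×ˢ Ici 0)

/-- `a` (a function of `t` and `y`) solves on `[0, T]` the initial-boundary value problem for
`a_t = - a_yyyy + a² - a_y ∫₀^y a` on the half-line, with clamped boundary conditions, decay of
the derivatives of order at most `3` at infinity, and initial datum `a₀`. -/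
structure IsSolution (T : ℝ) (a₀ : ℝ → ℝ) (a : ℝ → ℝ → ℝ) : Prop where
  equation : ∀ t ∈ Ioo 0 T, ∀ y ∈ Ioi (0 : ℝ),
    HasDerivAt (fun s => a s y)
      (-dy 4 (a t) y + a t y ^ 2 - dy 1 (a t) y * ∫ η in (0 : ℝ)..y, a t η) t
  initial : ∀ y ∈ Ici (0 : ℝ), a 0 y = a₀ y
  clamped : ∀ t ∈ Icc 0 T, a t 0 = 0 ∧ dy 1 (a t) 0 = 0
  decay : ∀ t ∈ Icc 0 T, ∀ m ≤ 3, Tendsto (dy m (a t)) atTop (𝓝 0)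

end Prandtl

namespace Prandtl

/-! ### Quartic exponential moments and oscillatory integrals -/

/-! The problem is solved in mild form. The clamped operator ∂_y⁴ on the half-line has the
generalized eigenfunctions φ(ky), k > 0, with φ(x) = cos x - sin x - e^{-x}, so its semigroup has
the kernel π⁻¹ ∫ e^{-k⁴t} φ(ky) φ(kη) dk. This kernel and all its derivatives lie in one explicit
family `greenK`, because the derivatives of φ have period four. The basic estimate is
`abs_greenK_le`: m derivatives in η cost t^{-m/4}, times a multiple of the Cauchy density of width
t^{1/4}. The quadratic tail is far from sharp, but it gives every L^∞ and L¹ bound that is needed,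
and t^{-m/4} is integrable at t = 0 exactly for m ≤ 3.

Derivatives are moved through the semigroup as follows. A y-derivative of a kernel is minus an
η-derivative of the kernel for the next boundary condition (`hasDerivAt_greenK_left`), and
integration by parts (`greenOp_succ`) hands it to the function acted upon. The boundary term
contains the value at 0 of a derivative of φ, which vanishes for orders 0 and 1 modulo 4; in the
other cases the function itself must vanish at 0. For the initial datum this requires precisely that
the derivatives of orders 0, 1, 4, 5 vanish at 0. Continuity at t = 0 rests on the mass of the
kernels (`tendsto_greenOp_zero`): it is exactly one, or else it differs from one only near the
boundary, where the datum vanishes.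

Existence: since a² - a_y ∂⁻¹a = 2a² - ∂_y(a ∂⁻¹a), the derivative can be put on the kernel, and the
Duhamel map is a contraction for small T in the sup norm together with L^∞_t L¹_y; the L¹ norm is
what bounds ∂⁻¹a (`exists_mild_solution`). Regularity is a bootstrap (`exists_regularSolution`):
with two derivatives left on the kernel and the others on the nonlinearity, the derivative of order
k is expressed through those of order less than k. The equation is first proved integrated in time,
by Fubini and the semigroup identity (`RegularSolution.eq_integral`), so no singular Duhamel
integral is differentiated in t.

Continuity in the norms: the equation makes a Lipschitz in time, and interpolation between a
function and its second derivative carries continuity up to order 5 in sup norm and order 3 in L¹.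
For the top orders, 6 and 4, smoothing supplies one more derivative at positive times; at t = 0 the
approximate identity is used directly, which for order 6 needs uniform continuity of the datum.

Uniqueness: a classical solution satisfies the Duhamel formula (`eq_duhamel_of_hasDerivAt`), and the
L¹ distance of two mild solutions is halved repeatedly in an exponentially weighted norm
(`mild_unique`). -/

lemma integrableOn_pow_mul_exp (n : ℕ) {t : ℝ} (ht : 0 < t) :
    IntegrableOn (fun k : ℝ => k ^ n * Real.exp (-(k ^ 4 * t))) (Ioi 0) := by
  have h := integrableOn_rpow_mul_exp_neg_mul_rpow (p := 4) (s := n) (b := t)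
    (by have : (0 : ℝ) ≤ n := n.cast_nonneg
        linarith) (by norm_num) ht
  refine h.congr_fun (fun k _ => ?_) measurableSet_Ioi
  have : k ^ (4 : ℝ) = k ^ 4 := by exact_mod_cast Real.rpow_natCast k 4
  simp only [Real.rpow_natCast, this]
  ring_nf

/-- The weight `k ^ n * exp (-k ^ 4)`. -/
noncomputable def quarticWeight (n : ℕ) (k : ℝ) : ℝ := k ^ n * Real.exp (-(k ^ 4))

lemma integrableOn_quarticWeight (n : ℕ) : IntegrableOn (quarticWeight n) (Ioi 0) := by
  simpa [quarticWeight] using! integrableOn_pow_mul_exp n one_pos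

lemma continuous_quarticWeight (n : ℕ) : Continuous (quarticWeight n) := by
  unfold quarticWeight; fun_prop

lemma hasDerivAt_quarticWeight (n : ℕ) (k : ℝ) :
    HasDerivAt (quarticWeight n)
      (n * quarticWeight (n - 1) k - 4 * quarticWeight (n + 3) k) k := by
  have h := (hasDerivAt_pow n k).mul ((hasDerivAt_pow 4 k).neg.exp)
  refine h.congr_deriv ?_
  simp only [quarticWeight, Pi.neg_apply]
  push_cast
  ring

lemma tendsto_quarticWeight (n : ℕ) : Tendsto (quarticWeight n) atTop (𝓝 0) := by
  refine tendsto_zero_of_hasDerivAt_of_integrableOn_Ioi (a := 0)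
    (fun x _ => hasDerivAt_quarticWeight n x) ?_ (integrableOn_quarticWeight n)
  exact ((integrableOn_quarticWeight _).const_mul _).sub ((integrableOn_quarticWeight _).const_mul _)

lemma norm_exp_mul_le_one {l : ℂ} (hl : l.re ≤ 0) {k : ℝ} (hk : 0 ≤ k) :
    ‖Complex.exp (l * k)‖ ≤ 1 := by
  rw [Complex.norm_exp]
  simpa using mul_nonpos_of_nonpos_of_nonneg hl hk

lemma integrableOn_mul_cexp {g : ℝ → ℝ} (hg : IntegrableOn g (Ioi 0)) {l : ℂ} (hl : l.re ≤ 0) :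
    IntegrableOn (fun k : ℝ => (g k : ℂ) * Complex.exp (l * k)) (Ioi 0) := by
  refine Integrable.mul_bdd (c := 1) hg.ofReal ?_ ?_
  · exact Continuous.aestronglyMeasurable (by fun_prop)
  · filter_upwards [ae_restrict_mem measurableSet_Ioi] with k hk
    exact norm_exp_mul_le_one hl (le_of_lt hk)

/-- Integration by parts. Purely imaginary l is allowed, so the vanishing of the boundary term at
infinity has to come from `g` and not from the exponential. -/
lemma integral_mul_cexp {g g' : ℝ → ℝ} (hd : ∀ k, HasDerivAt g (g' k) k)
    (hg : IntegrableOn g (Ioi 0)) (hg' : IntegrableOn g' (Ioi 0)) (h0 : Tendsto g atTop (𝓝 0))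
    {l : ℂ} (hl : l.re ≤ 0) (hl0 : l ≠ 0) :
    ∫ k in Ioi (0 : ℝ), (g k : ℂ) * Complex.exp (l * k) =
      -(g 0 : ℂ) / l - l⁻¹ * ∫ k in Ioi (0 : ℝ), (g' k : ℂ) * Complex.exp (l * k) := by
  have hv : ∀ k : ℝ, HasDerivAt (fun k : ℝ => l⁻¹ * Complex.exp (l * k)) (Complex.exp (l * k)) k := by
    intro k
    have h1 : HasDerivAt (fun k : ℝ => l * (k : ℂ)) l k := by
      simpa using (Complex.ofRealCLM.hasDerivAt (x := k)).const_mul l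
    refine (h1.cexp.const_mul l⁻¹).congr_deriv ?_
    field_simp
  have hcg : Continuous g := continuous_iff_continuousAt.2 fun k => (hd k).continuousAt
  have key := integral_Ioi_mul_deriv_eq_deriv_mul (a := (0 : ℝ)) (u := fun k => (g k : ℂ))
    (u' := fun k => (g' k : ℂ)) (v := fun k : ℝ => l⁻¹ * Complex.exp (l * k))
    (v' := fun k : ℝ => Complex.exp (l * k)) (a' := (g 0 : ℂ) * l⁻¹) (b' := 0)
    (fun k _ => (hd k).ofReal_comp) (fun k _ => hv k) (integrableOn_mul_cexp hg hl)
    (by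
      have := (integrableOn_mul_cexp hg' hl).const_mul l⁻¹
      refine Integrable.congr this (Eventually.of_forall fun k => ?_)
      simp only [Pi.mul_apply]; ring)
    (by
      have : Continuous ((fun k => (g k : ℂ)) * fun k : ℝ => l⁻¹ * Complex.exp (l * k)) := by
        apply Continuous.mul
        · exact Complex.continuous_ofReal.comp hcg
        · fun_prop
      have h2 := (this.tendsto 0).mono_left (nhdsWithin_le_nhds (s := Ioi 0))
      simpa using h2)
    (by
      have h1 : Tendsto (fun k => (g k : ℂ)) atTop (𝓝 0) := by
        simpa [Function.comp_def] using (Complex.continuous_ofReal.tendsto 0).comp h0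
      refine h1.zero_mul_isBoundedUnder_le ?_
      refine isBoundedUnder_of_eventually_le (a := ‖l⁻¹‖) ?_
      filter_upwards [eventually_ge_atTop 0] with k hk
      simp only [Function.comp, norm_mul]
      exact mul_le_of_le_one_right (norm_nonneg _) (norm_exp_mul_le_one hl hk))
  rw [key, zero_sub, ← integral_const_mul, div_eq_mul_inv, neg_mul]
  congr 2
  ext k
  ring

/-- Two integrations by parts leave a remainder of order |l|⁻². The term of order |l|⁻¹ carries the
value of the weight at 0, hence is present only for m = 0; it is kept explicit because it cancels
only after several such integrals are added. -/
lemma exists_bound_integral_quarticWeight (m : ℕ) :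
    ∃ C : ℝ, 0 ≤ C ∧ ∀ l : ℂ, l.re ≤ 0 →
      ‖∫ k in Ioi (0 : ℝ), (quarticWeight m k : ℂ) * Complex.exp (l * k)‖ ≤ C ∧
      (l ≠ 0 → ‖(∫ k in Ioi (0 : ℝ), (quarticWeight m k : ℂ) * Complex.exp (l * k)) +
        (quarticWeight m 0 : ℂ) / l‖ ≤ C / ‖l‖ ^ 2) := by
  -- `g1` and `g2` are the first two derivatives of the weight. The truncated subtractions are
  -- harmless: whenever an exponent would become negative, its prefactor is zero.
  set g1 : ℝ → ℝ := fun k => m * quarticWeight (m - 1) k - 4 * quarticWeight (m + 3) k with hg1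
  set g2 : ℝ → ℝ := fun k =>
    m * ((m - 1 : ℕ) * quarticWeight (m - 1 - 1) k - 4 * quarticWeight (m - 1 + 3) k) -
      4 * ((m + 3 : ℕ) * quarticWeight (m + 3 - 1) k - 4 * quarticWeight (m + 3 + 3) k) with hg2
  have hd1 : ∀ k, HasDerivAt (quarticWeight m) (g1 k) k := fun k => hasDerivAt_quarticWeight m k
  have hd2 : ∀ k, HasDerivAt g1 (g2 k) k := fun k =>
    ((hasDerivAt_quarticWeight _ k).const_mul _).sub ((hasDerivAt_quarticWeight _ k).const_mul _)
  have I := integrableOn_quarticWeight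
  have hi1 : IntegrableOn g1 (Ioi 0) := ((I _).const_mul _).sub ((I _).const_mul _)
  have hi2 : IntegrableOn g2 (Ioi 0) :=
    ((((I _).const_mul _).sub ((I _).const_mul _)).const_mul _).sub
      ((((I _).const_mul _).sub ((I _).const_mul _)).const_mul _)
  have ht1 : Tendsto g1 atTop (𝓝 0) := by
    simpa using ((tendsto_quarticWeight (m - 1)).const_mul (m : ℝ)).sub
      ((tendsto_quarticWeight (m + 3)).const_mul 4)
  have nb : ∀ {g : ℝ → ℝ}, IntegrableOn g (Ioi 0) → ∀ l : ℂ, l.re ≤ 0 →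
      ‖∫ k in Ioi (0 : ℝ), (g k : ℂ) * Complex.exp (l * k)‖ ≤ ∫ k in Ioi (0 : ℝ), |g k| := by
    intro g hg l hl
    refine norm_integral_le_of_norm_le hg.abs ?_
    filter_upwards [ae_restrict_mem measurableSet_Ioi] with k hk
    rw [norm_mul, Complex.norm_real, Real.norm_eq_abs]
    exact mul_le_of_le_one_right (abs_nonneg _) (norm_exp_mul_le_one hl (le_of_lt hk))
  refine ⟨max (∫ k in Ioi (0 : ℝ), |quarticWeight m k|) (|g1 0| + ∫ k in Ioi (0 : ℝ), |g2 k|),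
    le_max_of_le_left (integral_nonneg fun k => abs_nonneg _), fun l hl => ⟨?_, fun hl0 => ?_⟩⟩
  · exact (nb (I m) l hl).trans (le_max_left _ _)
  · rw [integral_mul_cexp hd1 (I m) hi1 (tendsto_quarticWeight m) hl hl0,
      integral_mul_cexp hd2 hi1 hi2 ht1 hl hl0]
    have e : -(quarticWeight m 0 : ℂ) / l - l⁻¹ * (-(g1 0 : ℂ) / l - l⁻¹ *
        ∫ k in Ioi (0 : ℝ), (g2 k : ℂ) * Complex.exp (l * k)) + (quarticWeight m 0 : ℂ) / l =
        ((g1 0 : ℂ) + ∫ k in Ioi (0 : ℝ), (g2 k : ℂ) * Complex.exp (l * k)) / l ^ 2 := by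
      field_simp
      ring
    rw [e, norm_div, norm_pow]
    gcongr
    refine (norm_add_le _ _).trans (le_trans ?_ (le_max_right _ _))
    rw [Complex.norm_real, Real.norm_eq_abs]
    gcongr
    exact nb hi2 l hl

/-! ### Green's kernels of the biharmonic heat operator on the half-line -/

/-- The integral of `k ^ m * exp (-k ^ 4)` against a damped oscillation. -/
noncomputable def dampedIntegral (m : ℕ) (a b θ : ℝ) : ℝ :=
  ∫ k in Ioi (0 : ℝ), quarticWeight m k * (Real.exp (a * k) * Real.cos (b * k + θ))

lemma integrableOn_damped (m : ℕ) {a : ℝ} (ha : a ≤ 0) (b θ : ℝ) :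
    IntegrableOn (fun k => quarticWeight m k * (Real.exp (a * k) * Real.cos (b * k + θ)))
      (Ioi 0) := by
  refine Integrable.mul_bdd (c := 1) (integrableOn_quarticWeight m) ?_ ?_
  · exact Continuous.aestronglyMeasurable (by fun_prop)
  · filter_upwards [ae_restrict_mem measurableSet_Ioi] with k hk
    rw [Real.norm_eq_abs, abs_mul, Real.abs_exp]
    exact mul_le_one₀ (Real.exp_le_one_iff.2 (mul_nonpos_of_nonpos_of_nonneg ha (le_of_lt hk)))
      (abs_nonneg _) (Real.abs_cos_le_one _)

lemma dampedIntegral_eq_re (m : ℕ) {a : ℝ} (ha : a ≤ 0) (b θ : ℝ) :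
    dampedIntegral m a b θ = (Complex.exp (θ * Complex.I) * ∫ k in Ioi (0 : ℝ),
      (quarticWeight m k : ℂ) * Complex.exp ((a + b * Complex.I) * k)).re := by
  have hl : (a + b * Complex.I : ℂ).re ≤ 0 := by simpa using ha
  rw [← integral_const_mul]
  have h := (integrableOn_mul_cexp (integrableOn_quarticWeight m) hl).const_mul
    (Complex.exp (θ * Complex.I))
  have h2 := Complex.reCLM.integral_comp_comm h
  simp only [Complex.reCLM_apply] at h2
  rw [← h2, dampedIntegral]
  congr 1
  ext k
  have e : Complex.exp (θ * Complex.I) * ((quarticWeight m k : ℂ) *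
      Complex.exp ((a + b * Complex.I) * k)) =
      (quarticWeight m k : ℂ) * Complex.exp ((a * k : ℝ) + (b * k + θ : ℝ) * Complex.I) := by
    rw [mul_left_comm, ← Complex.exp_add]
    congr 2
    push_cast
    ring
  rw [e, Complex.re_ofReal_mul, Complex.exp_re]
  simp

lemma exists_bound_dampedIntegral (m : ℕ) : ∃ C : ℝ, 0 ≤ C ∧ ∀ a b θ : ℝ, a ≤ 0 →
    |dampedIntegral m a b θ| ≤ C ∧
    (0 < a ^ 2 + b ^ 2 → |dampedIntegral m a b θ +
      quarticWeight m 0 * ((a * Real.cos θ + b * Real.sin θ) / (a ^ 2 + b ^ 2))| ≤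
        C / (a ^ 2 + b ^ 2)) := by
  obtain ⟨C, hC0, hC⟩ := exists_bound_integral_quarticWeight m
  refine ⟨C, hC0, fun a b θ ha => ?_⟩
  have hl : (a + b * Complex.I : ℂ).re ≤ 0 := by simpa using ha
  obtain ⟨h1, h2⟩ := hC _ hl
  have hn : ‖Complex.exp (θ * Complex.I)‖ = 1 := Complex.norm_exp_ofReal_mul_I θ
  rw [dampedIntegral_eq_re m ha]
  refine ⟨(Complex.abs_re_le_norm _).trans (by rwa [norm_mul, hn, one_mul]), fun hpos => ?_⟩
  have hne : (a + b * Complex.I : ℂ) ≠ 0 := by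
    intro h
    have h1 := congrArg Complex.re h
    have h2 := congrArg Complex.im h
    simp at h1 h2
    simp [h1, h2] at hpos
  have hns : ‖(a + b * Complex.I : ℂ)‖ ^ 2 = a ^ 2 + b ^ 2 := by
    rw [← Complex.normSq_eq_norm_sq, Complex.normSq_add_mul_I]
  have h3 := h2 hne
  rw [hns] at h3
  have e : quarticWeight m 0 * ((a * Real.cos θ + b * Real.sin θ) / (a ^ 2 + b ^ 2)) =
      (Complex.exp (θ * Complex.I) * ((quarticWeight m 0 : ℂ) / (a + b * Complex.I))).re := by
    have e1 : Complex.exp (θ * Complex.I) * ((quarticWeight m 0 : ℂ) / (a + b * Complex.I)) =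
      ((quarticWeight m 0 : ℝ) : ℂ) * (Complex.exp (θ * Complex.I) / (a + b * Complex.I)) := by ring
    rw [e1, Complex.re_ofReal_mul, Complex.div_re, Complex.exp_ofReal_mul_I_re,
      Complex.exp_ofReal_mul_I_im, Complex.normSq_add_mul_I]
    simp
    left
    ring
  rw [e, ← Complex.add_re, ← mul_add]
  exact (Complex.abs_re_le_norm _).trans (by rwa [norm_mul, hn, one_mul])

/-! ### Eigenfunctions of the clamped operator and the reflection terms of the kernels -/

/-- The `n`-th derivative of `cos x - sin x - exp (-x)`, extended to `x < 0` by its value at `0`.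
The functions `osc 0 (k * y)` are the generalized eigenfunctions of the clamped operator `∂_y⁴`
on the half-line. -/
noncomputable def osc (n : ℕ) (x : ℝ) : ℝ :=
  Real.cos (max x 0 + n * (Real.pi / 2)) - Real.sin (max x 0 + n * (Real.pi / 2)) -
    (-1) ^ n * Real.exp (-max x 0)

lemma continuous_osc (n : ℕ) : Continuous (osc n) := by unfold osc; fun_prop

lemma abs_osc_le (n : ℕ) (x : ℝ) : |osc n x| ≤ 3 := by
  unfold osc
  have h1 := Real.abs_cos_le_one (max x 0 + n * (Real.pi / 2))
  have h2 := Real.abs_sin_le_one (max x 0 + n * (Real.pi / 2))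
  have h3 : |(-1 : ℝ) ^ n * Real.exp (-max x 0)| ≤ 1 := by
    rw [abs_mul, abs_pow, abs_neg, abs_one, one_pow, one_mul, Real.abs_exp, Real.exp_le_one_iff]
    simp
  calc _ ≤ |Real.cos (max x 0 + n * (Real.pi / 2)) - Real.sin (max x 0 + n * (Real.pi / 2))| +
        |(-1 : ℝ) ^ n * Real.exp (-max x 0)| := abs_sub _ _
    _ ≤ (1 + 1) + 1 := add_le_add ((abs_sub _ _).trans (add_le_add h1 h2)) h3
    _ = 3 := by norm_num

lemma osc_add_four (n : ℕ) : osc (n + 4) = osc n := by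
  ext x
  unfold osc
  have e : max x 0 + ((n + 4 : ℕ) : ℝ) * (Real.pi / 2) =
      max x 0 + n * (Real.pi / 2) + 2 * Real.pi := by push_cast; ring
  rw [e, Real.cos_add_two_pi, Real.sin_add_two_pi, pow_add]
  norm_num

lemma hasDerivAt_osc (n : ℕ) {x : ℝ} (hx : 0 < x) : HasDerivAt (osc n) (osc (n + 1) x) x := by
  have h0 : HasDerivAt (fun x : ℝ => x + n * (Real.pi / 2)) 1 x := (hasDerivAt_id x).add_const _
  have h := (h0.cos.sub h0.sin).sub ((hasDerivAt_id x).neg.exp.const_mul ((-1 : ℝ) ^ n))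
  have e : osc n =ᶠ[𝓝 x] ((fun x : ℝ => Real.cos (x + n * (Real.pi / 2))) -
      (fun x => Real.sin (x + n * (Real.pi / 2)))) - fun x => (-1 : ℝ) ^ n * Real.exp ((-id) x) := by
    filter_upwards [lt_mem_nhds hx] with z hz
    simp [osc, max_eq_left hz.le]
  refine (h.congr_of_eventuallyEq e).congr_deriv ?_
  have e2 : x + ((n + 1 : ℕ) : ℝ) * (Real.pi / 2) = x + n * (Real.pi / 2) + Real.pi / 2 := by
    push_cast; ring
  rw [osc, max_eq_left hx.le, e2, Real.cos_add_pi_div_two, Real.sin_add_pi_div_two]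
  simp [pow_succ]

lemma osc_mul_max (n : ℕ) {k : ℝ} (hk : 0 ≤ k) (y : ℝ) : osc n (k * max y 0) = osc n (k * y) := by
  have : max (k * max y 0) 0 = max (k * y) 0 := by
    rw [mul_max_of_nonneg _ _ hk, mul_zero, max_assoc, max_self]
  simp [osc, this]

lemma osc_add_mul_four (n q : ℕ) : osc (n + 4 * q) = osc n := by
  induction q with
  | zero => rfl
  | succ q ih => rw [mul_add, mul_one, ← add_assoc, osc_add_four, ih]

lemma osc_mod_four (n : ℕ) : osc (n % 4) = osc n := by
  conv_rhs => rw [← Nat.mod_add_div n 4, osc_add_mul_four]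

lemma osc_at_zero {n : ℕ} (hn : n % 4 = 0 ∨ n % 4 = 1) : osc n 0 = 0 := by
  rw [← osc_mod_four]
  rcases hn with h | h <;> simp [h, osc]

/-- The kernels `∂_η ^ m K_i`, where `K_i` is the Green kernel of `∂_t + ∂_y⁴` on the half-line
with the boundary conditions that the `i`-th derivative of a clamped solution satisfies. -/
noncomputable def greenK (m i : ℕ) (t y η : ℝ) : ℝ :=
  Real.pi⁻¹ * ∫ k in Ioi (0 : ℝ), k ^ m * Real.exp (-(k ^ 4 * t)) *
    ((-1) ^ i * osc i (k * y) * osc (m + 3 * i) (k * η))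

lemma greenK_max_left (m i : ℕ) (t y η : ℝ) : greenK m i t (max y 0) η = greenK m i t y η := by
  unfold greenK
  congr 1
  refine setIntegral_congr_fun measurableSet_Ioi fun k hk => ?_
  simp only [osc_mul_max _ (le_of_lt (mem_Ioi.1 hk))]

lemma greenK_add_four (m i : ℕ) : greenK m (i + 4) = greenK m i := by
  ext t y η
  unfold greenK
  rw [osc_add_four, show m + 3 * (i + 4) = m + 3 * i + 4 * 3 by ring, osc_add_mul_four, pow_add]
  norm_num

lemma greenK_add_four' (m i : ℕ) (t y η : ℝ) :
    greenK (m + 4) i t y η = Real.pi⁻¹ * ∫ k in Ioi (0 : ℝ), k ^ (m + 4) *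
      Real.exp (-(k ^ 4 * t)) * ((-1) ^ i * osc i (k * y) * osc (m + 3 * i) (k * η)) := by
  unfold greenK
  rw [show m + 4 + 3 * i = m + 3 * i + 4 by ring, osc_add_four]

/-- The `m`-th derivative in `η` of the fundamental solution of `∂_t + ∂_y⁴` on the line at time
one, at `x = y - η`. -/
noncomputable def lineK (m : ℕ) (x : ℝ) : ℝ :=
  Real.pi⁻¹ * dampedIntegral m 0 x (-(m * (Real.pi / 2)))

/-- The first cosine depends on x - z alone and produces the fundamental solution on the line. Every
other term, once integrated in the frequency, decays in x + z: these are the reflections at the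
boundary. -/
lemma osc_mul_osc (i j : ℕ) {x z : ℝ} (hx : 0 ≤ x) (hz : 0 ≤ z) :
    osc i x * osc j z =
      Real.cos (x - z + (i - j) * (Real.pi / 2)) -
      Real.cos (x + z + ((i + j) * (Real.pi / 2) - Real.pi / 2)) -
      (-1) ^ j * (Real.exp (-z) * Real.cos (x + i * (Real.pi / 2)) -
        Real.exp (-z) * Real.cos (x + (i * (Real.pi / 2) - Real.pi / 2))) -
      (-1) ^ i * (Real.exp (-x) * Real.cos (z + j * (Real.pi / 2)) -
        Real.exp (-x) * Real.cos (z + (j * (Real.pi / 2) - Real.pi / 2))) +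
      (-1) ^ i * (-1) ^ j * (Real.exp (-x) * Real.exp (-z)) := by
  have hs : ∀ u v : ℝ, Real.cos (u + (v - Real.pi / 2)) = Real.sin (u + v) := fun u v => by
    rw [← add_sub_assoc, Real.cos_sub_pi_div_two]
  have e1 : x - z + (i - j) * (Real.pi / 2) =
      (x + i * (Real.pi / 2)) - (z + j * (Real.pi / 2)) := by ring
  have e2 : x + z + (i + j) * (Real.pi / 2) =
      (x + i * (Real.pi / 2)) + (z + j * (Real.pi / 2)) := by ring
  simp only [hs, osc, max_eq_left hx, max_eq_left hz]
  rw [e1, e2]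
  generalize x + i * (Real.pi / 2) = α
  generalize z + j * (Real.pi / 2) = β
  rw [Real.cos_sub, Real.sin_add]
  ring

lemma integral_linear_combination {f₁ f₂ f₃ f₄ f₅ f₆ f₇ : ℝ → ℝ} {μ : Measure ℝ}
    (h₁ : Integrable f₁ μ) (h₂ : Integrable f₂ μ) (h₃ : Integrable f₃ μ) (h₄ : Integrable f₄ μ)
    (h₅ : Integrable f₅ μ) (h₆ : Integrable f₆ μ) (h₇ : Integrable f₇ μ) (c₀ c₁ c₂ c₃ : ℝ) :
    ∫ k, (f₁ k + c₀ * (-f₂ k - c₁ * (f₃ k - f₄ k) - c₂ * (f₅ k - f₆ k) + c₃ * f₇ k)) ∂μ =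
      (∫ k, f₁ k ∂μ) + c₀ * (-(∫ k, f₂ k ∂μ) - c₁ * ((∫ k, f₃ k ∂μ) - ∫ k, f₄ k ∂μ) -
        c₂ * ((∫ k, f₅ k ∂μ) - ∫ k, f₆ k ∂μ) + c₃ * ∫ k, f₇ k ∂μ) := by
  have a₂ : Integrable (fun k => -f₂ k) μ := h₂.neg
  have a₃ : Integrable (fun k => c₁ * (f₃ k - f₄ k)) μ := (h₃.sub h₄).const_mul _
  have a₅ : Integrable (fun k => c₂ * (f₅ k - f₆ k)) μ := (h₅.sub h₆).const_mul _
  have a₇ : Integrable (fun k => c₃ * f₇ k) μ := h₇.const_mul _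
  have b₁ : Integrable (fun k => -f₂ k - c₁ * (f₃ k - f₄ k)) μ := a₂.sub a₃
  have b₂ : Integrable (fun k => -f₂ k - c₁ * (f₃ k - f₄ k) - c₂ * (f₅ k - f₆ k)) μ := b₁.sub a₅
  have b₃ : Integrable (fun k => -f₂ k - c₁ * (f₃ k - f₄ k) - c₂ * (f₅ k - f₆ k) + c₃ * f₇ k) μ :=
    b₂.add a₇
  rw [integral_add h₁ (b₃.const_mul _), integral_const_mul, integral_add b₂ a₇, integral_sub b₁ a₅,
    integral_sub a₂ a₃, integral_neg, integral_const_mul, integral_const_mul, integral_const_mul,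
    integral_sub h₃ h₄, integral_sub h₅ h₆]

/-- The second index m + 3i of the kernel makes the phase of the translation-invariant term equal to
-mπ/2 - iπ. The factor (-1)^i absorbs the multiple of π, so all boundary conditions share the same
free part `lineK`. -/
lemma greenK_one (m i : ℕ) {y η : ℝ} (hy : 0 ≤ y) (hη : 0 ≤ η) :
    greenK m i 1 y η = lineK m (y - η) + Real.pi⁻¹ * ((-1) ^ i * (
      - dampedIntegral m 0 (y + η) ((i + (m + 3 * i : ℕ)) * (Real.pi / 2) - Real.pi / 2)
      - (-1) ^ (m + 3 * i) * (dampedIntegral m (-η) y (i * (Real.pi / 2)) -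
          dampedIntegral m (-η) y (i * (Real.pi / 2) - Real.pi / 2))
      - (-1) ^ i * (dampedIntegral m (-y) η ((m + 3 * i : ℕ) * (Real.pi / 2)) -
          dampedIntegral m (-y) η ((m + 3 * i : ℕ) * (Real.pi / 2) - Real.pi / 2))
      + (-1) ^ i * (-1) ^ (m + 3 * i) * dampedIntegral m (-(y + η)) 0 0)) := by
  have I1 := integrableOn_damped m le_rfl (y - η) (-(m * (Real.pi / 2)))
  have I2 := integrableOn_damped m le_rfl (y + η)
    ((i + (m + 3 * i : ℕ)) * (Real.pi / 2) - Real.pi / 2)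
  have I3 := integrableOn_damped m (neg_nonpos.2 hη) y (i * (Real.pi / 2))
  have I4 := integrableOn_damped m (neg_nonpos.2 hη) y (i * (Real.pi / 2) - Real.pi / 2)
  have I5 := integrableOn_damped m (neg_nonpos.2 hy) η ((m + 3 * i : ℕ) * (Real.pi / 2))
  have I6 := integrableOn_damped m (neg_nonpos.2 hy) η
    ((m + 3 * i : ℕ) * (Real.pi / 2) - Real.pi / 2)
  have I7 := integrableOn_damped m (neg_nonpos.2 (add_nonneg hy hη)) 0 0
  unfold greenK lineK dampedIntegral
  rw [← mul_add]
  congr 1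
  rw [← integral_linear_combination I1 I2 I3 I4 I5 I6 I7]
  refine setIntegral_congr_fun measurableSet_Ioi fun k hk => ?_
  have hk : 0 ≤ k := le_of_lt hk
  have e1 : Real.cos (k * y - k * η + ((i : ℝ) - (m + 3 * i : ℕ)) * (Real.pi / 2)) =
      (-1) ^ i * Real.cos ((y - η) * k + -(m * (Real.pi / 2))) := by
    rw [← Real.cos_sub_nat_mul_pi]
    congr 1
    push_cast
    ring
  have e2 : ((-1 : ℝ) ^ i) * (-1) ^ i = 1 := by rw [← mul_pow]; simp
  have e3 : Real.exp (-(k * y)) * Real.exp (-(k * η)) = Real.exp (-(y + η) * k) := by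
    rw [← Real.exp_add]; congr 1; ring
  have := osc_mul_osc i (m + 3 * i) (mul_nonneg hk hy) (mul_nonneg hk hη)
  rw [mul_assoc ((-1 : ℝ) ^ i) (osc _ _), this, e1, e3]
  simp only [quarticWeight, zero_mul, Real.exp_zero, Real.cos_zero, one_mul, mul_one, add_zero]
  rw [show k * y + k * η = (y + η) * k by ring, show -(k * y) = -y * k by ring,
    show -(k * η) = -η * k by ring, show k * y = y * k by ring, show k * η = η * k by ring]
  linear_combination k ^ m * Real.exp (-k ^ 4) *
    Real.cos ((y - η) * k + -(m * (Real.pi / 2))) * e2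

lemma abs_le_div_one_add_sq {A C X : ℝ} (h1 : |A| ≤ C) (h2 : 0 < X ^ 2 → |A| ≤ C / X ^ 2) :
    |A| ≤ 2 * C / (1 + X ^ 2) := by
  rw [le_div_iff₀ (by positivity)]
  rcases (sq_nonneg X).eq_or_lt with h | h
  · rw [← h]; linarith [(abs_nonneg A).trans h1]
  · have := h2 h
    rw [le_div_iff₀ h] at this
    linarith

lemma exists_bound_lineK (m : ℕ) : ∃ C : ℝ, 0 ≤ C ∧ ∀ x, |lineK m x| ≤ C / (1 + x ^ 2) := by
  obtain ⟨C, hC0, hC⟩ := exists_bound_dampedIntegral m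
  refine ⟨2 * C, by positivity, fun x => ?_⟩
  have hp : |Real.pi⁻¹| ≤ 1 := by
    rw [abs_inv, abs_of_pos Real.pi_pos]
    exact inv_le_one_of_one_le₀ (by linarith [Real.pi_gt_three])
  refine abs_le_div_one_add_sq ?_ fun hx => ?_
  · unfold lineK
    rw [abs_mul]
    exact (mul_le_of_le_one_left (abs_nonneg _) hp).trans (hC _ _ _ le_rfl).1
  · unfold lineK
    rw [abs_mul]
    refine (mul_le_of_le_one_left (abs_nonneg _) hp).trans ?_
    have h := (hC 0 x (-(m * (Real.pi / 2))) le_rfl).2 (by simpa using hx)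
    -- For m > 0 the weight vanishes at 0; for m = 0 the phase is zero, and so is its sine.
    have e : quarticWeight m 0 * ((0 * Real.cos (-(m * (Real.pi / 2))) +
        x * Real.sin (-(m * (Real.pi / 2)))) / (0 ^ 2 + x ^ 2)) = 0 := by
      rcases Nat.eq_zero_or_pos m with rfl | hm
      · simp
      · simp [quarticWeight, hm.ne']
    rw [e, add_zero] at h
    simpa using h

/-- Each reflection term is of second order in the inverse of its complex frequency, up to a leading
term that is nonzero only for m = 0. For m = 0 the six leading terms add up to zero, which is what
makes the decay integrable. -/
lemma exists_bound_greenK_sub_lineK (m : ℕ) : ∃ C : ℝ, 0 ≤ C ∧ ∀ (i : ℕ) (y η : ℝ), 0 ≤ y → 0 ≤ η →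
    |greenK m i 1 y η - lineK m (y - η)| ≤ C / (1 + (y + η) ^ 2) := by
  obtain ⟨C, hC0, hC⟩ := exists_bound_dampedIntegral m
  refine ⟨2 * (12 * C), by positivity, fun i y η hy hη => ?_⟩
  have hp : |Real.pi⁻¹| ≤ 1 := by
    rw [abs_inv, abs_of_pos Real.pi_pos]
    exact inv_le_one_of_one_le₀ (by linarith [Real.pi_gt_three])
  have hs : ∀ n : ℕ, |(-1 : ℝ) ^ n| = 1 := fun n => by simp
  have hcomb : ∀ a b c d e f : ℝ, ∀ D : ℝ, |a| ≤ D → |b| ≤ D → |c| ≤ D → |d| ≤ D → |e| ≤ D →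
      |f| ≤ D → |Real.pi⁻¹ * ((-1) ^ i * (-a - (-1) ^ (m + 3 * i) * (b - c) -
        (-1) ^ i * (d - e) + (-1) ^ i * (-1) ^ (m + 3 * i) * f))| ≤ 6 * D := by
    intro a b c d e f D ha hb hc hd he hf
    rw [abs_mul, abs_mul, hs, one_mul]
    refine (mul_le_of_le_one_left (abs_nonneg _) hp).trans ?_
    have h1 := abs_add_le (-a - (-1) ^ (m + 3 * i) * (b - c) - (-1) ^ i * (d - e))
      ((-1) ^ i * (-1) ^ (m + 3 * i) * f)
    have h2 := abs_sub (-a - (-1) ^ (m + 3 * i) * (b - c)) ((-1) ^ i * (d - e))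
    have h3 := abs_sub (-a) ((-1) ^ (m + 3 * i) * (b - c))
    rw [abs_mul, abs_mul, hs, hs, one_mul, one_mul] at h1
    rw [abs_mul, hs, one_mul] at h2
    rw [abs_mul, hs, one_mul, abs_neg] at h3
    have h4 := abs_sub b c
    have h5 := abs_sub d e
    linarith
  rw [greenK_one m i hy hη, add_sub_cancel_left]
  set θ₁ : ℝ := (i + (m + 3 * i : ℕ)) * (Real.pi / 2) - Real.pi / 2 with hθ₁
  set θ₂ : ℝ := i * (Real.pi / 2) with hθ₂
  set θ₃ : ℝ := (m + 3 * i : ℕ) * (Real.pi / 2) with hθ₃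
  refine abs_le_div_one_add_sq ?_ fun hX => ?_
  · refine (hcomb _ _ _ _ _ _ C (hC _ _ _ le_rfl).1 (hC _ _ _ (neg_nonpos.2 hη)).1
      (hC _ _ _ (neg_nonpos.2 hη)).1 (hC _ _ _ (neg_nonpos.2 hy)).1
      (hC _ _ _ (neg_nonpos.2 hy)).1 (hC _ _ _ (neg_nonpos.2 (add_nonneg hy hη))).1).trans
      (by linarith)
  · have hpos : 0 < y + η := by
      rcases (add_nonneg hy hη).eq_or_lt with h | h
      · rw [← h] at hX; simp at hX
      · exact h
    -- The mixed terms, oscillating in one variable and damped in the other, have a frequency of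
    -- squared modulus y² + η², which is comparable with (y + η)².
    have hD : (y + η) ^ 2 ≤ 2 * (η ^ 2 + y ^ 2) := by nlinarith [sq_nonneg (y - η)]
    have hD0 : 0 < η ^ 2 + y ^ 2 := by nlinarith
    set X := y + η with hXdef
    have hsum : quarticWeight m 0 = 0 ∨ m = 0 := by
      rcases Nat.eq_zero_or_pos m with h | h
      · exact Or.inr h
      · exact Or.inl (by simp [quarticWeight, h.ne'])
    have B1 := (hC 0 X θ₁ le_rfl).2 (by simpa using hX)
    have B2 := (hC (-η) y θ₂ (neg_nonpos.2 hη)).2 (by simpa using hD0)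
    have B3 := (hC (-η) y (θ₂ - Real.pi / 2) (neg_nonpos.2 hη)).2 (by simpa using hD0)
    have B4 := (hC (-y) η θ₃ (neg_nonpos.2 hy)).2 (by simpa [add_comm] using hD0)
    have B5 := (hC (-y) η (θ₃ - Real.pi / 2) (neg_nonpos.2 hy)).2 (by simpa [add_comm] using hD0)
    have B6 := (hC (-X) 0 0 (neg_nonpos.2 hpos.le)).2 (by simpa using hX)
    have hC2 : C / (η ^ 2 + y ^ 2) ≤ 2 * C / X ^ 2 := by
      rw [div_le_div_iff₀ hD0 hX]
      nlinarith
    have hC1 : C / X ^ 2 ≤ 2 * C / X ^ 2 := by gcongr; linarith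
    rw [neg_sq] at B2 B3 B4 B5 B6
    rw [add_comm (y ^ 2)] at B4 B5
    have B := hcomb _ _ _ _ _ _ (2 * C / X ^ 2) (B1.trans (by simpa using hC1)) (B2.trans hC2)
      (B3.trans hC2) (B4.trans hC2) (B5.trans hC2) (B6.trans (by simpa using hC1))
    refine le_trans (le_of_eq ?_) (B.trans (le_of_eq (by ring)))
    congr 1
    rcases hsum with h0 | h0
    · simp [h0]
    -- The case m = 0: θ₂ + θ₃ is a multiple of 2π, so all leading terms are expressed through the
    -- sine and cosine of θ₂, and they cancel identically.
    · subst h0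
      have e1 : Real.cos θ₁ = 0 := by
        rw [hθ₁, Real.cos_sub_pi_div_two, show ((i : ℝ) + (0 + 3 * i : ℕ)) * (Real.pi / 2) =
          (2 * i : ℕ) * Real.pi by push_cast; ring, Real.sin_nat_mul_pi]
      have e2 : Real.sin θ₁ = -1 := by
        rw [hθ₁, Real.sin_sub_pi_div_two, show ((i : ℝ) + (0 + 3 * i : ℕ)) * (Real.pi / 2) =
          i * (2 * Real.pi) by push_cast; ring, Real.cos_nat_mul_two_pi]
      have e3 : θ₃ = i * (2 * Real.pi) - θ₂ := by rw [hθ₂, hθ₃]; push_cast; ring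
      have e4 : Real.cos θ₃ = Real.cos θ₂ := by rw [e3, Real.cos_nat_mul_two_pi_sub]
      have e5 : Real.sin θ₃ = -Real.sin θ₂ := by rw [e3, Real.sin_nat_mul_two_pi_sub]
      have e6 : (-1 : ℝ) ^ (0 + 3 * i) = (-1) ^ i := by
        rw [zero_add, pow_mul]; norm_num
      have e7 : ((-1 : ℝ) ^ i) * (-1) ^ i = 1 := by rw [← mul_pow]; simp
      rw [e6, e7, e1, e2, Real.cos_sub_pi_div_two θ₂, Real.sin_sub_pi_div_two θ₂,
        Real.cos_sub_pi_div_two θ₃, Real.sin_sub_pi_div_two θ₃, e4, e5, Real.cos_zero,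
        Real.sin_zero]
      congr 2
      have : X ≠ 0 := hpos.ne'
      have : η ^ 2 + y ^ 2 ≠ 0 := hD0.ne'
      field_simp
      ring

/-! ### Parabolic scaling and the pointwise bound of the kernels -/

/-- The parabolic length scale `t ^ (1 / 4)`. -/
noncomputable def scale (t : ℝ) : ℝ := t ^ (1 / 4 : ℝ)

lemma scale_pos {t : ℝ} (ht : 0 < t) : 0 < scale t := Real.rpow_pos_of_pos ht _

lemma scale_pow_four {t : ℝ} (ht : 0 ≤ t) : scale t ^ 4 = t := by
  rw [scale, ← Real.rpow_natCast, ← Real.rpow_mul ht]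
  norm_num

lemma scale_mono {s t : ℝ} (hs : 0 ≤ s) (h : s ≤ t) : scale s ≤ scale t :=
  Real.rpow_le_rpow hs h (by norm_num)

lemma continuous_scale : Continuous scale := Real.continuous_rpow_const (by norm_num)

lemma scale_zero : scale 0 = 0 := Real.zero_rpow (by norm_num)

lemma tendsto_scale_zero : Tendsto scale (𝓝 0) (𝓝 0) := by
  simpa [scale_zero] using continuous_scale.tendsto 0

/-- A multiple of the Cauchy density of width `τ`. -/
noncomputable def cauchyK (τ x : ℝ) : ℝ := τ⁻¹ * (1 + (x / τ) ^ 2)⁻¹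

lemma cauchyK_nonneg {τ : ℝ} (hτ : 0 ≤ τ) (x : ℝ) : 0 ≤ cauchyK τ x := by
  unfold cauchyK; positivity

lemma continuous_cauchyK (τ : ℝ) : Continuous (cauchyK τ) := by
  unfold cauchyK
  exact continuous_const.mul (Continuous.inv₀ (by fun_prop) fun x => by positivity)

lemma integrable_cauchyK {τ : ℝ} (hτ : 0 < τ) : Integrable (cauchyK τ) :=
  (integrable_inv_one_add_sq.comp_div hτ.ne').const_mul _

lemma integral_cauchyK {τ : ℝ} (hτ : 0 < τ) : ∫ x, cauchyK τ x = Real.pi := by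
  unfold cauchyK
  rw [integral_const_mul, Measure.integral_comp_div (fun x : ℝ => (1 + x ^ 2)⁻¹) τ,
    integral_univ_inv_one_add_sq, abs_of_pos hτ, smul_eq_mul, inv_mul_cancel_left₀ hτ.ne']

lemma integrable_cauchyK_sub_left {τ : ℝ} (hτ : 0 < τ) (y : ℝ) :
    Integrable fun η => cauchyK τ (y - η) := (integrable_cauchyK hτ).comp_sub_left y

lemma integral_cauchyK_sub_left {τ : ℝ} (hτ : 0 < τ) (y : ℝ) :
    ∫ η, cauchyK τ (y - η) = Real.pi := by
  rw [integral_sub_left_eq_self (cauchyK τ), integral_cauchyK hτ]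

lemma greenK_scale (m i : ℕ) {τ : ℝ} (hτ : 0 < τ) (y η : ℝ) :
    greenK m i (τ ^ 4) y η = (τ ^ (m + 1))⁻¹ * greenK m i 1 (y / τ) (η / τ) := by
  unfold greenK
  have h := integral_comp_mul_right_Ioi (fun k => k ^ m * Real.exp (-(k ^ 4 * 1)) *
    ((-1) ^ i * osc i (k * (y / τ)) * osc (m + 3 * i) (k * (η / τ)))) 0 hτ
  rw [zero_mul, smul_eq_mul, eq_inv_mul_iff_mul_eq₀ hτ.ne'] at h
  rw [← h, mul_left_comm]
  congr 1
  rw [← integral_const_mul, ← integral_const_mul]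
  congr 1
  refine funext fun k => ?_
  have e : ∀ y : ℝ, k * τ * (y / τ) = k * y := fun y => by field_simp
  rw [e, e]
  field_simp
  ring

/-- By scaling it is enough to treat t = 1. On the quarter-plane |y - η| ≤ y + η, so the reflection
terms obey the bound of the free part. -/
lemma exists_bound_greenK (m : ℕ) : ∃ C : ℝ, 0 ≤ C ∧ ∀ (i : ℕ) (t y η : ℝ), 0 < t → 0 ≤ y → 0 ≤ η →
    |greenK m i t y η| ≤ C * (scale t ^ m)⁻¹ * cauchyK (scale t) (y - η) := by
  obtain ⟨C₁, h₁, H₁⟩ := exists_bound_lineK m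
  obtain ⟨C₂, h₂, H₂⟩ := exists_bound_greenK_sub_lineK m
  refine ⟨C₁ + C₂, by positivity, fun i t y η ht hy hη => ?_⟩
  have hτ := scale_pos ht
  set τ := scale t with hτd
  have hone : ∀ y η : ℝ, 0 ≤ y → 0 ≤ η → |greenK m i 1 y η| ≤ (C₁ + C₂) * (1 + (y - η) ^ 2)⁻¹ := by
    intro y η hy hη
    have a := H₁ (y - η)
    have b := H₂ i y η hy hη
    have b' : C₂ / (1 + (y + η) ^ 2) ≤ C₂ / (1 + (y - η) ^ 2) := by
      gcongr 1
      nlinarith [mul_nonneg hy hη]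
    have := abs_add_le (lineK m (y - η)) (greenK m i 1 y η - lineK m (y - η))
    rw [add_sub_cancel] at this
    refine this.trans ((add_le_add a (b.trans b')).trans (le_of_eq ?_))
    rw [← add_div, div_eq_mul_inv]
  have h := hone (y / τ) (η / τ) (by positivity) (by positivity)
  rw [← scale_pow_four ht.le, ← hτd, greenK_scale m i hτ, abs_mul, abs_of_pos (by positivity)]
  calc _ ≤ (τ ^ (m + 1))⁻¹ * ((C₁ + C₂) * (1 + (y / τ - η / τ) ^ 2)⁻¹) := by gcongr
    _ = _ := by
      unfold cauchyK
      rw [← sub_div, pow_succ, mul_inv]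
      ring

/-- A constant in the pointwise bound of the kernels `greenK m i`. -/
noncomputable def greenC (m : ℕ) : ℝ := (exists_bound_greenK m).choose

lemma greenC_nonneg (m : ℕ) : 0 ≤ greenC m := (exists_bound_greenK m).choose_spec.1

lemma abs_greenK_le (m i : ℕ) {t y η : ℝ} (ht : 0 < t) (hy : 0 ≤ y) (hη : 0 ≤ η) :
    |greenK m i t y η| ≤ greenC m * (scale t ^ m)⁻¹ * cauchyK (scale t) (y - η) :=
  (exists_bound_greenK m).choose_spec.2 i t y η ht hy hη

/-- A majorant independent of t, for dominated convergence when the time varies in a compact subset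
of (0, ∞). -/
lemma exists_locally_uniform_bound_greenK (m i : ℕ) {a b : ℝ} (ha : 0 < a) :
    ∃ D : ℝ, 0 ≤ D ∧ ∀ t ∈ Icc a b, ∀ y η : ℝ, 0 ≤ y → 0 ≤ η →
      |greenK m i t y η| ≤ D * (1 + (y - η) ^ 2)⁻¹ := by
  refine ⟨greenC m * (scale a ^ m)⁻¹ * ((scale a)⁻¹ * (1 + scale b ^ 2)), ?_,
    fun t ht y η hy hη => ?_⟩
  · have := greenC_nonneg m
    have := scale_pos ha
    positivity
  have h0 := greenC_nonneg m
  have h1 := scale_pos ha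
  have h2 := scale_mono ha.le ht.1
  have h3 := scale_mono (ha.le.trans ht.1) ht.2
  have ht0 : 0 < t := ha.trans_le ht.1
  have h4 := scale_pos ht0
  refine (abs_greenK_le m i ht0 hy hη).trans ?_
  unfold cauchyK
  generalize y - η = x
  have hx : (1 + (x / scale t) ^ 2)⁻¹ ≤ (1 + scale b ^ 2) * (1 + x ^ 2)⁻¹ := by
    rw [← div_eq_mul_inv, inv_le_iff_one_le_mul₀ (by positivity), div_mul_eq_mul_div,
      le_div_iff₀ (by positivity)]
    have hsq : scale t ^ 2 ≤ scale b ^ 2 := by gcongr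
    have e : scale t ^ 2 * (x / scale t) ^ 2 = x ^ 2 := by field_simp
    nlinarith [sq_nonneg (x / scale t), sq_nonneg (scale b)]
  calc _ ≤ greenC m * (scale a ^ m)⁻¹ * ((scale a)⁻¹ * ((1 + scale b ^ 2) * (1 + x ^ 2)⁻¹)) := by
        gcongr
    _ = _ := by ring

/-! ### Continuity and derivatives of the kernels -/

lemma abs_greenK_integrand_le (m i j : ℕ) {t k : ℝ} (hk : 0 < k) (y η : ℝ) :
    |k ^ m * Real.exp (-(k ^ 4 * t)) * ((-1) ^ i * osc i (k * y) * osc j (k * η))| ≤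
      9 * (k ^ m * Real.exp (-(k ^ 4 * t))) := by
  rw [abs_mul, abs_mul, Real.abs_exp, abs_pow, abs_of_pos hk, abs_mul, abs_mul, abs_pow, abs_neg,
    abs_one, one_pow, one_mul]
  have := mul_le_mul (abs_osc_le i (k * y)) (abs_osc_le j (k * η)) (abs_nonneg _) (by norm_num)
  rw [mul_comm]
  gcongr
  linarith

lemma aestronglyMeasurable_greenK_integrand (m i j : ℕ) (t y η : ℝ) :
    AEStronglyMeasurable (fun k : ℝ => k ^ m * Real.exp (-(k ^ 4 * t)) *
      ((-1) ^ i * osc i (k * y) * osc j (k * η))) (volume.restrict (Ioi 0)) := by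
  have := continuous_osc i
  have := continuous_osc j
  exact Continuous.aestronglyMeasurable (by fun_prop)

lemma integrableOn_greenK_integrand (m i j : ℕ) {t : ℝ} (ht : 0 < t) (y η : ℝ) :
    IntegrableOn (fun k : ℝ => k ^ m * Real.exp (-(k ^ 4 * t)) *
      ((-1) ^ i * osc i (k * y) * osc j (k * η))) (Ioi 0) := by
  refine ((integrableOn_pow_mul_exp m ht).const_mul 9).mono'
    (aestronglyMeasurable_greenK_integrand m i j t y η) ?_
  filter_upwards [ae_restrict_mem measurableSet_Ioi] with k hk
  exact abs_greenK_integrand_le m i j hk y η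

lemma continuousOn_greenK (m i : ℕ) :
    ContinuousOn (fun p : ℝ × ℝ × ℝ => greenK m i p.1 p.2.1 p.2.2) (Ioi 0 ×ˢ univ) := by
  rintro ⟨t, y, η⟩ ⟨ht, -⟩
  have ht : 0 < t := ht
  refine ContinuousAt.continuousWithinAt (ContinuousAt.const_mul ?_ _)
  have := continuous_osc i
  have := continuous_osc (m + 3 * i)
  refine continuousAt_of_dominated (bound := fun k => 9 * (k ^ m * Real.exp (-(k ^ 4 * (t / 2)))))
    (Eventually.of_forall fun p => aestronglyMeasurable_greenK_integrand m i _ _ _ _) ?_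
    ((integrableOn_pow_mul_exp m (half_pos ht)).const_mul 9) ?_
  · have : ∀ᶠ p : ℝ × ℝ × ℝ in 𝓝 (t, y, η), t / 2 < p.1 :=
      continuousAt_fst.eventually (lt_mem_nhds (half_lt_self ht))
    filter_upwards [this] with p hp
    filter_upwards [ae_restrict_mem measurableSet_Ioi] with k hk
    refine (abs_greenK_integrand_le m i _ hk _ _).trans ?_
    have hk : 0 < k := hk
    gcongr
  · refine Eventually.of_forall fun k => Continuous.continuousAt (by fun_prop)

/-- The family is closed under ∂_y: differentiation produces a factor k and raises the index of the
first eigenfunction. The second index of the new kernel is m + 3i + 4, the same modulo the period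
four, and the sign comes from (-1)^i. -/
lemma hasDerivAt_greenK_left (m i : ℕ) {t y : ℝ} (ht : 0 < t) (hy : 0 < y) (η : ℝ) :
    HasDerivAt (fun y => greenK m i t y η) (-greenK (m + 1) (i + 1) t y η) y := by
  unfold greenK
  rw [← mul_neg, ← integral_neg]
  refine HasDerivAt.const_mul _ ?_
  refine (hasDerivAt_integral_of_dominated_loc_of_deriv_le
    (bound := fun k => 9 * (k ^ (m + 1) * Real.exp (-(k ^ 4 * t)))) (Ioi_mem_nhds hy)
    (Eventually.of_forall fun y => aestronglyMeasurable_greenK_integrand m i _ t y η)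
    (integrableOn_greenK_integrand m i _ ht y η)
    (F' := fun y k => -(k ^ (m + 1) * Real.exp (-(k ^ 4 * t)) * ((-1) ^ (i + 1) * osc (i + 1) (k * y)
      * osc (m + 1 + 3 * (i + 1)) (k * η))))
    (aestronglyMeasurable_greenK_integrand (m + 1) (i + 1) _ t y η).neg ?_
    ((integrableOn_pow_mul_exp (m + 1) ht).const_mul 9) ?_).2
  · filter_upwards [ae_restrict_mem measurableSet_Ioi] with k hk z _
    rw [norm_neg]
    exact abs_greenK_integrand_le (m + 1) (i + 1) _ hk z η
  · filter_upwards [ae_restrict_mem measurableSet_Ioi] with k hk z hz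
    have hkz : 0 < k * z := mul_pos hk hz
    have h := ((hasDerivAt_osc i hkz).comp z ((hasDerivAt_id z).const_mul k))
    have h2 := ((h.const_mul ((-1 : ℝ) ^ i)).mul_const (osc (m + 3 * i) (k * η))).const_mul
      (k ^ m * Real.exp (-(k ^ 4 * t)))
    refine h2.congr_deriv ?_
    rw [show m + 1 + 3 * (i + 1) = m + 3 * i + 4 by ring, osc_add_four]
    ring

lemma hasDerivAt_greenK_right (m i : ℕ) {t η : ℝ} (ht : 0 < t) (y : ℝ) (hη : 0 < η) :
    HasDerivAt (fun η => greenK m i t y η) (greenK (m + 1) i t y η) η := by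
  unfold greenK
  refine HasDerivAt.const_mul _ ?_
  refine (hasDerivAt_integral_of_dominated_loc_of_deriv_le
    (bound := fun k => 9 * (k ^ (m + 1) * Real.exp (-(k ^ 4 * t)))) (Ioi_mem_nhds hη)
    (Eventually.of_forall fun η => aestronglyMeasurable_greenK_integrand m i _ t y η)
    (integrableOn_greenK_integrand m i _ ht y η)
    (F' := fun η k => k ^ (m + 1) * Real.exp (-(k ^ 4 * t)) * ((-1) ^ i * osc i (k * y)
      * osc (m + 1 + 3 * i) (k * η)))
    (aestronglyMeasurable_greenK_integrand (m + 1) i _ t y η) ?_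
    ((integrableOn_pow_mul_exp (m + 1) ht).const_mul 9) ?_).2
  · filter_upwards [ae_restrict_mem measurableSet_Ioi] with k hk z _
    exact abs_greenK_integrand_le (m + 1) i _ hk y z
  · filter_upwards [ae_restrict_mem measurableSet_Ioi] with k hk z hz
    have hkz : 0 < k * z := mul_pos hk hz
    have h := ((hasDerivAt_osc (m + 3 * i) hkz).comp z ((hasDerivAt_id z).const_mul k))
    have h2 := (h.const_mul ((-1 : ℝ) ^ i * osc i (k * y))).const_mul
      (k ^ m * Real.exp (-(k ^ 4 * t)))
    refine h2.congr_deriv ?_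
    rw [show m + 1 + 3 * i = m + 3 * i + 1 by ring]
    ring

lemma hasDerivAt_greenK_time (m i : ℕ) {t : ℝ} (ht : 0 < t) (y η : ℝ) :
    HasDerivAt (fun t => greenK m i t y η) (-greenK (m + 4) i t y η) t := by
  rw [greenK_add_four', ← mul_neg, ← integral_neg]
  unfold greenK
  refine HasDerivAt.const_mul _ ?_
  refine (hasDerivAt_integral_of_dominated_loc_of_deriv_le
    (bound := fun k => 9 * (k ^ (m + 4) * Real.exp (-(k ^ 4 * (t / 2)))))
    (Ioi_mem_nhds (half_lt_self ht))
    (Eventually.of_forall fun t => aestronglyMeasurable_greenK_integrand m i _ t y η)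
    (integrableOn_greenK_integrand m i _ ht y η)
    (F' := fun t k => -(k ^ (m + 4) * Real.exp (-(k ^ 4 * t)) * ((-1) ^ i * osc i (k * y)
      * osc (m + 3 * i) (k * η))))
    (aestronglyMeasurable_greenK_integrand (m + 4) i _ t y η).neg ?_
    ((integrableOn_pow_mul_exp (m + 4) (half_pos ht)).const_mul 9) ?_).2
  · filter_upwards [ae_restrict_mem measurableSet_Ioi] with k hk s hs
    rw [norm_neg]
    refine (abs_greenK_integrand_le (m + 4) i _ hk y η).trans ?_
    have hk : 0 < k := hk
    have hs : t / 2 < s := hs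
    gcongr
  · filter_upwards [ae_restrict_mem measurableSet_Ioi] with k hk s hs
    have h := (((hasDerivAt_id s).const_mul (k ^ 4)).neg.exp.const_mul (k ^ m)).mul_const
      ((-1) ^ i * osc i (k * y) * osc (m + 3 * i) (k * η))
    refine h.congr_deriv ?_
    simp only [Pi.neg_apply, id]
    ring

/-! ### The fundamental solution on the line -/

lemma continuous_lineK (m : ℕ) : Continuous (lineK m) := by
  unfold lineK dampedIntegral
  refine continuous_const.mul (continuous_of_dominated (bound := fun k => |quarticWeight m k|)
    (fun x => ?_) (fun x => ?_) (integrableOn_quarticWeight m).abs ?_)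
  · have := continuous_quarticWeight m
    exact Continuous.aestronglyMeasurable (by fun_prop)
  · refine Eventually.of_forall fun k => ?_
    rw [norm_mul, Real.norm_eq_abs, zero_mul, Real.exp_zero, one_mul]
    exact mul_le_of_le_one_right (abs_nonneg _) (Real.abs_cos_le_one _)
  · exact Eventually.of_forall fun k => by fun_prop

lemma integrable_lineK (m : ℕ) : Integrable (lineK m) := by
  obtain ⟨C, -, hC⟩ := exists_bound_lineK m
  refine (integrable_inv_one_add_sq.const_mul C).mono' (continuous_lineK m).aestronglyMeasurable ?_
  exact Eventually.of_forall fun x => by simpa [div_eq_mul_inv] using hC x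

lemma integrable_exp_neg_pow_four {c : ℝ} (hc : c ≠ 0) :
    Integrable fun v : ℝ => Real.exp (-(c * v) ^ 4) := by
  have h2 : Integrable (fun v : ℝ => Real.exp (-v ^ 4)) := by
    refine ((integrable_exp_neg_mul_sq one_pos).const_mul (Real.exp (1 / 4))).mono'
      (Continuous.aestronglyMeasurable (by fun_prop)) (Eventually.of_forall fun v => ?_)
    rw [Real.norm_eq_abs, Real.abs_exp, ← Real.exp_add, Real.exp_le_exp]
    nlinarith [sq_nonneg (v ^ 2 - 1 / 2)]
  exact h2.comp_mul_left' hc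

/-- `lineK 0` is the Fourier transform of exp(-(2πv)⁴), so its integral is the value of that
function at 0 by Fourier inversion. -/
lemma integral_lineK_zero : ∫ x, lineK 0 x = 1 := by
  set h : ℝ → ℂ := fun v => (Real.exp (-(2 * Real.pi * v) ^ 4) : ℂ) with hh
  have hc : Continuous h := by fun_prop
  have hi : Integrable h := (integrable_exp_neg_pow_four (by positivity)).ofReal
  have hF : FourierTransform.fourier h = fun w => (lineK 0 w : ℂ) := by
    ext w
    rw [Real.fourier_eq']
    have hE : ∀ v : ℝ, Complex.exp ((((-2 * Real.pi * inner ℝ v w : ℝ)) : ℂ) * Complex.I) • h v =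
        ((Real.cos (2 * Real.pi * v * w) * Real.exp (-(2 * Real.pi * v) ^ 4) : ℝ) : ℂ) -
        ((Real.sin (2 * Real.pi * v * w) * Real.exp (-(2 * Real.pi * v) ^ 4) : ℝ) : ℂ) *
          Complex.I := by
      intro v
      rw [Complex.exp_mul_I, smul_eq_mul, ← Complex.ofReal_cos, ← Complex.ofReal_sin,
        show (-2 * Real.pi * inner ℝ v w : ℝ) = -(2 * Real.pi * v * w) by
          simp [mul_comm w]; ring, Real.cos_neg, Real.sin_neg, hh]
      push_cast
      ring
    have hr : Integrable fun v : ℝ => Real.exp (-(2 * Real.pi * v) ^ 4) :=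
      integrable_exp_neg_pow_four (by positivity)
    have hi1 : Integrable fun v : ℝ =>
        Real.cos (2 * Real.pi * v * w) * Real.exp (-(2 * Real.pi * v) ^ 4) :=
      hr.bdd_mul (c := 1) (Continuous.aestronglyMeasurable (by fun_prop))
        (Eventually.of_forall fun v => Real.abs_cos_le_one _)
    have hi2 : Integrable fun v : ℝ =>
        Real.sin (2 * Real.pi * v * w) * Real.exp (-(2 * Real.pi * v) ^ 4) :=
      hr.bdd_mul (c := 1) (Continuous.aestronglyMeasurable (by fun_prop))
        (Eventually.of_forall fun v => Real.abs_sin_le_one _)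
    have hodd : ∫ v : ℝ, Real.sin (2 * Real.pi * v * w) * Real.exp (-(2 * Real.pi * v) ^ 4) = 0 := by
      have h1 := integral_neg_eq_self (fun v : ℝ =>
        Real.sin (2 * Real.pi * v * w) * Real.exp (-(2 * Real.pi * v) ^ 4)) volume
      have h2 : ∀ v : ℝ, Real.sin (2 * Real.pi * -v * w) * Real.exp (-(2 * Real.pi * -v) ^ 4) =
          -(Real.sin (2 * Real.pi * v * w) * Real.exp (-(2 * Real.pi * v) ^ 4)) := by
        intro v
        rw [show 2 * Real.pi * -v * w = -(2 * Real.pi * v * w) by ring, Real.sin_neg,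
          show (2 * Real.pi * -v) ^ 4 = (2 * Real.pi * v) ^ 4 by ring]
        ring
      simp only [h2, integral_neg] at h1
      linarith
    simp_rw [hE]
    rw [integral_sub hi1.ofReal (hi2.ofReal.mul_const _), integral_mul_const,
      integral_complex_ofReal, integral_complex_ofReal, hodd, Complex.ofReal_zero, zero_mul,
      sub_zero]
    congr 1
    have h3 := integral_comp_abs (f := fun v : ℝ =>
      Real.cos (2 * Real.pi * v * w) * Real.exp (-(2 * Real.pi * v) ^ 4))
    have h4 : ∀ v : ℝ, Real.cos (2 * Real.pi * |v| * w) * Real.exp (-(2 * Real.pi * |v|) ^ 4) =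
        Real.cos (2 * Real.pi * v * w) * Real.exp (-(2 * Real.pi * v) ^ 4) := by
      intro v
      rcases abs_cases v with ⟨h, -⟩ | ⟨h, -⟩
      · rw [h]
      · rw [h, show 2 * Real.pi * -v * w = -(2 * Real.pi * v * w) by ring, Real.cos_neg,
          show (2 * Real.pi * -v) ^ 4 = (2 * Real.pi * v) ^ 4 by ring]
    simp only [h4] at h3
    rw [h3]
    have h5 := integral_comp_mul_left_Ioi (fun k : ℝ => Real.cos (k * w) * Real.exp (-k ^ 4)) 0
      (show 0 < 2 * Real.pi by positivity)
    rw [h5, mul_zero, smul_eq_mul, lineK, dampedIntegral, ← mul_assoc]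
    congr 1
    · field_simp
    · refine setIntegral_congr_fun measurableSet_Ioi fun k _ => ?_
      simp [quarticWeight, mul_comm]
  have hinv := hc.fourierInv_fourier_eq hi (by rw [hF]; exact (integrable_lineK 0).ofReal)
  have h0 := congrFun hinv 0
  rw [hF, Real.fourierInv_eq] at h0
  simp [hh, integral_complex_ofReal] at h0
  exact_mod_cast h0

/-! ### The integral operators with kernels `greenK` -/

/-- The integral operator with kernel `greenK m i t`. -/
noncomputable def greenOp (m i : ℕ) (t : ℝ) (f : ℝ → ℝ) (y : ℝ) : ℝ :=
  ∫ η in Ioi (0 : ℝ), greenK m i t y η * f η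

/-- A constant in the bounds of the operators `greenOp m i`. -/
noncomputable def opC (m : ℕ) : ℝ := greenC m * Real.pi

lemma opC_nonneg (m : ℕ) : 0 ≤ opC m := mul_nonneg (greenC_nonneg m) Real.pi_pos.le

lemma greenOp_max (m i : ℕ) (t : ℝ) (f : ℝ → ℝ) (y : ℝ) :
    greenOp m i t f (max y 0) = greenOp m i t f y := by
  simp only [greenOp, greenK_max_left]

lemma greenOp_add_four (m i : ℕ) : greenOp m (i + 4) = greenOp m i := by
  ext t f y
  simp only [greenOp, greenK_add_four]

lemma abs_greenK_le_max (m i : ℕ) {t η : ℝ} (ht : 0 < t) (y : ℝ) (hη : 0 ≤ η) :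
    |greenK m i t y η| ≤ greenC m * (scale t ^ m)⁻¹ * cauchyK (scale t) (max y 0 - η) := by
  rw [← greenK_max_left]
  exact abs_greenK_le m i ht (le_max_right _ _) hη

lemma continuous_greenK_right (m i : ℕ) {t : ℝ} (ht : 0 < t) (y : ℝ) :
    Continuous (greenK m i t y) :=
  (continuousOn_greenK m i).comp_continuous (f := fun η => (t, y, η)) (by fun_prop)
    fun η => ⟨ht, mem_univ _⟩

lemma integrableOn_greenK (m i : ℕ) {t : ℝ} (ht : 0 < t) (y : ℝ) :
    IntegrableOn (greenK m i t y) (Ioi 0) := by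
  refine Integrable.mono' ((integrable_cauchyK_sub_left (scale_pos ht) (max y 0)).const_mul
    (greenC m * (scale t ^ m)⁻¹)).integrableOn
    (continuous_greenK_right m i ht y).aestronglyMeasurable ?_
  filter_upwards [ae_restrict_mem measurableSet_Ioi] with η hη
  exact abs_greenK_le_max m i ht y (le_of_lt hη)

lemma integrableOn_greenK_mul (m i : ℕ) {t : ℝ} (ht : 0 < t) (y : ℝ) {f : ℝ → ℝ} {B : ℝ}
    (hf : Continuous f) (hB : ∀ y, |f y| ≤ B) :
    IntegrableOn (fun η => greenK m i t y η * f η) (Ioi 0) :=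
  Integrable.mul_bdd (c := B) (integrableOn_greenK m i ht y) hf.aestronglyMeasurable
    (Eventually.of_forall fun y => hB y)

lemma setIntegral_cauchyK_le {τ : ℝ} (hτ : 0 < τ) (y : ℝ) :
    ∫ η in Ioi (0 : ℝ), cauchyK τ (y - η) ≤ Real.pi := by
  rw [← integral_cauchyK_sub_left hτ y]
  exact setIntegral_le_integral (integrable_cauchyK_sub_left hτ y)
    (Eventually.of_forall fun η => cauchyK_nonneg hτ.le _)

lemma integral_abs_greenK_le (m i : ℕ) {t : ℝ} (ht : 0 < t) (y : ℝ) :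
    ∫ η in Ioi (0 : ℝ), |greenK m i t y η| ≤ opC m * (scale t ^ m)⁻¹ := by
  have hA : 0 ≤ greenC m * (scale t ^ m)⁻¹ :=
    mul_nonneg (greenC_nonneg m) (inv_nonneg.2 (pow_nonneg (scale_pos ht).le m))
  calc _ ≤ ∫ η in Ioi (0 : ℝ), greenC m * (scale t ^ m)⁻¹ * cauchyK (scale t) (max y 0 - η) := by
        refine setIntegral_mono_on (integrableOn_greenK m i ht y).abs
          ((integrable_cauchyK_sub_left (scale_pos ht) (max y 0)).const_mul _).integrableOn
          measurableSet_Ioi fun η hη => abs_greenK_le_max m i ht y (le_of_lt hη)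
    _ ≤ greenC m * (scale t ^ m)⁻¹ * Real.pi := by
        rw [integral_const_mul]
        exact mul_le_mul_of_nonneg_left (setIntegral_cauchyK_le (scale_pos ht) _) hA
    _ = _ := by unfold opC; ring

lemma abs_greenOp_le (m i : ℕ) {t : ℝ} (ht : 0 < t) (y : ℝ) {f : ℝ → ℝ} {B : ℝ}
    (hB : ∀ y, |f y| ≤ B) :
    |greenOp m i t f y| ≤ opC m * (scale t ^ m)⁻¹ * B := by
  have hB0 : 0 ≤ B := (abs_nonneg _).trans (hB 0)
  calc |greenOp m i t f y| ≤ ∫ η in Ioi (0 : ℝ), |greenK m i t y η| * B := by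
        refine norm_integral_le_of_norm_le (f := fun η => greenK m i t y η * f η)
          ((integrableOn_greenK m i ht y).abs.mul_const B) (Eventually.of_forall fun η => ?_)
        rw [norm_mul]
        exact mul_le_mul_of_nonneg_left (hB η) (abs_nonneg _)
    _ ≤ _ := by
        rw [integral_mul_const]
        exact mul_le_mul_of_nonneg_right (integral_abs_greenK_le m i ht y) hB0

lemma lintegral_cauchyK_sub {τ : ℝ} (hτ : 0 < τ) (A η : ℝ) (hA : 0 ≤ A) :
    ∫⁻ y, ENNReal.ofReal (A * cauchyK τ (y - η)) = ENNReal.ofReal (A * Real.pi) := by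
  rw [← ofReal_integral_eq_lintegral_ofReal]
  · rw [integral_const_mul, integral_sub_right_eq_self (cauchyK τ), integral_cauchyK hτ]
  · exact ((integrable_cauchyK hτ).comp_sub_right η).const_mul A
  · exact Eventually.of_forall fun y => mul_nonneg hA (cauchyK_nonneg hτ.le _)

/-- Tonelli and the total mass of the Cauchy majorant in the variable y. In `ℝ≥0∞` no integrability
of `f` has to be assumed. -/
lemma lintegral_greenOp_le (m i : ℕ) {t : ℝ} (ht : 0 < t) {f : ℝ → ℝ} (hf : Continuous f) :
    ∫⁻ y in Ioi (0 : ℝ), ‖greenOp m i t f y‖ₑ ≤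
      ENNReal.ofReal (opC m * (scale t ^ m)⁻¹) * ∫⁻ η in Ioi (0 : ℝ), ‖f η‖ₑ := by
  set A := greenC m * (scale t ^ m)⁻¹ with hAd
  have hτ := scale_pos ht
  have hA : 0 ≤ A := mul_nonneg (greenC_nonneg m) (inv_nonneg.2 (pow_nonneg hτ.le m))
  have hcc := continuous_cauchyK (scale t)
  calc ∫⁻ y in Ioi (0 : ℝ), ‖greenOp m i t f y‖ₑ
      ≤ ∫⁻ y in Ioi (0 : ℝ), ∫⁻ η in Ioi (0 : ℝ),
        ENNReal.ofReal (A * cauchyK (scale t) (y - η)) * ‖f η‖ₑ := by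
        refine setLIntegral_mono_ae' measurableSet_Ioi (Eventually.of_forall fun y hy => ?_)
        refine (enorm_integral_le_lintegral_enorm _).trans ?_
        refine setLIntegral_mono_ae' measurableSet_Ioi (Eventually.of_forall fun η hη => ?_)
        rw [enorm_mul]
        gcongr
        rw [Real.enorm_eq_ofReal_abs]
        exact ENNReal.ofReal_le_ofReal (abs_greenK_le m i ht (le_of_lt hy) (le_of_lt hη))
    _ = ∫⁻ η in Ioi (0 : ℝ), ∫⁻ y in Ioi (0 : ℝ),
        ENNReal.ofReal (A * cauchyK (scale t) (y - η)) * ‖f η‖ₑ := by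
        refine lintegral_lintegral_swap (Measurable.aemeasurable ?_)
        change Measurable fun p : ℝ × ℝ =>
          ENNReal.ofReal (A * cauchyK (scale t) (p.1 - p.2)) * ‖f p.2‖ₑ
        have m1 : Measurable fun p : ℝ × ℝ => ENNReal.ofReal (A * cauchyK (scale t) (p.1 - p.2)) :=
          (Continuous.measurable (by fun_prop)).ennreal_ofReal
        have m2 : Measurable fun p : ℝ × ℝ => ‖f p.2‖ₑ :=
          (Continuous.measurable (by fun_prop)).enorm
        exact m1.mul m2
    _ ≤ ∫⁻ η in Ioi (0 : ℝ), ENNReal.ofReal (opC m * (scale t ^ m)⁻¹) * ‖f η‖ₑ := by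
        refine lintegral_mono fun η => ?_
        rw [lintegral_mul_const'' _ (Measurable.aemeasurable
          (Continuous.measurable (by fun_prop)).ennreal_ofReal)]
        gcongr
        refine (setLIntegral_le_lintegral _ _).trans ?_
        rw [lintegral_cauchyK_sub hτ A η hA]
        refine le_of_eq ?_
        rw [hAd, opC]
        ring_nf
    _ = _ := lintegral_const_mul _ hf.measurable.enorm

lemma inv_one_add_sq_le {x z : ℝ} (h : |x - z| ≤ 1) :
    (1 + x ^ 2)⁻¹ ≤ 3 * (1 + z ^ 2)⁻¹ := by
  rw [← div_eq_mul_inv, inv_le_iff_one_le_mul₀ (by positivity), div_mul_eq_mul_div,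
    le_div_iff₀ (by positivity)]
  have := abs_le.1 h
  nlinarith [sq_nonneg (2 * x - z), sq_nonneg (x - z)]

/-- A bound of the kernels that is uniform near a point with positive time. -/
lemma eventually_abs_greenK_le (m i : ℕ) {t₀ : ℝ} (ht₀ : 0 < t₀) (y₀ : ℝ) :
    ∃ D : ℝ, 0 ≤ D ∧ ∀ t ∈ Icc (t₀ / 2) (2 * t₀), ∀ y, |max y 0 - max y₀ 0| ≤ 1 →
      ∀ η, 0 ≤ η → |greenK m i t y η| ≤ D * (1 + (max y₀ 0 - η) ^ 2)⁻¹ := by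
  obtain ⟨D, hD, h⟩ := exists_locally_uniform_bound_greenK m i (half_pos ht₀) (b := 2 * t₀)
  refine ⟨D * 3, by positivity, fun t ht y hy η hη => ?_⟩
  rw [← greenK_max_left]
  refine (h t ht _ η (le_max_right _ _) hη).trans ?_
  rw [mul_assoc]
  gcongr
  exact inv_one_add_sq_le (by rwa [sub_sub_sub_cancel_right])

lemma integrable_inv_one_add_sub_sq (y : ℝ) : Integrable fun η : ℝ => (1 + (y - η) ^ 2)⁻¹ :=
  integrable_inv_one_add_sq.comp_sub_left y

lemma continuousOn_greenOp (m i : ℕ) {f : ℝ → ℝ → ℝ} {B : ℝ}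
    (hf : Continuous (Function.uncurry f)) (hB : ∀ s y, |f s y| ≤ B) :
    ContinuousOn (fun p : ℝ × ℝ × ℝ => greenOp m i p.1 (f p.2.1) p.2.2) (Ioi 0 ×ˢ univ) := by
  rintro ⟨t₀, s₀, y₀⟩ ⟨ht, -⟩
  have ht : 0 < t₀ := ht
  have hB0 : 0 ≤ B := (abs_nonneg _).trans (hB 0 0)
  obtain ⟨D, hD, h⟩ := eventually_abs_greenK_le m i ht y₀
  have ev1 : ∀ᶠ p : ℝ × ℝ × ℝ in 𝓝 (t₀, s₀, y₀), p.1 ∈ Icc (t₀ / 2) (2 * t₀) :=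
    continuousAt_fst.eventually (Icc_mem_nhds (by dsimp only; linarith) (by dsimp only; linarith))
  have ev2 : ∀ᶠ p : ℝ × ℝ × ℝ in 𝓝 (t₀, s₀, y₀), |max p.2.2 0 - max y₀ 0| ≤ 1 := by
    have : Continuous fun p : ℝ × ℝ × ℝ => |max p.2.2 0 - max y₀ 0| := by fun_prop
    exact (this.tendsto (t₀, s₀, y₀)).eventually (Iic_mem_nhds (by simp))
  refine ContinuousAt.continuousWithinAt ?_
  refine continuousAt_of_dominated (bound := fun η => D * (1 + (max y₀ 0 - η) ^ 2)⁻¹ * B)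
    ?_ ?_ (((integrable_inv_one_add_sub_sq _).const_mul D).mul_const B).integrableOn ?_
  · filter_upwards [ev1] with p hp
    have := continuous_greenK_right m i (show 0 < p.1 by linarith [hp.1]) p.2.2
    have h2 : Continuous (f p.2.1) := hf.comp (by fun_prop : Continuous fun y => (p.2.1, y))
    exact (this.mul h2).aestronglyMeasurable
  · filter_upwards [ev1, ev2] with p hp1 hp2
    filter_upwards [ae_restrict_mem measurableSet_Ioi] with η hη
    rw [norm_mul]
    exact mul_le_mul (h _ hp1 _ hp2 η (le_of_lt hη)) (hB _ _) (norm_nonneg _) (by positivity)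
  · refine Eventually.of_forall fun η => ContinuousAt.mul ?_ ?_
    · have h1 : ContinuousAt (fun p : ℝ × ℝ × ℝ => greenK m i p.1 p.2.1 p.2.2) (t₀, y₀, η) :=
        (continuousOn_greenK m i).continuousAt
          ((isOpen_Ioi.prod isOpen_univ).mem_nhds ⟨ht, mem_univ _⟩)
      exact ContinuousAt.comp (f := fun p : ℝ × ℝ × ℝ => (p.1, p.2.2, η)) (x := (t₀, s₀, y₀)) h1
        (Continuous.continuousAt (by fun_prop))
    · exact (hf.comp (by fun_prop : Continuous fun p : ℝ × ℝ × ℝ => (p.2.1, η))).continuousAt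

lemma continuous_greenOp (m i : ℕ) {t : ℝ} (ht : 0 < t) {f : ℝ → ℝ} {B : ℝ}
    (hf : Continuous f) (hB : ∀ y, |f y| ≤ B) : Continuous (greenOp m i t f) :=
  (continuousOn_greenOp m i (f := fun _ => f) (hf.comp continuous_snd) fun _ => hB).comp_continuous
    (f := fun y => (t, 0, y)) (by fun_prop) fun _ => ⟨ht, mem_univ _⟩

lemma hasDerivAt_greenOp (m i : ℕ) {t y : ℝ} (ht : 0 < t) (hy : 0 < y) {f : ℝ → ℝ} {B : ℝ}
    (hf : Continuous f) (hB : ∀ y, |f y| ≤ B) :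
    HasDerivAt (greenOp m i t f) (-greenOp (m + 1) (i + 1) t f y) y := by
  have hB0 : 0 ≤ B := (abs_nonneg _).trans (hB 0)
  obtain ⟨D, hD, h⟩ := eventually_abs_greenK_le (m + 1) (i + 1) ht y
  unfold greenOp
  rw [← integral_neg]
  have hr : 0 < min y 1 := lt_min hy one_pos
  refine (hasDerivAt_integral_of_dominated_loc_of_deriv_le
    (F' := fun z η => -(greenK (m + 1) (i + 1) t z η * f η))
    (bound := fun η => D * (1 + (max y 0 - η) ^ 2)⁻¹ * B) (Metric.ball_mem_nhds y hr)
    (Eventually.of_forall fun z => (integrableOn_greenK_mul m i ht z hf hB).aestronglyMeasurable)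
    (integrableOn_greenK_mul m i ht y hf hB)
    (integrableOn_greenK_mul (m + 1) (i + 1) ht y hf hB).aestronglyMeasurable.neg ?_
    (((integrable_inv_one_add_sub_sq _).const_mul D).mul_const B).integrableOn ?_).2
  · filter_upwards [ae_restrict_mem measurableSet_Ioi] with η hη z hz
    rw [norm_neg, norm_mul]
    rw [Metric.mem_ball, Real.dist_eq, lt_min_iff] at hz
    refine mul_le_mul (h t ⟨by linarith, by linarith⟩ z ?_ η (le_of_lt hη)) (hB _) (norm_nonneg _)
      (by positivity)
    exact (abs_max_sub_max_le_abs _ _ _).trans hz.2.le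
  · refine Eventually.of_forall fun η z hz => ?_
    rw [Metric.mem_ball, Real.dist_eq, lt_min_iff] at hz
    have hz0 : 0 < z := by linarith [(abs_lt.1 hz.1).1]
    refine ((hasDerivAt_greenK_left m i ht hz0 η).mul_const (f η)).congr_deriv ?_
    ring

/-- Integration by parts: a derivative of the kernel is transferred to the function. -/
lemma greenOp_succ (m i : ℕ) {t : ℝ} (ht : 0 < t) (y : ℝ) {f f' : ℝ → ℝ} {B B' : ℝ}
    (hf : Continuous f) (hB : ∀ y, |f y| ≤ B) (hf' : Continuous f') (hB' : ∀ y, |f' y| ≤ B')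
    (hd : ∀ y, 0 < y → HasDerivAt f (f' y) y) (h0 : osc (m + 3 * i) 0 * f 0 = 0) :
    greenOp (m + 1) i t f y = -greenOp m i t f' y := by
  have hB0 : 0 ≤ B := (abs_nonneg _).trans (hB 0)
  -- At η = 0 the eigenfunction in η has the constant value `osc (m + 3 * i) 0`, so if it is zero
  -- then so is the kernel.
  have hK0 : greenK m i t y 0 * f 0 = 0 := by
    rcases mul_eq_zero.1 h0 with h | h
    · simp [greenK, h]
    · simp [h]
  have key := integral_Ioi_mul_deriv_eq_deriv_mul (a := (0 : ℝ)) (u := f) (u' := f')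
    (v := greenK m i t y) (v' := greenK (m + 1) i t y) (a' := 0) (b' := 0)
    (fun η hη => hd η hη) (fun η hη => hasDerivAt_greenK_right m i ht y hη)
    ((integrableOn_greenK_mul (m + 1) i ht y hf hB).congr
      (Eventually.of_forall fun η => mul_comm _ _))
    ((integrableOn_greenK_mul m i ht y hf' hB').congr
      (Eventually.of_forall fun η => mul_comm _ _))
    (by
      have h1 : Continuous (f * greenK m i t y) := hf.mul (continuous_greenK_right m i ht y)
      have h2 := (h1.tendsto 0).mono_left (nhdsWithin_le_nhds (s := Ioi 0))
      rwa [Pi.mul_apply, mul_comm (f 0), hK0] at h2)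
    (by
      have h1 : Tendsto (greenK m i t y) atTop (𝓝 0) :=
        tendsto_zero_of_hasDerivAt_of_integrableOn_Ioi
          (fun η hη => hasDerivAt_greenK_right m i ht y hη) (integrableOn_greenK (m + 1) i ht y)
          (integrableOn_greenK m i ht y)
      exact isBoundedUnder_le_mul_tendsto_zero (isBoundedUnder_of ⟨B, hB⟩) h1)
  unfold greenOp
  rw [sub_zero, zero_sub] at key
  simp_rw [mul_comm (greenK _ _ _ _ _)]
  exact key

/-- The product rule: a t-derivative of the kernel equals minus four η-derivatives, and the reversed
time t - s turns the sign into a plus. The bounds are global while the differentiability of `b` is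
only local in time; this is the form in which classical solutions are fed in. -/
lemma hasDerivAt_greenOp_time (m i : ℕ) {t s y : ℝ} (hst : s < t) {b b' : ℝ → ℝ → ℝ} {B B' : ℝ}
    (hb : ∀ s, Continuous (b s)) (hB : ∀ s y, |b s y| ≤ B) (hb' : ∀ s, Continuous (b' s))
    (hB' : ∀ s y, |b' s y| ≤ B') {U : Set ℝ} (hU : U ∈ 𝓝 s)
    (hd : ∀ s ∈ U, ∀ y, 0 < y → HasDerivAt (fun s => b s y) (b' s y) s) :
    HasDerivAt (fun s => greenOp m i (t - s) (b s) y)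
      (greenOp (m + 4) i (t - s) (b s) y + greenOp m i (t - s) (b' s) y) s := by
  have hB0 : 0 ≤ B := (abs_nonneg _).trans (hB 0 0)
  have hB0' : 0 ≤ B' := (abs_nonneg _).trans (hB' 0 0)
  have ht : 0 < t - s := sub_pos.2 hst
  obtain ⟨D, hD, h⟩ := eventually_abs_greenK_le m i ht y
  obtain ⟨D', hD', h'⟩ := eventually_abs_greenK_le (m + 4) i ht y
  have hI := integrableOn_greenK_mul (m + 4) i ht y (hb s) (hB s)
  have hI' := integrableOn_greenK_mul m i ht y (hb' s) (hB' s)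
  unfold greenOp
  rw [← integral_add hI hI']
  have hV : {r : ℝ | t - r ∈ Icc ((t - s) / 2) (2 * (t - s))} ∈ 𝓝 s :=
    (by fun_prop : Continuous fun r => t - r).continuousAt.preimage_mem_nhds
      (Icc_mem_nhds (by linarith) (by linarith))
  refine (hasDerivAt_integral_of_dominated_loc_of_deriv_le
    (F := fun r η => greenK m i (t - r) y η * b r η)
    (F' := fun r η => greenK (m + 4) i (t - r) y η * b r η + greenK m i (t - r) y η * b' r η)
    (bound := fun η => (D' * B + D * B') * (1 + (max y 0 - η) ^ 2)⁻¹) (inter_mem hU hV)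
    ?_ (integrableOn_greenK_mul m i ht y (hb s) (hB s))
    (hI.aestronglyMeasurable.add hI'.aestronglyMeasurable) ?_
    ((integrable_inv_one_add_sub_sq _).const_mul _).integrableOn ?_).2
  · filter_upwards [hV] with r hr
    exact (integrableOn_greenK_mul m i (by linarith [hr.1]) y (hb r) (hB r)).aestronglyMeasurable
  · filter_upwards [ae_restrict_mem measurableSet_Ioi] with η hη r hr
    refine (norm_add_le _ _).trans ?_
    rw [norm_mul, norm_mul]
    have a1 := mul_le_mul (h' _ hr.2 y (by simp) η (le_of_lt hη)) (hB r η) (abs_nonneg _)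
      (by positivity)
    have a2 := mul_le_mul (h _ hr.2 y (by simp) η (le_of_lt hη)) (hB' r η) (abs_nonneg _)
      (by positivity)
    simp only [Real.norm_eq_abs]
    linarith
  · filter_upwards [ae_restrict_mem measurableSet_Ioi] with η hη r hr
    have h0 : 0 < t - r := by linarith [hr.2.1]
    have h1 : HasDerivAt (fun r => greenK m i (t - r) y η) (greenK (m + 4) i (t - r) y η) r := by
      refine ((hasDerivAt_greenK_time m i h0 y η).comp r
        ((hasDerivAt_id r).const_sub t)).congr_deriv ?_
      ring
    exact h1.mul (hd r hr.1 η hη)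

lemma greenOp_sub (m i : ℕ) {t : ℝ} (ht : 0 < t) (y : ℝ) {f g : ℝ → ℝ} {B B' : ℝ}
    (hf : Continuous f) (hB : ∀ y, |f y| ≤ B) (hg : Continuous g) (hB' : ∀ y, |g y| ≤ B') :
    greenOp m i t (fun y => f y - g y) y = greenOp m i t f y - greenOp m i t g y := by
  unfold greenOp
  rw [← integral_sub (integrableOn_greenK_mul m i ht y hf hB)
    (integrableOn_greenK_mul m i ht y hg hB')]
  simp only [mul_sub]

/-! ### Approximation of the identity -/

lemma setIntegral_comp_sub_left (f : ℝ → ℝ) (y : ℝ) :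
    ∫ η in Ioi (0 : ℝ), f (y - η) = ∫ x in Iio y, f x := by
  rw [← integral_indicator measurableSet_Ioi, ← integral_indicator measurableSet_Iio,
    ← integral_sub_left_eq_self ((Iio y).indicator f) volume y]
  congr 1
  refine funext fun η => ?_
  simp only [indicator, mem_Ioi, mem_Iio, sub_lt_self_iff]

lemma setIntegral_comp_add_left (f : ℝ → ℝ) (y : ℝ) :
    ∫ η in Ioi (0 : ℝ), f (y + η) = ∫ x in Ioi y, f x := by
  rw [← integral_indicator measurableSet_Ioi, ← integral_indicator measurableSet_Ioi,
    ← integral_add_left_eq_self ((Ioi y).indicator f) y]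
  congr 1
  refine funext fun η => ?_
  simp only [indicator, mem_Ioi, lt_add_iff_pos_right]

/-- Far from the boundary the free part sees nearly the whole line, where its mass is one, and the
reflected part is bounded by the tail of an integrable function. -/
lemma tendsto_greenOp_one_atTop (i : ℕ) :
    Tendsto (greenOp 0 i 1 fun _ => 1) atTop (𝓝 1) := by
  obtain ⟨C, hC0, hC⟩ := exists_bound_greenK_sub_lineK 0
  have h1 : Tendsto (fun y => ∫ η in Ioi (0 : ℝ), lineK 0 (y - η)) atTop (𝓝 1) := by
    simp_rw [setIntegral_comp_sub_left]
    rw [← integral_lineK_zero]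
    exact (aecover_Iio tendsto_id).integral_tendsto_of_countably_generated (integrable_lineK 0)
  have hg : Integrable fun x : ℝ => C * (1 + x ^ 2)⁻¹ := integrable_inv_one_add_sq.const_mul C
  have h2 : Tendsto (fun y => ∫ η in Ioi (0 : ℝ), C * (1 + (y + η) ^ 2)⁻¹) atTop (𝓝 0) := by
    have h3 := (aecover_Iic tendsto_id).integral_tendsto_of_countably_generated hg
    have h4 := (tendsto_const_nhds (x := ∫ x : ℝ, C * (1 + x ^ 2)⁻¹)).sub h3
    rw [sub_self] at h4
    refine h4.congr fun y => ?_
    rw [setIntegral_comp_add_left (fun x : ℝ => C * (1 + x ^ 2)⁻¹), ← compl_Iic, sub_eq_iff_eq_add',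
      id, integral_add_compl measurableSet_Iic hg]
  have h3 : Tendsto (fun y => greenOp 0 i 1 (fun _ => 1) y -
      ∫ η in Ioi (0 : ℝ), lineK 0 (y - η)) atTop (𝓝 0) := by
    refine squeeze_zero_norm' ?_ h2
    filter_upwards [eventually_ge_atTop 0] with y hy
    have e : greenOp 0 i 1 (fun _ => 1) y - ∫ η in Ioi (0 : ℝ), lineK 0 (y - η) =
        ∫ η in Ioi (0 : ℝ), (greenK 0 i 1 y η - lineK 0 (y - η)) := by
      rw [integral_sub (integrableOn_greenK 0 i one_pos y)
        ((integrable_lineK 0).comp_sub_left y).integrableOn]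
      simp only [greenOp, mul_one]
    rw [e]
    refine norm_integral_le_of_norm_le (hg.comp_add_left y).integrableOn ?_
    filter_upwards [ae_restrict_mem measurableSet_Ioi] with η hη
    rw [← div_eq_mul_inv]
    exact hC i y η hy (le_of_lt hη)
  simpa using h3.add h1

lemma greenOp_one_scale (i : ℕ) {t : ℝ} (ht : 0 < t) (y : ℝ) :
    greenOp 0 i t (fun _ => 1) y = greenOp 0 i 1 (fun _ => 1) (y / scale t) := by
  have hτ := scale_pos ht
  have h := integral_comp_mul_right_Ioi (fun η => greenK 0 i 1 (y / scale t) η) 0 (inv_pos.2 hτ)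
  rw [zero_mul, inv_inv, smul_eq_mul] at h
  simp only [greenOp, mul_one]
  rw [eq_comm, ← eq_inv_mul_iff_mul_eq₀ hτ.ne', eq_comm] at h
  rw [← h, ← integral_const_mul]
  congr 1
  refine funext fun η => ?_
  conv_lhs => rw [← scale_pow_four ht.le, greenK_scale 0 i hτ]
  rw [zero_add, pow_one, div_eq_mul_inv η]

lemma continuous_greenOp_one (i : ℕ) : Continuous (greenOp 0 i 1 fun _ => 1) :=
  continuous_greenOp 0 i one_pos continuous_const (B := 1) fun _ => by simp

/-- For i ≡ 2, 3 modulo 4 the eigenfunction of index 3(i + 1) vanishes at 0, so the y-derivative of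
the mass can be integrated by parts onto the constant 1 and is zero. The mass is thus constant in y,
equal to its limit one at infinity. -/
lemma greenOp_one_of_mod (i : ℕ) (hi : i % 4 = 2 ∨ i % 4 = 3) {t : ℝ} (ht : 0 < t) (y : ℝ) :
    greenOp 0 i t (fun _ => 1) y = 1 := by
  rw [greenOp_one_scale i ht]
  have hconst : ∀ x, 0 ≤ x → greenOp 0 i 1 (fun _ => 1) x = greenOp 0 i 1 (fun _ => 1) 0 := by
    intro x hx
    have hd : ∀ z ∈ Ioo 0 x, HasDerivAt (greenOp 0 i 1 fun _ => 1) 0 z := by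
      intro z hz
      refine (hasDerivAt_greenOp 0 i one_pos hz.1 continuous_const (B := 1)
        fun _ => by simp).congr_deriv ?_
      rw [greenOp_succ 0 (i + 1) one_pos z (f := fun _ => 1) (f' := fun _ => 0) continuous_const
        (B := 1) (fun _ => by simp) continuous_const (B' := 0) (fun _ => by simp)
        (fun y _ => hasDerivAt_const _ _)]
      · simp [greenOp]
      · rw [osc_at_zero (by omega), zero_mul]
    have := intervalIntegral.integral_eq_sub_of_hasDerivAt_of_le hx
      (continuous_greenOp_one i).continuousOn hd (by simp)
    rw [intervalIntegral.integral_zero] at this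
    linarith
  have hlim := tendsto_greenOp_one_atTop i
  have h0 : greenOp 0 i 1 (fun _ => 1) 0 = 1 := by
    refine tendsto_nhds_unique (tendsto_const_nhds.congr' ?_) hlim
    filter_upwards [eventually_ge_atTop 0] with x hx
    exact (hconst x hx).symm
  rw [← greenOp_max, hconst _ (le_max_right _ _), h0]

/-- The average of `|f (y - τ * x) - f y|` with respect to the Cauchy kernel in `x`. -/
noncomputable def cauchyOsc (f : ℝ → ℝ) (τ y : ℝ) : ℝ :=
  ∫ x, cauchyK 1 x * |f (y - τ * x) - f y|

lemma integrable_cauchyOsc {f : ℝ → ℝ} {B : ℝ} (hf : Continuous f) (hB : ∀ y, |f y| ≤ B)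
    (τ y : ℝ) : Integrable fun x => cauchyK 1 x * |f (y - τ * x) - f y| := by
  refine (integrable_cauchyK one_pos).mul_bdd (c := 2 * B)
    (Continuous.aestronglyMeasurable (by fun_prop)) (Eventually.of_forall fun x => ?_)
  rw [Real.norm_eq_abs, abs_abs]
  linarith [abs_sub (f (y - τ * x)) (f y), hB (y - τ * x), hB y]

/-- The value of `f` is compared with the mass of the kernel times `f y`, not with `f y` itself: the
mass may differ from one near the boundary, and this defect is estimated separately. -/
lemma abs_greenOp_sub_le (i : ℕ) {t y : ℝ} (ht : 0 < t) (hy : 0 ≤ y) {f : ℝ → ℝ} {B : ℝ}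
    (hf : Continuous f) (hB : ∀ y, |f y| ≤ B) :
    |greenOp 0 i t f y - greenOp 0 i t (fun _ => 1) y * f y| ≤
      greenC 0 * cauchyOsc f (scale t) y := by
  have hτ := scale_pos ht
  have e : greenOp 0 i t f y - greenOp 0 i t (fun _ => 1) y * f y =
      ∫ η in Ioi (0 : ℝ), greenK 0 i t y η * (f η - f y) := by
    simp only [greenOp, mul_one]
    rw [← integral_mul_const, ← integral_sub (integrableOn_greenK_mul 0 i ht y hf hB)
      ((integrableOn_greenK 0 i ht y).mul_const _)]
    simp only [mul_sub]
  have hi : Integrable fun η => cauchyK (scale t) (y - η) * |f η - f y| := by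
    refine (integrable_cauchyK_sub_left hτ y).mul_bdd (c := 2 * B)
      (Continuous.aestronglyMeasurable (by fun_prop)) (Eventually.of_forall fun x => ?_)
    rw [Real.norm_eq_abs, abs_abs]
    linarith [abs_sub (f x) (f y), hB x, hB y]
  have e2 : cauchyOsc f (scale t) y = ∫ η, cauchyK (scale t) (y - η) * |f η - f y| := by
    have h1 := integral_sub_left_eq_self
      (fun x => cauchyK (scale t) x * |f (y - x) - f y|) volume y
    simp only [sub_sub_cancel] at h1
    have h2 := Measure.integral_comp_mul_left
      (fun x => cauchyK (scale t) x * |f (y - x) - f y|) (scale t)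
    have h3 : ∀ x, cauchyK (scale t) (scale t * x) = (scale t)⁻¹ * cauchyK 1 x := fun x => by
      unfold cauchyK
      rw [mul_div_cancel_left₀ _ hτ.ne', inv_one, one_mul, div_one]
    simp only [h3, mul_assoc] at h2
    rw [integral_const_mul, smul_eq_mul, abs_of_pos (inv_pos.2 hτ)] at h2
    rw [h1]
    exact mul_left_cancel₀ (inv_pos.2 hτ).ne' h2
  rw [e, e2, ← integral_const_mul]
  calc _ ≤ ∫ η in Ioi (0 : ℝ), greenC 0 * (cauchyK (scale t) (y - η) * |f η - f y|) := by
        refine norm_integral_le_of_norm_le (f := fun η => greenK 0 i t y η * (f η - f y))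
          (hi.const_mul _).integrableOn ?_
        filter_upwards [ae_restrict_mem measurableSet_Ioi] with η hη
        rw [norm_mul, ← mul_assoc]
        have := abs_greenK_le 0 i ht hy (le_of_lt hη)
        rw [pow_zero, inv_one, mul_one] at this
        exact mul_le_mul_of_nonneg_right this (abs_nonneg _)
    _ ≤ _ := setIntegral_le_integral (hi.const_mul _) (Eventually.of_forall fun η =>
        mul_nonneg (greenC_nonneg 0) (mul_nonneg (cauchyK_nonneg hτ.le _) (abs_nonneg _)))

lemma continuous_cauchyOsc {f : ℝ → ℝ} {B : ℝ} (hf : Continuous f) (hB : ∀ y, |f y| ≤ B) :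
    Continuous fun p : ℝ × ℝ => cauchyOsc f p.1 p.2 := by
  refine continuous_of_dominated (bound := fun x => cauchyK 1 x * (2 * B))
    (fun p => (integrable_cauchyOsc hf hB _ _).aestronglyMeasurable)
    (fun p => Eventually.of_forall fun x => ?_) ((integrable_cauchyK one_pos).mul_const _)
    (Eventually.of_forall fun x => by fun_prop)
  rw [Real.norm_eq_abs, abs_mul, abs_abs, abs_of_nonneg (cauchyK_nonneg zero_le_one _)]
  refine mul_le_mul_of_nonneg_left ?_ (cauchyK_nonneg zero_le_one _)
  linarith [abs_sub (f (p.2 - p.1 * x)) (f p.2), hB (p.2 - p.1 * x), hB p.2]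

lemma cauchyOsc_zero (f : ℝ → ℝ) (y : ℝ) : cauchyOsc f 0 y = 0 := by simp [cauchyOsc]

lemma abs_greenOp_one_sub_one_le (i : ℕ) {t : ℝ} (ht : 0 < t) (y : ℝ) :
    |greenOp 0 i t (fun _ => 1) y - 1| ≤ opC 0 + 1 := by
  have h := abs_greenOp_le 0 i ht y (f := fun _ => 1) (B := 1) (fun _ => by simp)
  rw [pow_zero, inv_one, mul_one, mul_one] at h
  have := abs_sub (greenOp 0 i t (fun _ => 1) y) 1
  rw [abs_one] at this
  linarith

/-- The error splits into the local oscillation of `f` at scale t^{1/4} and the mass defect times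
`f`. Convergence is joint in (t, y), as is needed for continuity of the semigroup up to t = 0. -/
lemma tendsto_greenOp_zero (i : ℕ) {f : ℝ → ℝ} {B : ℝ} (hf : Continuous f)
    (hB : ∀ y, |f y| ≤ B) (hm : ∀ y, f (max y 0) = f y)
    (hi : i % 4 = 2 ∨ i % 4 = 3 ∨ f 0 = 0) (y₀ : ℝ) :
    Tendsto (fun p : ℝ × ℝ => greenOp 0 i p.1 f p.2) (𝓝[>] 0 ×ˢ 𝓝 y₀) (𝓝 (f y₀)) := by
  have hpos : ∀ᶠ p : ℝ × ℝ in 𝓝[>] 0 ×ˢ 𝓝 y₀, 0 < p.1 :=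
    tendsto_fst.eventually (eventually_mem_nhdsWithin)
  have hle : (𝓝[>] (0 : ℝ) ×ˢ 𝓝 y₀) ≤ 𝓝 ((0 : ℝ), y₀) := by
    rw [nhds_prod_eq]
    exact prod_mono nhdsWithin_le_nhds le_rfl
  have h1 : Tendsto (fun p : ℝ × ℝ => greenOp 0 i p.1 f p.2 -
      greenOp 0 i p.1 (fun _ => 1) p.2 * f p.2) (𝓝[>] 0 ×ˢ 𝓝 y₀) (𝓝 0) := by
    have hc : Continuous fun p : ℝ × ℝ => greenC 0 * cauchyOsc f (scale p.1) (max p.2 0) :=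
      continuous_const.mul ((continuous_cauchyOsc hf hB).comp
        ((continuous_scale.comp continuous_fst).prodMk (by fun_prop :
          Continuous fun p : ℝ × ℝ => max p.2 0)))
    have h2 := (hc.tendsto (0, y₀)).mono_left hle
    simp only [scale_zero, cauchyOsc_zero, mul_zero] at h2
    refine squeeze_zero_norm' ?_ h2
    filter_upwards [hpos] with p hp
    have := abs_greenOp_sub_le i hp (le_max_right p.2 0) hf hB
    rwa [greenOp_max, greenOp_max, hm] at this
  have h2 : Tendsto (fun p : ℝ × ℝ => (greenOp 0 i p.1 (fun _ => 1) p.2 - 1) * f p.2)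
      (𝓝[>] 0 ×ˢ 𝓝 y₀) (𝓝 0) := by
    have hfy : Tendsto (fun p : ℝ × ℝ => f p.2) (𝓝[>] 0 ×ˢ 𝓝 y₀) (𝓝 (f y₀)) :=
      (hf.tendsto y₀).comp tendsto_snd
    -- The mass defect vanishes identically in the first case. Otherwise f(0) = 0: at the boundary
    -- the defect is merely bounded while `f` tends to zero, and at an interior point the defect
    -- tends to zero because y / t^{1/4} tends to infinity.
    by_cases hi' : i % 4 = 2 ∨ i % 4 = 3
    · refine tendsto_const_nhds.congr' ?_
      filter_upwards [hpos] with p hp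
      rw [greenOp_one_of_mod i hi' hp, sub_self, zero_mul]
    · have hf0 : f 0 = 0 := by tauto
      rcases le_or_gt y₀ 0 with hy | hy
      · rw [← hm, max_eq_right hy, hf0] at hfy
        refine isBoundedUnder_le_mul_tendsto_zero ?_ hfy
        refine isBoundedUnder_of_eventually_le (a := opC 0 + 1) ?_
        filter_upwards [hpos] with p hp
        exact abs_greenOp_one_sub_one_le i hp p.2
      · have h3 : Tendsto (fun p : ℝ × ℝ => p.2 / scale p.1) (𝓝[>] 0 ×ˢ 𝓝 y₀) atTop := by
          have hs : Tendsto (fun p : ℝ × ℝ => scale p.1) (𝓝[>] 0 ×ˢ 𝓝 y₀) (𝓝[>] 0) := by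
            refine tendsto_nhdsWithin_of_tendsto_nhds_of_eventually_within _ ?_ ?_
            · exact (tendsto_scale_zero.mono_left nhdsWithin_le_nhds).comp tendsto_fst
            · filter_upwards [hpos] with p hp using scale_pos hp
          simp_rw [div_eq_mul_inv]
          exact Tendsto.pos_mul_atTop hy tendsto_snd hs.inv_tendsto_nhdsGT_zero
        have h4 := (tendsto_greenOp_one_atTop i).comp h3
        have h5 : Tendsto (fun p : ℝ × ℝ => greenOp 0 i p.1 (fun _ => 1) p.2 - 1)
            (𝓝[>] 0 ×ˢ 𝓝 y₀) (𝓝 0) := by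
          have h6 := h4.sub_const 1
          rw [sub_self] at h6
          refine h6.congr' ?_
          filter_upwards [hpos] with p hp
          rw [greenOp_one_scale i hp]
          rfl
        simpa using h5.mul hfy
  have h3 : Tendsto (fun p : ℝ × ℝ => f p.2) (𝓝[>] (0 : ℝ) ×ˢ 𝓝 y₀) (𝓝 (f y₀)) :=
    (hf.tendsto y₀).comp tendsto_snd
  have h4 := (h1.add h2).add h3
  rw [add_zero, zero_add] at h4
  refine h4.congr fun p => ?_
  ring

/-- The operators `greenOp 0 i`, extended by the identity to nonpositive times. -/
noncomputable def heat (i : ℕ) (f : ℝ → ℝ) (t y : ℝ) : ℝ :=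
  if t ≤ 0 then f y else greenOp 0 i t f y

lemma heat_of_pos (i : ℕ) (f : ℝ → ℝ) {t : ℝ} (ht : 0 < t) (y : ℝ) :
    heat i f t y = greenOp 0 i t f y := if_neg ht.not_ge

lemma heat_zero (i : ℕ) (f : ℝ → ℝ) (y : ℝ) : heat i f 0 y = f y := if_pos le_rfl

lemma heat_add_four (i : ℕ) : heat (i + 4) = heat i := by
  ext f t y
  simp only [heat, greenOp_add_four]

lemma continuous_heat (i : ℕ) {f : ℝ → ℝ} {B : ℝ} (hf : Continuous f)
    (hB : ∀ y, |f y| ≤ B) (hm : ∀ y, f (max y 0) = f y)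
    (hi : i % 4 = 2 ∨ i % 4 = 3 ∨ f 0 = 0) : Continuous (Function.uncurry (heat i f)) := by
  have hcont : ContinuousOn (fun p : ℝ × ℝ => greenOp 0 i p.1 f p.2) (Ioi 0 ×ˢ univ) :=
    (continuousOn_greenOp 0 i (f := fun _ => f) (hf.comp continuous_snd) fun _ => hB).comp
      (f := fun p : ℝ × ℝ => (p.1, 0, p.2)) (by fun_prop) fun p hp => ⟨hp.1, mem_univ _⟩
  rw [continuous_iff_continuousAt]
  rintro ⟨t, y⟩
  rcases lt_trichotomy t 0 with ht | rfl | ht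
  · have : ContinuousAt (fun p : ℝ × ℝ => f p.2) (t, y) := by fun_prop
    refine this.congr ?_
    filter_upwards [continuousAt_fst.eventually (gt_mem_nhds ht)] with p hp
    exact (if_pos (le_of_lt hp)).symm
  · rw [ContinuousAt, nhds_prod_eq]
    have e : (𝓝 (0 : ℝ)) = 𝓝[≤] 0 ⊔ 𝓝[>] 0 := by
      rw [← nhdsWithin_union, Iic_union_Ioi, nhdsWithin_univ]
    rw [e, sup_prod, Function.uncurry_apply_pair, heat_zero]
    refine Tendsto.sup ?_ ?_
    · have h1 : Tendsto (fun p : ℝ × ℝ => f p.2) (𝓝[≤] (0 : ℝ) ×ˢ 𝓝 y) (𝓝 (f y)) :=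
        (hf.tendsto y).comp tendsto_snd
      refine h1.congr' ?_
      filter_upwards [tendsto_fst.eventually eventually_mem_nhdsWithin] with p hp
      exact (if_pos hp).symm
    · refine (tendsto_greenOp_zero i hf hB hm hi y).congr' ?_
      filter_upwards [tendsto_fst.eventually eventually_mem_nhdsWithin] with p hp
      exact (heat_of_pos i f hp p.2).symm
  · refine ContinuousAt.congr (hcont.continuousAt
      ((isOpen_Ioi.prod isOpen_univ).mem_nhds ⟨ht, mem_univ _⟩)) ?_
    filter_upwards [continuousAt_fst.eventually (lt_mem_nhds ht)] with p hp
    exact (heat_of_pos i f hp p.2).symm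

lemma abs_heat_le (i : ℕ) {f : ℝ → ℝ} {B : ℝ} (hB : ∀ y, |f y| ≤ B) (t y : ℝ) :
    |heat i f t y| ≤ (opC 0 + 1) * B := by
  have hB0 : 0 ≤ B := (abs_nonneg _).trans (hB 0)
  have := mul_nonneg (opC_nonneg 0) hB0
  unfold heat
  split_ifs with h
  · linarith [hB y]
  · have := abs_greenOp_le 0 i (not_le.1 h) y hB
    rw [pow_zero, inv_one, mul_one] at this
    linarith

lemma lintegral_heat_le (i : ℕ) {f : ℝ → ℝ} (hf : Continuous f) (t : ℝ) :
    ∫⁻ y in Ioi (0 : ℝ), ‖heat i f t y‖ₑ ≤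
      ENNReal.ofReal (opC 0 + 1) * ∫⁻ y in Ioi (0 : ℝ), ‖f y‖ₑ := by
  rcases le_or_gt t 0 with h | h
  · simp only [heat, if_pos h]
    refine le_mul_of_one_le_left' ?_
    rw [ENNReal.one_le_ofReal]
    linarith [opC_nonneg 0]
  · simp only [heat, if_neg h.not_ge]
    refine (lintegral_greenOp_le 0 i h hf).trans ?_
    rw [pow_zero, inv_one, mul_one]
    gcongr
    linarith

/-- Uniform convergence to uniformly continuous data. -/
lemma exists_abs_greenOp_sub_le (i : ℕ) (hi : i % 4 = 2 ∨ i % 4 = 3) {f : ℝ → ℝ} {B : ℝ}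
    (hf : UniformContinuous f) (hB : ∀ y, |f y| ≤ B) {ε : ℝ} (hε : 0 < ε) :
    ∃ δ > 0, ∀ t, 0 < t → t < δ → ∀ y, 0 ≤ y → |greenOp 0 i t f y - f y| ≤ ε := by
  have hB0 : 0 ≤ B := (abs_nonneg _).trans (hB 0)
  set c := greenC 0 with hc
  have hc0 : 0 ≤ c := greenC_nonneg 0
  set ε' := ε / (2 * (c * Real.pi + 1)) with hε'
  have hcp : 0 ≤ c * Real.pi := mul_nonneg hc0 Real.pi_pos.le
  have hε'0 : 0 < ε' := by positivity
  obtain ⟨d, hd, hfd⟩ := Metric.uniformContinuous_iff.1 hf ε' hε'0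
  -- `G` bounds the contribution of displacements larger than d uniformly in y; smaller ones are
  -- controlled by uniform continuity. The cutoff `min 1` is used in place of an indicator so that
  -- `G` is continuous.
  set G : ℝ → ℝ := fun τ => ∫ x, cauchyK 1 x * (2 * B * min 1 (|τ * x| / d)) with hG
  have hGi : ∀ τ, Integrable fun x => cauchyK 1 x * (2 * B * min 1 (|τ * x| / d)) := by
    intro τ
    refine (integrable_cauchyK one_pos).mul_bdd (c := 2 * B)
      (Continuous.aestronglyMeasurable (by fun_prop)) (Eventually.of_forall fun x => ?_)
    rw [Real.norm_eq_abs, abs_of_nonneg (by positivity)]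
    exact mul_le_of_le_one_right (by positivity) (min_le_left _ _)
  have hGc : Continuous G := by
    refine continuous_of_dominated (bound := fun x => cauchyK 1 x * (2 * B))
      (fun τ => (hGi τ).aestronglyMeasurable)
      (fun τ => Eventually.of_forall fun x => ?_) ((integrable_cauchyK one_pos).mul_const _)
      (Eventually.of_forall fun x => by fun_prop)
    have := cauchyK_nonneg zero_le_one x
    rw [Real.norm_eq_abs, abs_of_nonneg (by positivity)]
    refine mul_le_mul_of_nonneg_left ?_ this
    exact mul_le_of_le_one_right (by positivity) (min_le_left _ _)
  have hG0 : G 0 = 0 := by simp [hG]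
  have hlim : Tendsto (fun t => c * G (scale t)) (𝓝 0) (𝓝 0) := by
    have := ((hGc.tendsto 0).comp tendsto_scale_zero).const_mul c
    rwa [hG0, mul_zero] at this
  obtain ⟨δ, hδ, hδ'⟩ := Metric.eventually_nhds_iff.1 (hlim.eventually (gt_mem_nhds (half_pos hε)))
  refine ⟨δ, hδ, fun t ht htδ y hy => ?_⟩
  have h1 := abs_greenOp_sub_le i ht hy hf.continuous hB
  rw [greenOp_one_of_mod i hi ht, one_mul] at h1
  refine h1.trans ?_
  have h2 : cauchyOsc f (scale t) y ≤ ε' * Real.pi + G (scale t) := by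
    rw [hG, ← integral_cauchyK one_pos, ← integral_const_mul,
      ← integral_add ((integrable_cauchyK one_pos).const_mul _) (hGi _)]
    refine integral_mono (integrable_cauchyOsc hf.continuous hB _ _)
      (((integrable_cauchyK one_pos).const_mul _).add (hGi _)) fun x => ?_
    have hk := cauchyK_nonneg zero_le_one x
    suffices |f (y - scale t * x) - f y| ≤ ε' + 2 * B * min 1 (|scale t * x| / d) by
      have := mul_le_mul_of_nonneg_left this hk
      dsimp only
      linarith
    rcases lt_or_ge |scale t * x| d with h | h
    · have h3 : dist (y - scale t * x) y < d := by
        rwa [Real.dist_eq, sub_sub_cancel_left, abs_neg]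
      have h4 := hfd h3
      rw [Real.dist_eq] at h4
      have : 0 ≤ 2 * B * min 1 (|scale t * x| / d) := by positivity
      linarith
    · rw [min_eq_left ((one_le_div hd).2 h)]
      linarith [abs_sub (f (y - scale t * x)) (f y), hB (y - scale t * x), hB y]
  have h3 : c * G (scale t) < ε / 2 := hδ' (by rwa [Real.dist_eq, sub_zero, abs_of_pos ht])
  have h4 : c * (ε' * Real.pi) ≤ ε / 2 := by
    rw [hε']
    have : 0 < 2 * (c * Real.pi + 1) := by positivity
    rw [div_mul_eq_mul_div, mul_div_assoc', div_le_iff₀ this]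
    nlinarith
  have := mul_le_mul_of_nonneg_left h2 hc0
  linarith

/-! ### Convergence to the datum in L¹ -/

/-- Continuity of translations in L¹, read off from the continuity of the translation action on
`Lp`. -/
lemma tendsto_lintegral_comp_sub_sub {f : ℝ → ℝ} (hf : Integrable f) :
    Tendsto (fun h => ∫⁻ y, ‖f (y - h) - f y‖ₑ) (𝓝 0) (𝓝 0) := by
  have : Fact ((1 : ℝ≥0∞) ≠ ∞) := ⟨ENNReal.one_ne_top⟩
  have hm : MemLp f 1 := memLp_one_iff_integrable.2 hf
  have hc : Continuous fun h : ℝ => DomAddAct.mk (-h) +ᵥ hm.toLp f :=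
    (continuous_id.vadd continuous_const : Continuous fun c : (DomAddAct ℝ) => c +ᵥ hm.toLp f).comp
      (DomAddAct.continuous_mk.comp continuous_neg)
  have h0 := hc.tendsto 0
  rw [tendsto_iff_edist_tendsto_0] at h0
  refine h0.congr fun h => ?_
  rw [neg_zero, DomAddAct.mk_zero, zero_vadd, DomAddAct.mk_vadd_toLp, Lp.edist_toLp_toLp,
    eLpNorm_one_eq_lintegral_enorm]
  refine lintegral_congr fun y => ?_
  simp only [Pi.sub_apply, vadd_eq_add, sub_eq_neg_add]

lemma integrable_of_integrableOn_Ioi {f : ℝ → ℝ} (hm : ∀ y, f (max y 0) = f y) (h0 : f 0 = 0)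
    (hf : IntegrableOn f (Ioi 0)) : Integrable f := by
  have : (Ioi (0 : ℝ)).indicator f = f := by
    refine indicator_eq_self.2 fun y hy => ?_
    by_contra h
    rw [mem_Ioi, not_lt] at h
    rw [Function.mem_support, ← hm, max_eq_right h] at hy
    exact hy h0
  rw [← this]
  exact hf.integrable_indicator measurableSet_Ioi

/-- Convergence in `L¹` at time zero. -/
lemma tendsto_lintegral_greenOp_sub (i : ℕ) {f : ℝ → ℝ} {B : ℝ} (hf : Continuous f)
    (hB : ∀ y, |f y| ≤ B) (hm : ∀ y, f (max y 0) = f y) (h0 : f 0 = 0)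
    (hfi : IntegrableOn f (Ioi 0)) :
    Tendsto (fun t => ∫⁻ y in Ioi (0 : ℝ), ‖greenOp 0 i t f y - f y‖ₑ) (𝓝[>] 0) (𝓝 0) := by
  have hfint := integrable_of_integrableOn_Ioi hm h0 hfi
  have hN : ∫⁻ y, ‖f y‖ₑ ≠ ∞ := hfint.2.ne
  set T : ℝ → ℝ≥0∞ := fun h => ∫⁻ y, ‖f (y - h) - f y‖ₑ with hT
  have hTm : Measurable T := by
    have : Measurable fun p : ℝ × ℝ => ‖f (p.2 - p.1) - f p.2‖ₑ :=
      (Continuous.measurable (by fun_prop)).enorm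
    exact this.lintegral_prod_right'
  have hTb : ∀ h, T h ≤ 2 * ∫⁻ y, ‖f y‖ₑ := by
    intro h
    calc T h ≤ ∫⁻ y, (‖f (y - h)‖ₑ + ‖f y‖ₑ) := lintegral_mono fun y => enorm_sub_le
      _ = (∫⁻ y, ‖f (y - h)‖ₑ) + ∫⁻ y, ‖f y‖ₑ := lintegral_add_right _ hf.measurable.enorm
      _ = _ := by rw [lintegral_sub_right_eq_self fun y => ‖f y‖ₑ, two_mul]
  have hcc := continuous_cauchyK 1
  have hcm : Measurable fun x => ENNReal.ofReal (cauchyK 1 x) := hcc.measurable.ennreal_ofReal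
  have hcf : ∫⁻ x, ENNReal.ofReal (cauchyK 1 x) ≠ ∞ := by
    rw [← ofReal_integral_eq_lintegral_ofReal (integrable_cauchyK one_pos)
      (Eventually.of_forall fun x => cauchyK_nonneg zero_le_one x)]
    exact ENNReal.ofReal_ne_top
  -- The oscillation part: after Tonelli it is the average of the L¹ moduli of translation over the
  -- Cauchy kernel, and dominated convergence applies.
  have hS : Tendsto (fun τ => ∫⁻ x, ENNReal.ofReal (cauchyK 1 x) * T (τ * x)) (𝓝 0) (𝓝 0) := by
    have h1 := tendsto_lintegral_filter_of_dominated_convergence (μ := volume) (l := 𝓝 (0 : ℝ))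
      (F := fun τ x => ENNReal.ofReal (cauchyK 1 x) * T (τ * x)) (f := fun _ => 0)
      (fun x => ENNReal.ofReal (cauchyK 1 x) * (2 * ∫⁻ y, ‖f y‖ₑ))
      (Eventually.of_forall fun τ => hcm.mul (hTm.comp (by fun_prop)))
      (Eventually.of_forall fun τ => Eventually.of_forall fun x => by
        gcongr; exact hTb _)
      (by
        rw [lintegral_mul_const _ hcm]
        exact ENNReal.mul_ne_top hcf (ENNReal.mul_ne_top (by simp) hN))
      (Eventually.of_forall fun x => by
        have h2 : Tendsto (fun τ : ℝ => T (τ * x)) (𝓝 0) (𝓝 0) := by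
          refine (tendsto_lintegral_comp_sub_sub hfint).comp ?_
          have : Continuous fun τ : ℝ => τ * x := by fun_prop
          simpa using this.tendsto 0
        have h3 := ENNReal.Tendsto.const_mul (a := ENNReal.ofReal (cauchyK 1 x)) h2
          (Or.inr ENNReal.ofReal_ne_top)
        rwa [mul_zero] at h3)
    simpa using h1
  have hS' : Tendsto (fun t => ENNReal.ofReal (greenC 0) *
      ∫⁻ x, ENNReal.ofReal (cauchyK 1 x) * T (scale t * x)) (𝓝[>] 0) (𝓝 0) := by
    have h3 := ENNReal.Tendsto.const_mul (a := ENNReal.ofReal (greenC 0))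
      (hS.comp tendsto_scale_zero) (Or.inr ENNReal.ofReal_ne_top)
    rw [mul_zero] at h3
    exact h3.mono_left nhdsWithin_le_nhds
  -- The mass-defect part: the defect is bounded and tends to zero at every y > 0, with a multiple
  -- of |f| as majorant.
  have hM : Tendsto (fun t => ∫⁻ y in Ioi (0 : ℝ), ‖(greenOp 0 i t (fun _ => 1) y - 1) * f y‖ₑ)
      (𝓝[>] 0) (𝓝 0) := by
    have h1 := tendsto_lintegral_filter_of_dominated_convergence
      (μ := volume.restrict (Ioi (0 : ℝ))) (l := 𝓝[>] (0 : ℝ))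
      (F := fun t y => ‖(greenOp 0 i t (fun _ => 1) y - 1) * f y‖ₑ) (f := fun _ => 0)
      (fun y => ENNReal.ofReal (opC 0 + 1) * ‖f y‖ₑ) (by
        filter_upwards [eventually_mem_nhdsWithin] with t ht
        have := continuous_greenOp 0 i ht continuous_const (B := 1) (f := fun _ => 1)
          fun _ => by simp
        exact (Continuous.measurable (by fun_prop)).enorm) (by
        filter_upwards [eventually_mem_nhdsWithin] with t ht
        refine Eventually.of_forall fun y => ?_
        rw [enorm_mul]
        gcongr
        rw [Real.enorm_eq_ofReal_abs]
        exact ENNReal.ofReal_le_ofReal (abs_greenOp_one_sub_one_le i ht y))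
      (by
        rw [lintegral_const_mul _ hf.measurable.enorm]
        exact ENNReal.mul_ne_top ENNReal.ofReal_ne_top hfi.2.ne) (by
        filter_upwards [ae_restrict_mem measurableSet_Ioi] with y hy
        have hy : 0 < y := hy
        have h3 : Tendsto (fun t : ℝ => y / scale t) (𝓝[>] 0) atTop := by
          have hs : Tendsto scale (𝓝[>] 0) (𝓝[>] 0) := by
            refine tendsto_nhdsWithin_of_tendsto_nhds_of_eventually_within _
              (tendsto_scale_zero.mono_left nhdsWithin_le_nhds) ?_
            filter_upwards [eventually_mem_nhdsWithin] with t ht using scale_pos ht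
          simp_rw [div_eq_mul_inv]
          exact Tendsto.pos_mul_atTop hy tendsto_const_nhds hs.inv_tendsto_nhdsGT_zero
        have h4 := ((tendsto_greenOp_one_atTop i).comp h3).sub_const 1
        rw [sub_self] at h4
        have h5 := (h4.mul_const (f y)).enorm
        rw [zero_mul, enorm_zero] at h5
        refine h5.congr' ?_
        filter_upwards [eventually_mem_nhdsWithin] with t ht
        rw [greenOp_one_scale i ht]
        rfl)
    simpa using h1
  have hsum := hS'.add hM
  rw [add_zero] at hsum
  refine tendsto_of_tendsto_of_tendsto_of_le_of_le' tendsto_const_nhds hsum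
    (Eventually.of_forall fun _ => zero_le) ?_
  filter_upwards [eventually_mem_nhdsWithin] with t ht
  have ht : 0 < t := ht
  have hgc : Continuous (greenOp 0 i t fun _ => 1) :=
    continuous_greenOp 0 i ht continuous_const (B := 1) fun _ => by simp
  have hpt : ∀ y ∈ Ioi (0 : ℝ), ‖greenOp 0 i t f y - f y‖ₑ ≤
      ENNReal.ofReal (greenC 0) * ENNReal.ofReal (cauchyOsc f (scale t) y) +
        ‖(greenOp 0 i t (fun _ => 1) y - 1) * f y‖ₑ := by
    intro y hy
    have e : greenOp 0 i t f y - f y = (greenOp 0 i t f y - greenOp 0 i t (fun _ => 1) y * f y) +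
      (greenOp 0 i t (fun _ => 1) y - 1) * f y := by ring
    rw [e]
    refine (enorm_add_le _ _).trans ?_
    gcongr
    rw [Real.enorm_eq_ofReal_abs, ← ENNReal.ofReal_mul (greenC_nonneg 0)]
    exact ENNReal.ofReal_le_ofReal (abs_greenOp_sub_le i ht (le_of_lt hy) hf hB)
  have hco : ∀ y, ENNReal.ofReal (cauchyOsc f (scale t) y) =
      ∫⁻ x, ENNReal.ofReal (cauchyK 1 x) * ‖f (y - scale t * x) - f y‖ₑ := by
    intro y
    rw [cauchyOsc, ofReal_integral_eq_lintegral_ofReal (integrable_cauchyOsc hf hB _ _)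
      (Eventually.of_forall fun x => mul_nonneg (cauchyK_nonneg zero_le_one x) (abs_nonneg _))]
    refine lintegral_congr fun x => ?_
    rw [ENNReal.ofReal_mul (cauchyK_nonneg zero_le_one x), Real.enorm_eq_ofReal_abs]
  calc ∫⁻ y in Ioi (0 : ℝ), ‖greenOp 0 i t f y - f y‖ₑ
      ≤ ∫⁻ y in Ioi (0 : ℝ), (ENNReal.ofReal (greenC 0) *
        ENNReal.ofReal (cauchyOsc f (scale t) y) +
          ‖(greenOp 0 i t (fun _ => 1) y - 1) * f y‖ₑ) :=
        setLIntegral_mono' measurableSet_Ioi hpt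
    _ = (∫⁻ y in Ioi (0 : ℝ), ENNReal.ofReal (greenC 0) *
        ENNReal.ofReal (cauchyOsc f (scale t) y)) +
          ∫⁻ y in Ioi (0 : ℝ), ‖(greenOp 0 i t (fun _ => 1) y - 1) * f y‖ₑ :=
        lintegral_add_right _ (Continuous.measurable (by fun_prop)).enorm
    _ ≤ _ := by
        refine add_le_add ?_ le_rfl
        rw [lintegral_const_mul' _ _ ENNReal.ofReal_ne_top]
        refine mul_le_mul' le_rfl ?_
        refine (setLIntegral_le_lintegral _ _).trans ?_
        simp_rw [hco]
        rw [lintegral_lintegral_swap]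
        · refine le_of_eq (lintegral_congr fun x => ?_)
          rw [lintegral_const_mul' _ _ ENNReal.ofReal_ne_top]
        · have m1 : Measurable fun p : ℝ × ℝ => ENNReal.ofReal (cauchyK 1 p.2) :=
            hcm.comp measurable_snd
          have m2 : Measurable fun p : ℝ × ℝ => ‖f (p.1 - scale t * p.2) - f p.1‖ₑ :=
            (Continuous.measurable (by fun_prop)).enorm
          exact (m1.mul m2).aemeasurable

/-! ### Duhamel integrals -/

lemma inv_scale_pow {r : ℝ} (hr : 0 < r) (m : ℕ) :
    (scale r ^ m)⁻¹ = r ^ (-(m / 4 : ℝ)) := by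
  rw [scale, ← Real.rpow_natCast, ← Real.rpow_mul hr.le, Real.rpow_neg hr.le]
  congr 2
  ring

lemma inv_scale_pow_nonneg {r : ℝ} (hr : 0 < r) (m : ℕ) : 0 ≤ (scale r ^ m)⁻¹ :=
  inv_nonneg.2 (pow_nonneg (scale_pos hr).le m)

/-- The exponent -m/4 exceeds -1 exactly when m ≤ 3: at most three derivatives may rest on the
kernel of a Duhamel integral. -/
lemma integrableOn_inv_scale_pow {m : ℕ} (hm : m ≤ 3) (t : ℝ) :
    IntegrableOn (fun r => (scale r ^ m)⁻¹) (Ioc 0 t) := by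
  rcases le_or_gt t 0 with h | h
  · simp [Ioc_eq_empty_of_le h]
  have hm' : (m : ℝ) ≤ 3 := by exact_mod_cast hm
  have h1 : IntervalIntegrable (fun r : ℝ => r ^ (-(m / 4 : ℝ))) volume 0 t :=
    intervalIntegral.intervalIntegrable_rpow' (by linarith)
  rw [intervalIntegrable_iff_integrableOn_Ioc_of_le h.le] at h1
  exact h1.congr_fun (fun r hr => (inv_scale_pow hr.1 m).symm) measurableSet_Ioc

/-- The integral of `r ^ (-m / 4)` over `(0, t]`. -/
noncomputable def scaleInt (m : ℕ) (t : ℝ) : ℝ := ∫ r in Ioc 0 t, (scale r ^ m)⁻¹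

lemma scaleInt_nonneg (m : ℕ) (t : ℝ) : 0 ≤ scaleInt m t :=
  setIntegral_nonneg measurableSet_Ioc fun _ hr => inv_scale_pow_nonneg hr.1 m

lemma scaleInt_mono {m : ℕ} (hm : m ≤ 3) : Monotone (scaleInt m) := by
  intro s t hst
  refine setIntegral_mono_set (integrableOn_inv_scale_pow hm t) ?_
    (Ioc_subset_Ioc_right hst).eventuallyLE
  filter_upwards [ae_restrict_mem measurableSet_Ioc] with r hr
  exact inv_scale_pow_nonneg hr.1 m

lemma tendsto_scaleInt {m : ℕ} (hm : m ≤ 3) : Tendsto (scaleInt m) (𝓝[>] 0) (𝓝 0) := by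
  have hm' : (m : ℝ) ≤ 3 := by exact_mod_cast hm
  have hp : 0 < -(m / 4 : ℝ) + 1 := by linarith
  have h1 : Tendsto (fun t : ℝ => t ^ (-(m / 4 : ℝ) + 1) / (-(m / 4 : ℝ) + 1)) (𝓝[>] 0) (𝓝 0) := by
    have := (((Real.continuous_rpow_const hp.le).tendsto 0).div_const
      (-(m / 4 : ℝ) + 1)).mono_left (nhdsWithin_le_nhds (s := Ioi 0))
    rwa [Real.zero_rpow hp.ne', zero_div] at this
  refine h1.congr' ?_
  filter_upwards [eventually_mem_nhdsWithin] with t ht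
  have ht : 0 < t := ht
  rw [scaleInt, setIntegral_congr_fun measurableSet_Ioc fun r hr => inv_scale_pow hr.1 m,
    ← intervalIntegral.integral_of_le ht.le, integral_rpow (Or.inl (by linarith)),
    Real.zero_rpow hp.ne', sub_zero]

/-- The Duhamel integral with the kernel `greenK m i`. -/
noncomputable def duhamel (m i : ℕ) (f : ℝ → ℝ → ℝ) (t y : ℝ) : ℝ :=
  ∫ r in Ioc 0 t, greenOp m i r (f (t - r)) y

lemma duhamel_of_nonpos (m i : ℕ) (f : ℝ → ℝ → ℝ) {t : ℝ} (ht : t ≤ 0) (y : ℝ) :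
    duhamel m i f t y = 0 := by
  simp [duhamel, Ioc_eq_empty_of_le ht]

lemma duhamel_max (m i : ℕ) (f : ℝ → ℝ → ℝ) (t y : ℝ) :
    duhamel m i f t (max y 0) = duhamel m i f t y := by
  simp only [duhamel, greenOp_max]

lemma duhamel_add_four (m i : ℕ) : duhamel m (i + 4) = duhamel m i := by
  ext f t y
  simp only [duhamel, greenOp_add_four]

lemma continuous_slice {f : ℝ → ℝ → ℝ} (hf : Continuous (Function.uncurry f)) (s : ℝ) :
    Continuous (f s) := hf.comp (by fun_prop : Continuous fun y => (s, y))

lemma aestronglyMeasurable_greenOp_sub (m i : ℕ) {f : ℝ → ℝ → ℝ} {B : ℝ}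
    (hf : Continuous (Function.uncurry f)) (hB : ∀ s y, |f s y| ≤ B) (t T y : ℝ) :
    AEStronglyMeasurable (fun r => greenOp m i r (f (t - r)) y) (volume.restrict (Ioc 0 T)) := by
  refine ContinuousOn.aestronglyMeasurable ?_ measurableSet_Ioc
  exact (continuousOn_greenOp m i hf hB).comp (f := fun r => (r, t - r, y)) (by fun_prop)
    fun r hr => ⟨hr.1, mem_univ _⟩

lemma integrableOn_greenOp_sub {m : ℕ} (hm : m ≤ 3) (i : ℕ) {f : ℝ → ℝ → ℝ} {B : ℝ}
    (hf : Continuous (Function.uncurry f)) (hB : ∀ s y, |f s y| ≤ B) (t T y : ℝ) :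
    IntegrableOn (fun r => greenOp m i r (f (t - r)) y) (Ioc 0 T) := by
  refine Integrable.mono' (((integrableOn_inv_scale_pow hm T).const_mul (opC m)).mul_const B)
    (aestronglyMeasurable_greenOp_sub m i hf hB t T y) ?_
  filter_upwards [ae_restrict_mem measurableSet_Ioc] with r hr
  exact abs_greenOp_le m i hr.1 y fun y => hB (t - r) y

lemma abs_duhamel_le {m : ℕ} (hm : m ≤ 3) (i : ℕ) {f : ℝ → ℝ → ℝ} {t B : ℝ}
    (hB : ∀ s ∈ Ico 0 t, ∀ y, |f s y| ≤ B) (y : ℝ) :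
    |duhamel m i f t y| ≤ opC m * scaleInt m t * B := by
  have h := norm_integral_le_of_norm_le (f := fun r => greenOp m i r (f (t - r)) y)
    (((integrableOn_inv_scale_pow hm t).const_mul (opC m)).mul_const B) (by
      filter_upwards [ae_restrict_mem measurableSet_Ioc] with r hr
      exact abs_greenOp_le m i hr.1 y (hB (t - r) ⟨by linarith [hr.2], by linarith [hr.1]⟩))
  rwa [integral_mul_const, integral_const_mul] at h

/-- The L¹ bound `β` may depend on time; the uniqueness argument takes it exponential. -/
lemma lintegral_duhamel_le (m i : ℕ) {f : ℝ → ℝ → ℝ} {B : ℝ}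
    (hf : Continuous (Function.uncurry f)) (hB : ∀ s y, |f s y| ≤ B) {t : ℝ} {β : ℝ → ℝ≥0∞}
    (hβ : ∀ s ∈ Ico 0 t, ∫⁻ y in Ioi (0 : ℝ), ‖f s y‖ₑ ≤ β s) :
    ∫⁻ y in Ioi (0 : ℝ), ‖duhamel m i f t y‖ₑ ≤
      ∫⁻ r in Ioc 0 t, ENNReal.ofReal (opC m * (scale r ^ m)⁻¹) * β (t - r) := by
  calc ∫⁻ y in Ioi (0 : ℝ), ‖duhamel m i f t y‖ₑ
      ≤ ∫⁻ y in Ioi (0 : ℝ), ∫⁻ r in Ioc 0 t, ‖greenOp m i r (f (t - r)) y‖ₑ :=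
        lintegral_mono fun y => enorm_integral_le_lintegral_enorm _
    _ = ∫⁻ r in Ioc 0 t, ∫⁻ y in Ioi (0 : ℝ), ‖greenOp m i r (f (t - r)) y‖ₑ := by
        refine lintegral_lintegral_swap ?_
        rw [Measure.prod_restrict]
        have hc : ContinuousOn (fun p : ℝ × ℝ => greenOp m i p.2 (f (t - p.2)) p.1)
            (Ioi 0 ×ˢ Ioc 0 t) :=
          (continuousOn_greenOp m i hf hB).comp (f := fun p : ℝ × ℝ => (p.2, t - p.2, p.1))
            (by fun_prop) fun p hp => ⟨hp.2.1, mem_univ _⟩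
        exact (hc.aemeasurable (measurableSet_Ioi.prod measurableSet_Ioc)).enorm
    _ ≤ _ := by
        refine setLIntegral_mono_ae' measurableSet_Ioc (Eventually.of_forall fun r hr => ?_)
        refine (lintegral_greenOp_le m i hr.1 (continuous_slice hf _)).trans ?_
        gcongr
        exact hβ _ ⟨by linarith [hr.2], by linarith [hr.1]⟩

lemma lintegral_duhamel_le_const {m : ℕ} (hm : m ≤ 3) (i : ℕ) {f : ℝ → ℝ → ℝ} {B : ℝ}
    (hf : Continuous (Function.uncurry f)) (hB : ∀ s y, |f s y| ≤ B) {t : ℝ} {b : ℝ≥0∞}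
    (hb : ∀ s ∈ Ico 0 t, ∫⁻ y in Ioi (0 : ℝ), ‖f s y‖ₑ ≤ b) :
    ∫⁻ y in Ioi (0 : ℝ), ‖duhamel m i f t y‖ₑ ≤ ENNReal.ofReal (opC m * scaleInt m t) * b := by
  refine (lintegral_duhamel_le m i hf hB hb).trans ?_
  have hi := (integrableOn_inv_scale_pow hm t).const_mul (opC m)
  rw [lintegral_mul_const'' _ hi.aestronglyMeasurable.aemeasurable.ennreal_ofReal,
    ← ofReal_integral_eq_lintegral_ofReal hi, integral_const_mul, scaleInt]
  filter_upwards [ae_restrict_mem measurableSet_Ioc] with r hr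
  exact mul_nonneg (opC_nonneg m) (inv_scale_pow_nonneg hr.1 m)

lemma continuous_duhamel {m : ℕ} (hm : m ≤ 3) (i : ℕ) {f : ℝ → ℝ → ℝ} {B : ℝ}
    (hf : Continuous (Function.uncurry f)) (hB : ∀ s y, |f s y| ≤ B) :
    Continuous (Function.uncurry (duhamel m i f)) := by
  rw [continuous_iff_continuousAt]
  rintro ⟨t₀, y₀⟩
  have ev : ∀ᶠ p : ℝ × ℝ in 𝓝 (t₀, y₀), p.1 < t₀ + 1 :=
    continuousAt_fst.eventually (gt_mem_nhds (by simp))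
  -- The upper limit of integration depends on the point. It is moved into an indicator, whose only
  -- discontinuity at the point considered is r = t₀, a null set.
  have hev : (fun p : ℝ × ℝ => ∫ r in Ioc 0 (t₀ + 1), (Iic p.1).indicator
      (fun r => greenOp m i r (f (p.1 - r)) p.2) r) =ᶠ[𝓝 (t₀, y₀)]
      Function.uncurry (duhamel m i f) := by
    filter_upwards [ev] with p hp
    rw [setIntegral_indicator measurableSet_Iic, Ioc_inter_Iic, min_eq_right hp.le]
    rfl
  refine ContinuousAt.congr ?_ hev
  refine continuousAt_of_dominated (bound := fun r => opC m * (scale r ^ m)⁻¹ * B)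
    (Eventually.of_forall fun p =>
      (aestronglyMeasurable_greenOp_sub m i hf hB p.1 _ p.2).indicator measurableSet_Iic)
    (Eventually.of_forall fun p => ?_)
    (((integrableOn_inv_scale_pow hm _).const_mul _).mul_const B) ?_
  · filter_upwards [ae_restrict_mem measurableSet_Ioc] with r hr
    refine (norm_indicator_le_norm_self _ _).trans ?_
    exact abs_greenOp_le m i hr.1 p.2 fun y => hB _ y
  · have hne : ∀ᵐ r ∂(volume.restrict (Ioc 0 (t₀ + 1))), r ≠ t₀ :=
      ae_restrict_of_ae (Measure.ae_ne volume t₀)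
    filter_upwards [ae_restrict_mem measurableSet_Ioc, hne] with r hr hrt
    rcases lt_or_gt_of_ne hrt with h | h
    · have hc : ContinuousAt (fun p : ℝ × ℝ => greenOp m i r (f (p.1 - r)) p.2) (t₀, y₀) := by
        have h1 : ContinuousAt (fun p : ℝ × ℝ × ℝ => greenOp m i p.1 (f p.2.1) p.2.2)
            (r, t₀ - r, y₀) := (continuousOn_greenOp m i hf hB).continuousAt
          ((isOpen_Ioi.prod isOpen_univ).mem_nhds ⟨hr.1, mem_univ _⟩)
        exact ContinuousAt.comp (f := fun p : ℝ × ℝ => (r, p.1 - r, p.2)) (x := (t₀, y₀)) h1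
          (Continuous.continuousAt (by fun_prop))
      refine hc.congr ?_
      filter_upwards [continuousAt_fst.eventually (lt_mem_nhds h)] with p hp
      have hn : r ∈ Iic p.1 := le_of_lt hp
      simp only [indicator_of_mem hn]
    · refine ContinuousAt.congr (f := fun _ => (0 : ℝ)) continuousAt_const ?_
      filter_upwards [continuousAt_fst.eventually (gt_mem_nhds h)] with p hp
      have hn : r ∉ Iic p.1 := not_le.2 hp
      simp only [indicator_of_notMem hn]

lemma hasDerivAt_duhamel {m : ℕ} (hm : m ≤ 2) (i : ℕ) {f : ℝ → ℝ → ℝ} {B : ℝ}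
    (hf : Continuous (Function.uncurry f)) (hB : ∀ s y, |f s y| ≤ B) (t : ℝ) {y : ℝ} (hy : 0 < y) :
    HasDerivAt (duhamel m i f t) (-duhamel (m + 1) (i + 1) f t y) y := by
  unfold duhamel
  rw [← integral_neg]
  refine (hasDerivAt_integral_of_dominated_loc_of_deriv_le
    (F := fun z r => greenOp m i r (f (t - r)) z)
    (F' := fun z r => -greenOp (m + 1) (i + 1) r (f (t - r)) z)
    (bound := fun r => opC (m + 1) * (scale r ^ (m + 1))⁻¹ * B) (Ioi_mem_nhds hy)
    (Eventually.of_forall fun z => aestronglyMeasurable_greenOp_sub m i hf hB t t z)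
    (integrableOn_greenOp_sub (by omega) i hf hB t t y)
    (aestronglyMeasurable_greenOp_sub (m + 1) (i + 1) hf hB t t y).neg ?_
    (((integrableOn_inv_scale_pow (by omega) t).const_mul _).mul_const B) ?_).2
  · filter_upwards [ae_restrict_mem measurableSet_Ioc] with r hr z _
    rw [norm_neg]
    exact abs_greenOp_le (m + 1) (i + 1) hr.1 z fun y => hB _ y
  · filter_upwards [ae_restrict_mem measurableSet_Ioc] with r hr z hz
    exact hasDerivAt_greenOp m i hr.1 hz (continuous_slice hf _) (hB _)

lemma duhamel_succ (m i : ℕ) {f f' : ℝ → ℝ → ℝ} {B B' : ℝ}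
    (hf : Continuous (Function.uncurry f)) (hB : ∀ s y, |f s y| ≤ B)
    (hf' : Continuous (Function.uncurry f')) (hB' : ∀ s y, |f' s y| ≤ B')
    (hd : ∀ s y, 0 < y → HasDerivAt (f s) (f' s y) y)
    (h0 : ∀ s, osc (m + 3 * i) 0 * f s 0 = 0) (t y : ℝ) :
    duhamel (m + 1) i f t y = -duhamel m i f' t y := by
  unfold duhamel
  rw [← integral_neg]
  refine setIntegral_congr_fun measurableSet_Ioc fun r hr => ?_
  exact greenOp_succ m i hr.1 y (continuous_slice hf _) (hB _) (continuous_slice hf' _) (hB' _)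
    (hd _) (h0 _)

lemma duhamel_sub {m : ℕ} (hm : m ≤ 3) (i : ℕ) {f g : ℝ → ℝ → ℝ} {B B' : ℝ}
    (hf : Continuous (Function.uncurry f)) (hB : ∀ s y, |f s y| ≤ B)
    (hg : Continuous (Function.uncurry g)) (hB' : ∀ s y, |g s y| ≤ B') (t y : ℝ) :
    duhamel m i (fun s y => f s y - g s y) t y = duhamel m i f t y - duhamel m i g t y := by
  unfold duhamel
  rw [← integral_sub (integrableOn_greenOp_sub hm i hf hB t t y)
    (integrableOn_greenOp_sub hm i hg hB' t t y)]
  refine setIntegral_congr_fun measurableSet_Ioc fun r hr => ?_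
  exact greenOp_sub m i hr.1 y (continuous_slice hf _) (hB _) (continuous_slice hg _) (hB' _)

/-! ### Mild solutions -/

/-- The primitive in `y` that vanishes at `0`. -/
noncomputable def prim (u : ℝ → ℝ → ℝ) (t y : ℝ) : ℝ := ∫ η in (0 : ℝ)..max y 0, u t η

/-- Continuous functions of `(t, y)` that are bounded by `M` and whose time slices have `L¹` norm
at most `M` on the half-line. -/
structure BddField (M : ℝ) (u : ℝ → ℝ → ℝ) : Prop where
  cont : Continuous (Function.uncurry u)
  bdd : ∀ t y, |u t y| ≤ M
  int : ∀ t, ∫⁻ y in Ioi (0 : ℝ), ‖u t y‖ₑ ≤ ENNReal.ofReal M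

lemma BddField.nonneg {M : ℝ} {u : ℝ → ℝ → ℝ} (h : BddField M u) : 0 ≤ M :=
  (abs_nonneg _).trans (h.bdd 0 0)

lemma BddField.mono {M M' : ℝ} {u : ℝ → ℝ → ℝ} (h : BddField M u) (hM : M ≤ M') : BddField M' u :=
  ⟨h.cont, fun t y => (h.bdd t y).trans hM, fun t => (h.int t).trans (ENNReal.ofReal_le_ofReal hM)⟩

lemma continuous_prim {u : ℝ → ℝ → ℝ} (hu : Continuous (Function.uncurry u)) :
    Continuous (Function.uncurry (prim u)) := by
  have : Continuous (Function.uncurry fun (p : ℝ × ℝ) (η : ℝ) => u p.1 η) :=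
    hu.comp (by fun_prop : Continuous fun q : (ℝ × ℝ) × ℝ => (q.1.1, q.2))
  exact intervalIntegral.continuous_parametric_intervalIntegral_of_continuous this (by fun_prop)

/-- The nonlocal term is controlled uniformly in y by the L¹ norm only; this is why the contraction
uses L¹ beside the sup norm. -/
lemma enorm_prim_sub_le {u v : ℝ → ℝ → ℝ} (hu : Continuous (Function.uncurry u))
    (hv : Continuous (Function.uncurry v)) (t y : ℝ) :
    ‖prim u t y - prim v t y‖ₑ ≤ ∫⁻ y in Ioi (0 : ℝ), ‖u t y - v t y‖ₑ := by
  unfold prim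
  rw [← intervalIntegral.integral_sub ((continuous_slice hu t).intervalIntegrable _ _)
    ((continuous_slice hv t).intervalIntegrable _ _),
    intervalIntegral.integral_of_le (le_max_right _ _)]
  exact (enorm_integral_le_lintegral_enorm _).trans (lintegral_mono_set Ioc_subset_Ioi_self)

lemma enorm_prim_le {u : ℝ → ℝ → ℝ} (t y : ℝ) :
    ‖prim u t y‖ₑ ≤ ∫⁻ y in Ioi (0 : ℝ), ‖u t y‖ₑ := by
  unfold prim
  rw [intervalIntegral.integral_of_le (le_max_right _ _)]
  exact (enorm_integral_le_lintegral_enorm _).trans (lintegral_mono_set Ioc_subset_Ioi_self)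

lemma abs_le_of_enorm_le {x M : ℝ} (hM : 0 ≤ M) (h : ‖x‖ₑ ≤ ENNReal.ofReal M) : |x| ≤ M := by
  rwa [Real.enorm_eq_ofReal_abs, ENNReal.ofReal_le_ofReal_iff hM] at h

lemma enorm_le_ofReal {x M : ℝ} (h : |x| ≤ M) : ‖x‖ₑ ≤ ENNReal.ofReal M := by
  rw [Real.enorm_eq_ofReal_abs]
  exact ENNReal.ofReal_le_ofReal h

lemma BddField.abs_prim_le {M : ℝ} {u : ℝ → ℝ → ℝ} (h : BddField M u) (t y : ℝ) :
    |prim u t y| ≤ M :=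
  abs_le_of_enorm_le h.nonneg ((enorm_prim_le t y).trans (h.int t))

lemma hasDerivAt_prim {u : ℝ → ℝ → ℝ} (hu : Continuous (Function.uncurry u)) (t : ℝ) {y : ℝ}
    (hy : 0 < y) : HasDerivAt (prim u t) (u t y) y := by
  have hc := continuous_slice hu t
  refine (intervalIntegral.integral_hasDerivAt_right (hc.intervalIntegrable 0 y)
    (hc.stronglyMeasurableAtFilter _ _) hc.continuousAt).congr_of_eventuallyEq ?_
  filter_upwards [lt_mem_nhds hy] with z hz
  rw [prim, max_eq_left hz.le]

lemma lintegral_enorm_mul_le {f g : ℝ → ℝ} {B : ℝ} (hg : ∀ y, |g y| ≤ B) :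
    ∫⁻ y in Ioi (0 : ℝ), ‖f y * g y‖ₑ ≤
      ENNReal.ofReal B * ∫⁻ y in Ioi (0 : ℝ), ‖f y‖ₑ := by
  rw [← lintegral_const_mul' _ _ ENNReal.ofReal_ne_top]
  refine lintegral_mono fun y => ?_
  rw [enorm_mul, mul_comm]
  gcongr
  exact enorm_le_ofReal (hg y)

/-- The undifferentiated part of the nonlinearity `2 u² - ∂_y (u ∂_y⁻¹ u)`. -/
def source (u : ℝ → ℝ → ℝ) (t y : ℝ) : ℝ := 2 * u t y ^ 2

/-- The flux of the nonlinearity `2 u² - ∂_y (u ∂_y⁻¹ u)`. -/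
noncomputable def flux (u : ℝ → ℝ → ℝ) (t y : ℝ) : ℝ := u t y * prim u t y

lemma continuous_source {u : ℝ → ℝ → ℝ} (hu : Continuous (Function.uncurry u)) :
    Continuous (Function.uncurry (source u)) := continuous_const.mul (hu.pow 2)

lemma continuous_flux {u : ℝ → ℝ → ℝ} (hu : Continuous (Function.uncurry u)) :
    Continuous (Function.uncurry (flux u)) := hu.mul (continuous_prim hu)

section

variable {M : ℝ} {u v : ℝ → ℝ → ℝ}

lemma BddField.abs_source_le (hu : BddField M u) (t y : ℝ) : |source u t y| ≤ 2 * M ^ 2 := by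
  have := abs_le.1 (hu.bdd t y)
  rw [source, abs_of_nonneg (by positivity)]
  nlinarith

lemma BddField.abs_flux_le (hu : BddField M u) (t y : ℝ) : |flux u t y| ≤ M ^ 2 := by
  rw [flux, abs_mul, sq]
  exact mul_le_mul (hu.bdd t y) (hu.abs_prim_le t y) (abs_nonneg _) hu.nonneg

lemma BddField.lintegral_source_le (hu : BddField M u) (t : ℝ) :
    ∫⁻ y in Ioi (0 : ℝ), ‖source u t y‖ₑ ≤ ENNReal.ofReal (2 * M ^ 2) := by
  have hM := hu.nonneg
  have h := lintegral_enorm_mul_le (f := u t) (g := fun y => 2 * u t y) (B := 2 * M) fun y => by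
    rw [abs_mul, abs_two]; linarith [hu.bdd t y]
  have e : ∀ y, source u t y = u t y * (2 * u t y) := fun y => by rw [source]; ring
  simp_rw [e]
  refine h.trans ?_
  rw [show 2 * M ^ 2 = 2 * M * M by ring,
    ENNReal.ofReal_mul (p := 2 * M) (q := M) (by positivity)]
  exact mul_le_mul' le_rfl (hu.int t)

lemma BddField.lintegral_flux_le (hu : BddField M u) (t : ℝ) :
    ∫⁻ y in Ioi (0 : ℝ), ‖flux u t y‖ₑ ≤ ENNReal.ofReal (M ^ 2) := by
  refine (lintegral_enorm_mul_le (hu.abs_prim_le t)).trans ?_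
  rw [sq, ENNReal.ofReal_mul hu.nonneg]
  exact mul_le_mul' le_rfl (hu.int t)

lemma lintegral_source_sub_le (hu : BddField M u) (hv : BddField M v) (t : ℝ) :
    ∫⁻ y in Ioi (0 : ℝ), ‖source u t y - source v t y‖ₑ ≤
      ENNReal.ofReal (4 * M) * ∫⁻ y in Ioi (0 : ℝ), ‖u t y - v t y‖ₑ := by
  have e : ∀ y, source u t y - source v t y = (u t y - v t y) * (2 * (u t y + v t y)) :=
    fun y => by simp only [source]; ring
  simp_rw [e]
  refine lintegral_enorm_mul_le fun y => ?_
  rw [abs_mul, abs_two]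
  linarith [abs_add_le (u t y) (v t y), hu.bdd t y, hv.bdd t y]

/-- In the difference of the products, the difference of the primitives is taken in sup norm and the
other factor in L¹. Hence the L¹ distance alone appears on the right, which is what makes uniqueness
closable in L¹. -/
lemma lintegral_flux_sub_le (hu : BddField M u) (hv : BddField M v) (t : ℝ) :
    ∫⁻ y in Ioi (0 : ℝ), ‖flux u t y - flux v t y‖ₑ ≤
      ENNReal.ofReal (2 * M) * ∫⁻ y in Ioi (0 : ℝ), ‖u t y - v t y‖ₑ := by
  have hM := hu.nonneg
  set N := ∫⁻ y in Ioi (0 : ℝ), ‖u t y - v t y‖ₑ with hN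
  have e : ∀ y, flux u t y - flux v t y =
      (u t y - v t y) * prim u t y + v t y * (prim u t y - prim v t y) :=
    fun y => by simp only [flux]; ring
  have h1 : ∫⁻ y in Ioi (0 : ℝ), ‖(u t y - v t y) * prim u t y‖ₑ ≤ ENNReal.ofReal M * N :=
    lintegral_enorm_mul_le (hu.abs_prim_le t)
  have h2 : ∫⁻ y in Ioi (0 : ℝ), ‖v t y * (prim u t y - prim v t y)‖ₑ ≤ ENNReal.ofReal M * N := by
    calc _ ≤ ∫⁻ y in Ioi (0 : ℝ), ‖v t y‖ₑ * N := by
          refine lintegral_mono fun y => ?_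
          rw [enorm_mul]
          gcongr
          exact enorm_prim_sub_le hu.cont hv.cont t y
      _ = (∫⁻ y in Ioi (0 : ℝ), ‖v t y‖ₑ) * N :=
          lintegral_mul_const _ (continuous_slice hv.cont t).measurable.enorm
      _ ≤ _ := by gcongr; exact hv.int t
  have hm : Measurable fun y => ‖(u t y - v t y) * prim u t y‖ₑ :=
    (((continuous_slice hu.cont t).sub (continuous_slice hv.cont t)).mul
      (continuous_slice (continuous_prim hu.cont) t)).measurable.enorm
  calc _ ≤ ∫⁻ y in Ioi (0 : ℝ), (‖(u t y - v t y) * prim u t y‖ₑ +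
        ‖v t y * (prim u t y - prim v t y)‖ₑ) := by
        refine lintegral_mono fun y => ?_
        rw [e]
        exact enorm_add_le _ _
    _ ≤ ENNReal.ofReal M * N + ENNReal.ofReal M * N := by
        rw [lintegral_add_left hm]
        exact add_le_add h1 h2
    _ = _ := by rw [← add_mul, ← ENNReal.ofReal_add hM hM, two_mul]

/-- `u` and `v` are at distance at most `D` in the sup norm and in `L^∞_t L¹_y`. -/
def FieldClose (D : ℝ) (u v : ℝ → ℝ → ℝ) : Prop :=
  (∀ t y, |u t y - v t y| ≤ D) ∧ ∀ t, ∫⁻ y in Ioi (0 : ℝ), ‖u t y - v t y‖ₑ ≤ ENNReal.ofReal D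

lemma abs_source_sub_le (hu : BddField M u) (hv : BddField M v) {D : ℝ} (h : FieldClose D u v)
    (t y : ℝ) : |source u t y - source v t y| ≤ 4 * M * D := by
  have e : source u t y - source v t y = (2 * (u t y + v t y)) * (u t y - v t y) := by
    simp only [source]; ring
  have hM := hu.nonneg
  rw [e, abs_mul]
  refine mul_le_mul ?_ (h.1 t y) (abs_nonneg _) (by positivity)
  rw [abs_mul, abs_two]
  linarith [abs_add_le (u t y) (v t y), hu.bdd t y, hv.bdd t y]

lemma abs_flux_sub_le (hu : BddField M u) (hv : BddField M v) {D : ℝ} (h : FieldClose D u v)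
    (t y : ℝ) : |flux u t y - flux v t y| ≤ 2 * M * D := by
  have e : flux u t y - flux v t y =
      prim u t y * (u t y - v t y) + v t y * (prim u t y - prim v t y) := by
    simp only [flux]; ring
  have hM := hu.nonneg
  have hD : 0 ≤ D := (abs_nonneg _).trans (h.1 0 0)
  have h1 : |prim u t y - prim v t y| ≤ D :=
    abs_le_of_enorm_le hD ((enorm_prim_sub_le hu.cont hv.cont t y).trans (h.2 t))
  rw [e]
  refine (abs_add_le _ _).trans ?_
  rw [abs_mul, abs_mul]
  have h2 := mul_le_mul (hu.abs_prim_le t y) (h.1 t y) (abs_nonneg _) hM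
  have h3 := mul_le_mul (hv.bdd t y) h1 (abs_nonneg _) hM
  linarith

lemma FieldClose.trans {D E : ℝ} {w : ℝ → ℝ → ℝ} (hu : Continuous (Function.uncurry u))
    (hv : Continuous (Function.uncurry v)) (h : FieldClose D u v)
    (h' : FieldClose E v w) : FieldClose (D + E) u w := by
  have hD : 0 ≤ D := (abs_nonneg _).trans (h.1 0 0)
  have hE : 0 ≤ E := (abs_nonneg _).trans (h'.1 0 0)
  refine ⟨fun t y => ?_, fun t => ?_⟩
  · exact (abs_sub_le _ (v t y) _).trans (add_le_add (h.1 t y) (h'.1 t y))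
  · rw [ENNReal.ofReal_add hD hE]
    refine le_trans ?_ (add_le_add (h.2 t) (h'.2 t))
    have hm : Measurable fun y => ‖u t y - v t y‖ₑ :=
      ((continuous_slice hu t).sub (continuous_slice hv t)).measurable.enorm
    rw [← lintegral_add_left hm]
    refine lintegral_mono fun y => ?_
    rw [← sub_add_sub_cancel (u t y) (v t y) (w t y)]
    exact enorm_add_le _ _

/-- The mild formulation: the Duhamel map. -/
noncomputable def mildMap (g : ℝ → ℝ) (T : ℝ) (u : ℝ → ℝ → ℝ) (t y : ℝ) : ℝ :=
  heat 0 g (min t T) y + duhamel 0 0 (source u) (min t T) y + duhamel 1 0 (flux u) (min t T) y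

/-- A constant in the contraction estimate of the Duhamel map on `[0, T]`. -/
noncomputable def mildC (T : ℝ) : ℝ := opC 0 * scaleInt 0 T + opC 1 * scaleInt 1 T

lemma opC_mul_scaleInt_le {m : ℕ} (hm : m ≤ 3) {t T : ℝ} (h : t ≤ T) :
    opC m * scaleInt m t ≤ opC m * scaleInt m T :=
  mul_le_mul_of_nonneg_left (scaleInt_mono hm h) (opC_nonneg m)

lemma lintegral_add_add_le {f g h : ℝ → ℝ} (hf : Continuous f) (hg : Continuous g)
    {a b c : ℝ} (ha : 0 ≤ a) (hb : 0 ≤ b) (hc : 0 ≤ c)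
    (h1 : ∫⁻ y in Ioi (0 : ℝ), ‖f y‖ₑ ≤ ENNReal.ofReal a)
    (h2 : ∫⁻ y in Ioi (0 : ℝ), ‖g y‖ₑ ≤ ENNReal.ofReal b)
    (h3 : ∫⁻ y in Ioi (0 : ℝ), ‖h y‖ₑ ≤ ENNReal.ofReal c) :
    ∫⁻ y in Ioi (0 : ℝ), ‖f y + g y + h y‖ₑ ≤ ENNReal.ofReal (a + b + c) := by
  rw [ENNReal.ofReal_add (by positivity) hc, ENNReal.ofReal_add ha hb]
  refine le_trans ?_ (add_le_add (add_le_add h1 h2) h3)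
  have m1 : Measurable fun y => ‖f y‖ₑ := hf.measurable.enorm
  have m2 : Measurable fun y => ‖g y‖ₑ := hg.measurable.enorm
  have m3 : Measurable fun y => ‖f y‖ₑ + ‖g y‖ₑ := m1.add m2
  rw [← lintegral_add_left m1, ← lintegral_add_left m3]
  exact lintegral_mono fun y => (enorm_add_le _ _).trans (add_le_add (enorm_add_le _ _) le_rfl)

/-- A ball in L^∞ ∩ L^∞_t L¹_y is mapped into itself. Times after T are frozen, so that all bounds
hold on the whole plane with constants taken at T. -/
lemma bddField_mildMap {g : ℝ → ℝ} {B : ℝ} (hg : Continuous g) (hB : ∀ y, |g y| ≤ B)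
    (hm : ∀ y, g (max y 0) = g y) (h0 : g 0 = 0)
    (hgi : ∫⁻ y in Ioi (0 : ℝ), ‖g y‖ₑ ≤ ENNReal.ofReal B) {T : ℝ} (hu : BddField M u)
    (hM : (opC 0 + 1) * B + mildC T * (2 * M ^ 2) ≤ M) : BddField M (mildMap g T u) := by
  have hB0 : 0 ≤ B := (abs_nonneg _).trans (hB 0)
  have hM0 := hu.nonneg
  have hc1 := continuous_heat 0 hg hB hm (Or.inr (Or.inr h0))
  have hc2 := continuous_duhamel (m := 0) (by norm_num) 0 (continuous_source hu.cont)
    hu.abs_source_le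
  have hc3 := continuous_duhamel (m := 1) (by norm_num) 0 (continuous_flux hu.cont)
    hu.abs_flux_le
  have hmin : Continuous fun p : ℝ × ℝ => (min p.1 T, p.2) := by fun_prop
  have o0 := opC_nonneg 0
  have o1 := opC_nonneg 1
  have hsum : ∀ t ≤ T, (opC 0 + 1) * B + opC 0 * scaleInt 0 t * (2 * M ^ 2) +
      opC 1 * scaleInt 1 t * M ^ 2 ≤ M := by
    intro t ht
    have s0 := mul_le_mul_of_nonneg_right (opC_mul_scaleInt_le (m := 0) (by norm_num) ht)
      (show 0 ≤ 2 * M ^ 2 by positivity)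
    have s1 := mul_le_mul_of_nonneg_right (opC_mul_scaleInt_le (m := 1) (by norm_num) ht)
      (show 0 ≤ M ^ 2 by positivity)
    have s2 : 0 ≤ opC 1 * scaleInt 1 T * M ^ 2 := by
      have := scaleInt_nonneg 1 T
      positivity
    unfold mildC at hM
    nlinarith
  refine ⟨((hc1.comp hmin).add (hc2.comp hmin)).add (hc3.comp hmin), fun t y => ?_, fun t => ?_⟩
  · have a1 := abs_heat_le 0 hB (min t T) y
    have a2 := abs_duhamel_le (m := 0) (by norm_num) 0 (t := min t T)
      (fun s _ => hu.abs_source_le s) y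
    have a3 := abs_duhamel_le (m := 1) (by norm_num) 0 (t := min t T)
      (fun s _ => hu.abs_flux_le s) y
    refine (abs_add_three _ _ _).trans (le_trans ?_ (hsum _ (min_le_right t T)))
    linarith
  · have b1 := lintegral_heat_le 0 hg (min t T)
    have b2 := lintegral_duhamel_le_const (m := 0) (by norm_num) 0 (continuous_source hu.cont)
      hu.abs_source_le (t := min t T) fun s _ => hu.lintegral_source_le s
    have b3 := lintegral_duhamel_le_const (m := 1) (by norm_num) 0 (continuous_flux hu.cont)
      hu.abs_flux_le (t := min t T) fun s _ => hu.lintegral_flux_le s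
    have s0 := scaleInt_nonneg 0 (min t T)
    have s1 := scaleInt_nonneg 1 (min t T)
    refine (lintegral_add_add_le (a := (opC 0 + 1) * B)
      (b := opC 0 * scaleInt 0 (min t T) * (2 * M ^ 2)) (c := opC 1 * scaleInt 1 (min t T) * M ^ 2)
      (continuous_slice hc1 _) (continuous_slice hc2 _) (by positivity) (by positivity)
      (by positivity) (b1.trans ?_) (b2.trans_eq ?_) (b3.trans_eq ?_)).trans
      (ENNReal.ofReal_le_ofReal (hsum _ (min_le_right t T)))
    · rw [ENNReal.ofReal_mul (by positivity)]
      gcongr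
    · rw [← ENNReal.ofReal_mul (by positivity)]
    · rw [← ENNReal.ofReal_mul (by positivity)]

lemma mildMap_sub (g : ℝ → ℝ) (T : ℝ) (hu : BddField M u) (hv : BddField M v) (t y : ℝ) :
    mildMap g T u t y - mildMap g T v t y =
      duhamel 0 0 (fun s y => source u s y - source v s y) (min t T) y +
      duhamel 1 0 (fun s y => flux u s y - flux v s y) (min t T) y := by
  rw [duhamel_sub (by norm_num) 0 (continuous_source hu.cont) hu.abs_source_le
    (continuous_source hv.cont) hv.abs_source_le, duhamel_sub (by norm_num) 0
    (continuous_flux hu.cont) hu.abs_flux_le (continuous_flux hv.cont) hv.abs_flux_le]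
  unfold mildMap
  ring

lemma abs_source_sub_le' (hu : BddField M u) (hv : BddField M v) (t y : ℝ) :
    |source u t y - source v t y| ≤ 2 * M ^ 2 + 2 * M ^ 2 :=
  (abs_sub _ _).trans (add_le_add (hu.abs_source_le t y) (hv.abs_source_le t y))

lemma abs_flux_sub_le' (hu : BddField M u) (hv : BddField M v) (t y : ℝ) :
    |flux u t y - flux v t y| ≤ M ^ 2 + M ^ 2 :=
  (abs_sub _ _).trans (add_le_add (hu.abs_flux_le t y) (hv.abs_flux_le t y))

lemma fieldClose_mildMap {g : ℝ → ℝ} {T : ℝ} (hu : BddField M u) (hv : BddField M v) {D : ℝ}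
    (h : FieldClose D u v) (hM : mildC T * (4 * M) ≤ 1 / 2) :
    FieldClose (D / 2) (mildMap g T u) (mildMap g T v) := by
  have hM0 := hu.nonneg
  have hD : 0 ≤ D := (abs_nonneg _).trans (h.1 0 0)
  have o0 := opC_nonneg 0
  have o1 := opC_nonneg 1
  have hs : Continuous (Function.uncurry fun s y => source u s y - source v s y) :=
    (continuous_source hu.cont).sub (continuous_source hv.cont)
  have hf : Continuous (Function.uncurry fun s y => flux u s y - flux v s y) :=
    (continuous_flux hu.cont).sub (continuous_flux hv.cont)
  have hsum : ∀ t ≤ T, opC 0 * scaleInt 0 t * (4 * M * D) + opC 1 * scaleInt 1 t * (2 * M * D) ≤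
      D / 2 := by
    intro t ht
    have s0 := mul_le_mul_of_nonneg_right (opC_mul_scaleInt_le (m := 0) (by norm_num) ht)
      (show 0 ≤ 4 * M * D by positivity)
    have s1 := mul_le_mul_of_nonneg_right (opC_mul_scaleInt_le (m := 1) (by norm_num) ht)
      (show 0 ≤ 2 * M * D by positivity)
    have s2 : 0 ≤ opC 1 * scaleInt 1 T * (2 * M * D) := by
      have := scaleInt_nonneg 1 T
      positivity
    have s3 := mul_le_mul_of_nonneg_right hM hD
    unfold mildC at s3
    nlinarith
  refine ⟨fun t y => ?_, fun t => ?_⟩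
  · rw [mildMap_sub g T hu hv]
    have a2 := abs_duhamel_le (m := 0) (by norm_num) 0 (t := min t T)
      (fun s _ => abs_source_sub_le hu hv h s) y
    have a3 := abs_duhamel_le (m := 1) (by norm_num) 0 (t := min t T)
      (fun s _ => abs_flux_sub_le hu hv h s) y
    refine (abs_add_le _ _).trans (le_trans ?_ (hsum _ (min_le_right t T)))
    linarith
  · simp_rw [mildMap_sub g T hu hv]
    have b2 := lintegral_duhamel_le_const (m := 0) (by norm_num) 0 hs (abs_source_sub_le' hu hv)
      (t := min t T) (b := ENNReal.ofReal (4 * M * D)) fun s _ => by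
        rw [ENNReal.ofReal_mul (by positivity)]
        exact (lintegral_source_sub_le hu hv s).trans (by gcongr; exact h.2 s)
    have b3 := lintegral_duhamel_le_const (m := 1) (by norm_num) 0 hf (abs_flux_sub_le' hu hv)
      (t := min t T) (b := ENNReal.ofReal (2 * M * D)) fun s _ => by
        rw [ENNReal.ofReal_mul (by positivity)]
        exact (lintegral_flux_sub_le hu hv s).trans (by gcongr; exact h.2 s)
    have s0 := scaleInt_nonneg 0 (min t T)
    have s1 := scaleInt_nonneg 1 (min t T)
    have hc2 := continuous_duhamel (m := 0) (by norm_num) 0 hs (abs_source_sub_le' hu hv)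
    rw [← ENNReal.ofReal_mul (by positivity)] at b2 b3
    have := lintegral_add_add_le (f := fun _ => 0) (a := 0) continuous_const
      (continuous_slice hc2 (min t T)) le_rfl (by positivity) (by positivity) (by simp) b2 b3
    simp only [zero_add] at this
    exact this.trans (ENNReal.ofReal_le_ofReal (hsum _ (min_le_right t T)))

end

lemma tendsto_mildC : Tendsto mildC (𝓝[>] 0) (𝓝 0) := by
  have h0 := (tendsto_scaleInt (m := 0) (by norm_num)).const_mul (opC 0)
  have h1 := (tendsto_scaleInt (m := 1) (by norm_num)).const_mul (opC 1)
  simpa using! h0.add h1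

lemma FieldClose.symm {D : ℝ} {u v : ℝ → ℝ → ℝ} (h : FieldClose D u v) : FieldClose D v u := by
  refine ⟨fun t y => by rw [abs_sub_comm]; exact h.1 t y, fun t => ?_⟩
  simp_rw [← enorm_neg (v t _ - u t _), neg_sub]
  exact h.2 t

/-! ### Picard iteration -/

/-- Completeness of the class of bounded fields with respect to `FieldClose`. -/
lemma exists_limit_field {M D : ℝ} {U : ℕ → ℝ → ℝ → ℝ} (hU : ∀ n, BddField M (U n))
    (hD : ∀ n, FieldClose (D / 2 ^ n) (U n) (U (n + 1))) :
    ∃ u, BddField M u ∧ ∀ n, FieldClose (2 * D / 2 ^ n) (U n) u := by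
  have hD0 : 0 ≤ D := by simpa using (abs_nonneg _).trans ((hD 0).1 0 0)
  have hM : 0 ≤ M := (hU 0).nonneg
  have hstep : ∀ n j, FieldClose (2 * D / 2 ^ n - 2 * D / 2 ^ (n + j)) (U n) (U (n + j)) := by
    intro n j
    induction j with
    | zero => refine ⟨fun t y => by simp, fun t => by simp⟩
    | succ j ih =>
      have := ih.trans (hU n).cont (hU (n + j)).cont (hD (n + j))
      rw [show 2 * D / 2 ^ n - 2 * D / 2 ^ (n + j) + D / 2 ^ (n + j) =
        2 * D / 2 ^ n - 2 * D / 2 ^ (n + (j + 1)) by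
          rw [← add_assoc n j 1, pow_succ (2 : ℝ) (n + j)]; field_simp; ring] at this
      exact this
  have hclose : ∀ n m, n ≤ m → FieldClose (2 * D / 2 ^ n) (U n) (U m) := by
    intro n m hnm
    obtain ⟨j, rfl⟩ := Nat.exists_eq_add_of_le hnm
    have h := hstep n j
    have hle : 2 * D / 2 ^ n - 2 * D / 2 ^ (n + j) ≤ 2 * D / 2 ^ n := by
      have : 0 ≤ 2 * D / 2 ^ (n + j) := by positivity
      linarith
    exact ⟨fun t y => (h.1 t y).trans hle, fun t => (h.2 t).trans (ENNReal.ofReal_le_ofReal hle)⟩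
  have hlim0 : Tendsto (fun n : ℕ => 2 * D / 2 ^ n) atTop (𝓝 0) := by
    have := (tendsto_pow_atTop_nhds_zero_of_lt_one (r := (1 / 2 : ℝ)) (by norm_num)
      (by norm_num)).const_mul (2 * D)
    rw [mul_zero] at this
    refine this.congr fun n => ?_
    rw [one_div, inv_pow, ← div_eq_mul_inv]
  have hcau : ∀ t y, ∃ l, Tendsto (fun n => U n t y) atTop (𝓝 l) := by
    intro t y
    refine cauchySeq_tendsto_of_complete (cauchySeq_of_le_tendsto_0' (fun n => 2 * D / 2 ^ n)
      (fun n m hnm => ?_) hlim0)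
    rw [Real.dist_eq]
    exact (hclose n m hnm).1 t y
  choose u hu using hcau
  have hsup : ∀ n t y, |U n t y - u t y| ≤ 2 * D / 2 ^ n := by
    intro n t y
    refine le_of_tendsto ((tendsto_const_nhds.sub (hu t y)).abs) ?_
    filter_upwards [eventually_ge_atTop n] with m hm
    exact (hclose n m hm).1 t y
  have hcont : Continuous (Function.uncurry u) := by
    refine TendstoUniformly.continuous (F := fun n => Function.uncurry (U n)) (p := atTop) ?_
      (Eventually.of_forall fun n => (hU n).cont).frequently
    rw [Metric.tendstoUniformly_iff]
    intro ε hε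
    filter_upwards [hlim0.eventually (gt_mem_nhds hε)] with n hn p
    rw [dist_comm, Real.dist_eq]
    exact (hsup n p.1 p.2).trans_lt hn
  have hmeas : ∀ n t, Measurable fun y => ‖U n t y‖ₑ :=
    fun n t => (continuous_slice (hU n).cont t).measurable.enorm
  -- The L¹ bounds pass to the uniform limit by Fatou's lemma, so the completeness of L¹ is not
  -- invoked.
  have hfatou : ∀ t (F : ℕ → ℝ → ℝ≥0∞) (f : ℝ → ℝ≥0∞) (c : ℝ≥0∞), (∀ n, Measurable (F n)) →
      (∀ y, Tendsto (fun n => F n y) atTop (𝓝 (f y))) →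
      (∀ᶠ n in atTop, ∫⁻ y in Ioi (t : ℝ), F n y ≤ c) → ∫⁻ y in Ioi t, f y ≤ c := by
    intro t F f c hF hf hc
    have h1 : ∫⁻ y in Ioi t, f y = ∫⁻ y in Ioi t, liminf (fun n => F n y) atTop :=
      lintegral_congr fun y => (hf y).liminf_eq.symm
    rw [h1]
    refine (lintegral_liminf_le hF).trans ?_
    exact liminf_le_of_frequently_le' hc.frequently
  refine ⟨u, ⟨hcont, fun t y => ?_, fun t => ?_⟩, fun n => ⟨hsup n, fun t => ?_⟩⟩
  · exact le_of_tendsto (hu t y).abs (Eventually.of_forall fun n => (hU n).bdd t y)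
  · exact hfatou 0 (fun n y => ‖U n t y‖ₑ) _ _ (fun n => hmeas n t)
      (fun y => (hu t y).enorm) (Eventually.of_forall fun n => (hU n).int t)
  · refine hfatou 0 (fun m y => ‖U n t y - U m t y‖ₑ) _ _ (fun m => ?_)
      (fun y => (tendsto_const_nhds.sub (hu t y)).enorm) ?_
    · exact ((continuous_slice (hU n).cont t).sub (continuous_slice (hU m).cont t)).measurable.enorm
    · filter_upwards [eventually_ge_atTop n] with m hm
      exact (hclose n m hm).2 t

/-- Local existence of mild solutions. -/
lemma exists_mild_solution {g : ℝ → ℝ} {B : ℝ} (hg : Continuous g) (hB : ∀ y, |g y| ≤ B)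
    (hm : ∀ y, g (max y 0) = g y) (h0 : g 0 = 0)
    (hgi : ∫⁻ y in Ioi (0 : ℝ), ‖g y‖ₑ ≤ ENNReal.ofReal B) :
    ∃ T : ℝ, 0 < T ∧ ∃ (M : ℝ) (u : ℝ → ℝ → ℝ), BddField M u ∧ ∀ t y, u t y = mildMap g T u t y := by
  have hB0 : 0 ≤ B := (abs_nonneg _).trans (hB 0)
  -- The bound of the free evolution plus one; the unit leaves room for the Duhamel terms.
  set M := (opC 0 + 1) * B + 1 with hMd
  have hM : 0 < M := by have := opC_nonneg 0; positivity
  -- The single smallness condition on T, with the factor 8(M + M²), implies both the invariance of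
  -- the ball and the contraction factor 1/2.
  obtain ⟨T, hT, hT0⟩ := ((tendsto_mildC.eventually (gt_mem_nhds
    (show 0 < (8 * (M + M ^ 2))⁻¹ by positivity))).and eventually_mem_nhdsWithin).exists
  have hT0 : 0 < T := hT0
  have hC0 : 0 ≤ mildC T := add_nonneg (mul_nonneg (opC_nonneg 0) (scaleInt_nonneg 0 T))
    (mul_nonneg (opC_nonneg 1) (scaleInt_nonneg 1 T))
  have hT1 : mildC T * (8 * (M + M ^ 2)) ≤ 1 := by
    have := mul_le_mul_of_nonneg_right hT.le (show 0 ≤ 8 * (M + M ^ 2) by positivity)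
    rwa [inv_mul_cancel₀ (by positivity)] at this
  have hc1 : (opC 0 + 1) * B + mildC T * (2 * M ^ 2) ≤ M := by nlinarith
  have hc2 : mildC T * (4 * M) ≤ 1 / 2 := by nlinarith [mul_nonneg hC0 (sq_nonneg M)]
  set U : ℕ → ℝ → ℝ → ℝ := fun n => (mildMap g T)^[n] (fun _ _ => 0) with hU
  have hUs : ∀ n, U (n + 1) = mildMap g T (U n) := fun n => Function.iterate_succ_apply' _ _ _
  have hUb : ∀ n, BddField M (U n) := by
    intro n
    induction n with
    | zero => exact ⟨continuous_const, fun t y => by simp [hU, hM.le], fun t => by simp [hU]⟩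
    | succ n ih => rw [hUs]; exact bddField_mildMap hg hB hm h0 hgi ih hc1
  have hUc : ∀ n, FieldClose (M / 2 ^ n) (U n) (U (n + 1)) := by
    intro n
    induction n with
    | zero =>
      have h := hUb 1
      refine FieldClose.symm ⟨fun t y => ?_, fun t => ?_⟩
      · simpa [hU] using h.bdd t y
      · simpa [hU] using h.int t
    | succ n ih =>
      have h := fieldClose_mildMap (g := g) (hUb n) (hUb (n + 1)) ih hc2
      rw [← hUs, ← hUs] at h
      rwa [pow_succ, ← div_div]
  obtain ⟨u, hu, hlim⟩ := exists_limit_field hUb hUc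
  refine ⟨T, hT0, M, u, hu, fun t y => ?_⟩
  have hlim0 : Tendsto (fun n : ℕ => 2 * M / 2 ^ n) atTop (𝓝 0) := by
    have := (tendsto_pow_atTop_nhds_zero_of_lt_one (r := (1 / 2 : ℝ)) (by norm_num)
      (by norm_num)).const_mul (2 * M)
    rw [mul_zero] at this
    refine this.congr fun n => ?_
    rw [one_div, inv_pow, ← div_eq_mul_inv]
  have h1 : Tendsto (fun n => U (n + 1) t y) atTop (𝓝 (u t y)) := by
    rw [tendsto_iff_dist_tendsto_zero]
    refine squeeze_zero (fun _ => dist_nonneg) (fun n => ?_) (hlim0.comp (tendsto_add_atTop_nat 1))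
    exact (hlim (n + 1)).1 t y
  have h2 : Tendsto (fun n => U (n + 1) t y) atTop (𝓝 (mildMap g T u t y)) := by
    rw [tendsto_iff_dist_tendsto_zero]
    refine squeeze_zero (fun _ => dist_nonneg) (fun n => ?_)
      (by simpa using hlim0.div_const 2 : Tendsto (fun n : ℕ => 2 * M / 2 ^ n / 2) atTop (𝓝 0))
    have h := (fieldClose_mildMap (g := g) (hUb n) hu (hlim n) hc2).1 t y
    rwa [← hUs] at h
  exact tendsto_nhds_unique h1 h2

/-! ### Uniqueness in L¹ with an exponential weight in time -/

lemma lintegral_eq_zero_imp {f : ℝ → ℝ} (hf : Continuous f)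
    (h : ∫⁻ y in Ioi (0 : ℝ), ‖f y‖ₑ = 0) {y : ℝ} (hy : 0 ≤ y) : f y = 0 := by
  rw [lintegral_eq_zero_iff hf.measurable.enorm] at h
  have h1 : f =ᵐ[volume.restrict (Ioi 0)] fun _ => 0 := by
    filter_upwards [h] with y hy
    simpa using hy
  have h2 := Measure.eqOn_open_of_ae_eq h1 isOpen_Ioi hf.continuousOn continuousOn_const
  have h3 := h2.closure hf continuous_const
  rw [closure_Ioi] at h3
  exact h3 hy

/-- Replaces a singular Gronwall inequality: under a strong enough exponential weight the integral
operator with kernel a + b r^{-1/4} is small, whatever the length of the time interval. -/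
lemma tendsto_weighted_integral (a b T : ℝ) :
    Tendsto (fun l : ℝ => ∫ r in Ioc 0 T, (a + b * (scale r ^ 1)⁻¹) * Real.exp (-(l * r)))
      atTop (𝓝 0) := by
  have hi : IntegrableOn (fun r => a + b * (scale r ^ 1)⁻¹) (Ioc 0 T) :=
    (integrableOn_const (by simp)).add
      ((integrableOn_inv_scale_pow (m := 1) (by norm_num) T).const_mul b)
  have h := tendsto_integral_filter_of_dominated_convergence (μ := volume.restrict (Ioc 0 T))
    (l := atTop) (F := fun l r => (a + b * (scale r ^ 1)⁻¹) * Real.exp (-(l * r)))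
    (f := fun _ => 0) (fun r => |a + b * (scale r ^ 1)⁻¹|)
    (Eventually.of_forall fun l => hi.aestronglyMeasurable.mul
      (Continuous.aestronglyMeasurable (by fun_prop)))
    (by
      filter_upwards [eventually_ge_atTop 0] with l hl
      filter_upwards [ae_restrict_mem measurableSet_Ioc] with r hr
      rw [norm_mul, Real.norm_eq_abs, Real.norm_eq_abs, Real.abs_exp]
      refine mul_le_of_le_one_right (abs_nonneg _) (Real.exp_le_one_iff.2 ?_)
      have := mul_nonneg hl hr.1.le
      linarith) hi.abs (by
      filter_upwards [ae_restrict_mem measurableSet_Ioc] with r hr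
      have h1 : Tendsto (fun l : ℝ => Real.exp (-(l * r))) atTop (𝓝 0) :=
        Real.tendsto_exp_atBot.comp (tendsto_neg_atTop_atBot.comp
          (tendsto_id.atTop_mul_const hr.1))
      simpa only [mul_zero] using h1.const_mul (a + b * (scale r ^ 1)⁻¹))
  simpa using h

/-- Uniqueness of bounded mild solutions. -/
lemma mild_unique {g : ℝ → ℝ} {T M : ℝ} {u v : ℝ → ℝ → ℝ} (hu : BddField M u) (hv : BddField M v)
    (hum : ∀ t ∈ Icc 0 T, ∀ y, 0 < y → u t y = mildMap g T u t y)
    (hvm : ∀ t ∈ Icc 0 T, ∀ y, 0 < y → v t y = mildMap g T v t y) :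
    ∀ t ∈ Icc 0 T, ∀ y, 0 ≤ y → u t y = v t y := by
  have hM := hu.nonneg
  set a := opC 0 * (4 * M) with ha
  set b := opC 1 * (2 * M) with hb
  have ha0 : 0 ≤ a := mul_nonneg (opC_nonneg 0) (by positivity)
  have hb0 : 0 ≤ b := mul_nonneg (opC_nonneg 1) (by positivity)
  -- The rate l is chosen so that one application of the Duhamel estimate halves the L¹ distance
  -- measured against e^{lt}; no smallness of T is required.
  obtain ⟨l, hl, hl0⟩ := (((tendsto_weighted_integral a b T).eventually
    (gt_mem_nhds (show (0 : ℝ) < 1 / 2 by norm_num))).and (eventually_ge_atTop 0)).exists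
  set N : ℝ → ℝ≥0∞ := fun t => ∫⁻ y in Ioi (0 : ℝ), ‖u t y - v t y‖ₑ with hN
  have hs : Continuous (Function.uncurry fun s y => source u s y - source v s y) :=
    (continuous_source hu.cont).sub (continuous_source hv.cont)
  have hf : Continuous (Function.uncurry fun s y => flux u s y - flux v s y) :=
    (continuous_flux hu.cont).sub (continuous_flux hv.cont)
  have step : ∀ D : ℝ, 0 ≤ D → (∀ t ∈ Icc 0 T, N t ≤ ENNReal.ofReal (D * Real.exp (l * t))) →
      ∀ t ∈ Icc 0 T, N t ≤ ENNReal.ofReal (D / 2 * Real.exp (l * t)) := by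
    intro D hD hDN t ht
    have hIco : ∀ s ∈ Ico 0 t, s ∈ Icc 0 T := fun s hs => ⟨hs.1, hs.2.le.trans ht.2⟩
    have b2 := lintegral_duhamel_le 0 0 hs (abs_source_sub_le' hu hv)
      (t := t) (β := fun s => ENNReal.ofReal (4 * M * (D * Real.exp (l * s)))) fun s hs => by
        rw [ENNReal.ofReal_mul (by positivity)]
        exact (lintegral_source_sub_le hu hv s).trans (by gcongr; exact hDN s (hIco s hs))
    have b3 := lintegral_duhamel_le 1 0 hf (abs_flux_sub_le' hu hv)
      (t := t) (β := fun s => ENNReal.ofReal (2 * M * (D * Real.exp (l * s)))) fun s hs => by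
        rw [ENNReal.ofReal_mul (by positivity)]
        exact (lintegral_flux_sub_le hu hv s).trans (by gcongr; exact hDN s (hIco s hs))
    have hc2 := continuous_duhamel (m := 0) (by norm_num) 0 hs (abs_source_sub_le' hu hv)
    have hsum : N t ≤ (∫⁻ y in Ioi (0 : ℝ),
        ‖duhamel 0 0 (fun s y => source u s y - source v s y) t y‖ₑ) +
        ∫⁻ y in Ioi (0 : ℝ), ‖duhamel 1 0 (fun s y => flux u s y - flux v s y) t y‖ₑ := by
      have hm : Measurable fun y =>
          ‖duhamel 0 0 (fun s y => source u s y - source v s y) t y‖ₑ :=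
        (continuous_slice hc2 t).measurable.enorm
      rw [← lintegral_add_left hm]
      refine setLIntegral_mono_ae' measurableSet_Ioi (Eventually.of_forall fun y hy => ?_)
      rw [hum t ht y hy, hvm t ht y hy, mildMap_sub g T hu hv, min_eq_left ht.2]
      exact enorm_add_le _ _
    refine hsum.trans ((add_le_add b2 b3).trans ?_)
    have hexp : ∀ r, Real.exp (l * (t - r)) = Real.exp (l * t) * Real.exp (-(l * r)) := by
      intro r
      rw [← Real.exp_add]
      ring_nf
    have m1 : AEMeasurable (fun r => ENNReal.ofReal (opC 0 * (scale r ^ 0)⁻¹) *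
        ENNReal.ofReal (4 * M * (D * Real.exp (l * (t - r))))) (volume.restrict (Ioc 0 t)) := by
      refine AEMeasurable.mul (f := fun r => ENNReal.ofReal (opC 0 * (scale r ^ 0)⁻¹)) ?_ ?_
      · simp
      · exact (Continuous.measurable (by fun_prop)).ennreal_ofReal.aemeasurable
    rw [← lintegral_add_left' m1]
    have hi : IntegrableOn (fun r => (a + b * (scale r ^ 1)⁻¹) * Real.exp (-(l * r))) (Ioc 0 T) := by
      refine Integrable.mul_bdd (c := 1) ((integrableOn_const (by simp)).add
        ((integrableOn_inv_scale_pow (m := 1) (by norm_num) T).const_mul b))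
        (Continuous.aestronglyMeasurable (by fun_prop)) ?_
      filter_upwards [ae_restrict_mem measurableSet_Ioc] with r hr
      rw [Real.norm_eq_abs, Real.abs_exp, Real.exp_le_one_iff]
      have := mul_nonneg hl0 hr.1.le
      linarith
    calc _ = ∫⁻ r in Ioc 0 t, ENNReal.ofReal (D * Real.exp (l * t)) *
          ENNReal.ofReal ((a + b * (scale r ^ 1)⁻¹) * Real.exp (-(l * r))) := by
          refine setLIntegral_congr_fun measurableSet_Ioc fun r hr => ?_
          have := inv_scale_pow_nonneg hr.1 1
          have o0 := opC_nonneg 0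
          have o1 := opC_nonneg 1
          rw [← ENNReal.ofReal_mul (by simpa using o0), ← ENNReal.ofReal_mul (by positivity),
            ← ENNReal.ofReal_add (by positivity) (by positivity),
            ← ENNReal.ofReal_mul (by positivity), hexp, pow_zero, ha, hb]
          ring_nf
      _ ≤ ∫⁻ r in Ioc 0 T, ENNReal.ofReal (D * Real.exp (l * t)) *
          ENNReal.ofReal ((a + b * (scale r ^ 1)⁻¹) * Real.exp (-(l * r))) :=
          lintegral_mono_set (Ioc_subset_Ioc_right ht.2)
      _ = ENNReal.ofReal (D * Real.exp (l * t)) * ENNReal.ofReal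
          (∫ r in Ioc 0 T, (a + b * (scale r ^ 1)⁻¹) * Real.exp (-(l * r))) := by
          rw [lintegral_const_mul' _ _ ENNReal.ofReal_ne_top,
            ofReal_integral_eq_lintegral_ofReal hi]
          filter_upwards [ae_restrict_mem measurableSet_Ioc] with r hr
          have := inv_scale_pow_nonneg hr.1 1
          positivity
      _ ≤ ENNReal.ofReal (D * Real.exp (l * t)) * ENNReal.ofReal (1 / 2) := by gcongr
      _ = _ := by
          rw [← ENNReal.ofReal_mul (by positivity)]
          ring_nf
  have hbase : ∀ t ∈ Icc 0 T, N t ≤ ENNReal.ofReal (2 * M * Real.exp (l * t)) := by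
    intro t ht
    have h1 : N t ≤ (∫⁻ y in Ioi (0 : ℝ), ‖u t y‖ₑ) + ∫⁻ y in Ioi (0 : ℝ), ‖v t y‖ₑ := by
      have hm : Measurable fun y => ‖u t y‖ₑ := (continuous_slice hu.cont t).measurable.enorm
      rw [← lintegral_add_left hm]
      exact lintegral_mono fun y => enorm_sub_le
    refine h1.trans ((add_le_add (hu.int t) (hv.int t)).trans ?_)
    rw [← ENNReal.ofReal_add hM hM, ← two_mul]
    refine ENNReal.ofReal_le_ofReal (le_mul_of_one_le_right (by positivity) (Real.one_le_exp ?_))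
    exact mul_nonneg hl0 ht.1
  have hall : ∀ n : ℕ, ∀ t ∈ Icc 0 T, N t ≤ ENNReal.ofReal (2 * M / 2 ^ n * Real.exp (l * t)) := by
    intro n
    induction n with
    | zero => simpa using hbase
    | succ n ih =>
      have := step _ (by positivity) ih
      rwa [pow_succ, ← div_div]
  intro t ht y hy
  have hN0 : N t = 0 := by
    have h1 : Tendsto (fun n : ℕ => ENNReal.ofReal (2 * M / 2 ^ n * Real.exp (l * t))) atTop
        (𝓝 0) := by
      have h2 := ((tendsto_pow_atTop_nhds_zero_of_lt_one (r := (1 / 2 : ℝ)) (by norm_num)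
        (by norm_num)).const_mul (2 * M)).mul_const (Real.exp (l * t))
      rw [mul_zero, zero_mul] at h2
      have h3 := (ENNReal.continuous_ofReal.tendsto 0).comp h2
      rw [ENNReal.ofReal_zero] at h3
      refine h3.congr fun n => ?_
      simp only [Function.comp]
      rw [one_div, inv_pow, ← div_eq_mul_inv]
    exact le_antisymm (ge_of_tendsto' h1 fun n => hall n t ht) zero_le
  have hcd : Continuous fun y => u t y - v t y :=
    (continuous_slice hu.cont t).sub (continuous_slice hv.cont t)
  exact sub_eq_zero.1 (lintegral_eq_zero_imp hcd hN0 hy)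

/-! ### Derivatives on the half-line -/

/-- At the endpoint, a continuous function whose derivative has a limit there is one-sidedly
differentiable with that limit as derivative. This lets all derivatives be computed for y > 0 only.
-/
lemma hasDerivWithinAt_Ici_of_hasDerivAt_Ioi {f f' : ℝ → ℝ} (hf : Continuous f)
    (hf' : Continuous f') (hd : ∀ y, 0 < y → HasDerivAt f (f' y) y) {y : ℝ} (hy : 0 ≤ y) :
    HasDerivWithinAt f (f' y) (Ici 0) y := by
  rcases hy.eq_or_lt with rfl | hy
  · refine hasDerivWithinAt_Ici_of_tendsto_deriv (s := Ioi 0)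
      (fun z hz => (hd z hz).differentiableAt.differentiableWithinAt)
      hf.continuousAt.continuousWithinAt self_mem_nhdsWithin ?_
    refine (hf'.continuousAt.tendsto.mono_left nhdsWithin_le_nhds).congr' ?_
    filter_upwards [self_mem_nhdsWithin] with z hz
    exact (hd z hz).deriv.symm
  · exact (hd y hy).hasDerivWithinAt

section

variable {n : ℕ} {v : ℕ → ℝ → ℝ}

lemma dy_eq_of_hasDerivAt (hc : ∀ k ≤ n, Continuous (v k))
    (hd : ∀ k < n, ∀ y, 0 < y → HasDerivAt (v k) (v (k + 1) y) y) {k : ℕ} (hk : k ≤ n) :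
    ∀ y, 0 ≤ y → dy k (v 0) y = v k y := by
  induction k with
  | zero => intro y _; simp [dy]
  | succ k ih =>
    intro y hy
    have h1 := hasDerivWithinAt_Ici_of_hasDerivAt_Ioi (hc k (by omega)) (hc (k + 1) hk)
      (hd k hk) hy
    have ih := ih (by omega)
    have e : EqOn (iteratedDerivWithin k (v 0) (Ici 0)) (v k) (Ici 0) := ih
    rw [dy, iteratedDerivWithin_succ, derivWithin_congr e (ih y hy)]
    exact h1.derivWithin (uniqueDiffOn_Ici 0 y hy)

lemma contDiffOn_of_hasDerivAt (hc : ∀ k ≤ n, Continuous (v k))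
    (hd : ∀ k < n, ∀ y, 0 < y → HasDerivAt (v k) (v (k + 1) y) y) :
    ContDiffOn ℝ n (v 0) (Ici 0) := by
  refine contDiffOn_of_continuousOn_differentiableOn_deriv (fun k hk => ?_) (fun k hk => ?_)
  · exact (hc k (by exact_mod_cast hk)).continuousOn.congr
      (dy_eq_of_hasDerivAt hc hd (by exact_mod_cast hk))
  · have hk : k < n := by exact_mod_cast hk
    intro y hy
    refine DifferentiableWithinAt.congr (hasDerivWithinAt_Ici_of_hasDerivAt_Ioi (hc k hk.le)
      (hc (k + 1) hk) (hd k hk) hy).differentiableWithinAt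
      (dy_eq_of_hasDerivAt hc hd hk.le) (dy_eq_of_hasDerivAt hc hd hk.le y hy)

end

lemma dy_zero (f : ℝ → ℝ) : dy 0 f = f := iteratedDerivWithin_zero

lemma continuous_dy_max {n k : ℕ} {f : ℝ → ℝ} (h : ContDiffOn ℝ n f (Ici 0))
    (hk : k ≤ n) : Continuous fun y => dy k f (max y 0) :=
  (h.continuousOn_iteratedDerivWithin (by exact_mod_cast hk) (uniqueDiffOn_Ici 0)).comp_continuous
    (by fun_prop) fun y => le_max_right y 0

lemma hasDerivAt_dy {n k : ℕ} {f : ℝ → ℝ} (h : ContDiffOn ℝ n f (Ici 0))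
    (hk : k < n) {y : ℝ} (hy : 0 < y) :
    HasDerivAt (fun y => dy k f (max y 0)) (dy (k + 1) f (max y 0)) y := by
  have h1 := (h.differentiableOn_iteratedDerivWithin (m := k) (by exact_mod_cast hk)
    (uniqueDiffOn_Ici 0) y hy.le).hasDerivWithinAt.hasDerivAt (Ici_mem_nhds hy)
  rw [max_eq_left hy.le, show dy (k + 1) f y = _ from congrFun iteratedDerivWithin_succ y]
  refine h1.congr_of_eventuallyEq ?_
  filter_upwards [lt_mem_nhds hy] with z hz
  rw [max_eq_left hz.le, dy]

/-! ### Interpolation inequalities on the half-line -/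

/-- The difference quotient over [y, y + h] equals f' at an intermediate point, and the integral of
f'' carries it back to y. Steps go only to the right, so the half-line is never left. Both the
sup-norm and the L¹ inequality follow from this pointwise form. -/
lemma enorm_deriv_le {f f' f'' : ℝ → ℝ} (hf'' : Continuous f'')
    (hd : ∀ y, 0 < y → HasDerivAt f (f' y) y) (hd' : ∀ y, 0 < y → HasDerivAt f' (f'' y) y)
    {h y : ℝ} (hh : 0 < h) (hy : 0 < y) :
    ‖f' y‖ₑ ≤ ENNReal.ofReal h⁻¹ * (‖f (y + h)‖ₑ + ‖f y‖ₑ) +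
      ∫⁻ r in Ioc 0 h, ‖f'' (y + r)‖ₑ := by
  obtain ⟨ξ, hξ, he⟩ := exists_hasDerivAt_eq_slope f f' (show y < y + h by linarith)
    (fun z hz => (hd z (hy.trans_le hz.1)).continuousAt.continuousWithinAt)
    fun z hz => hd z (hy.trans hz.1)
  have h1 : ∫ z in y..ξ, f'' z = f' ξ - f' y :=
    intervalIntegral.integral_eq_sub_of_hasDerivAt (fun z hz => by
      rw [uIcc_of_le hξ.1.le] at hz
      exact hd' z (hy.trans_le hz.1)) (hf''.intervalIntegrable _ _)
  have h2 : f' y = (f (y + h) - f y) * h⁻¹ - ∫ z in y..ξ, f'' z := by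
    rw [h1, he, add_sub_cancel_left, ← div_eq_mul_inv]; ring
  have h3 : ‖∫ z in y..ξ, f'' z‖ₑ ≤ ∫⁻ r in Ioc 0 h, ‖f'' (y + r)‖ₑ := by
    have e : ∫ z in y..ξ, f'' z = ∫ r in (0 : ℝ)..ξ - y, f'' (y + r) := by
      rw [intervalIntegral.integral_comp_add_left (fun z => f'' z) y]
      simp
    rw [e, intervalIntegral.integral_of_le (by linarith [hξ.1])]
    exact (enorm_integral_le_lintegral_enorm _).trans
      (lintegral_mono_set (Ioc_subset_Ioc_right (by linarith [hξ.2])))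
  rw [h2]
  refine enorm_sub_le.trans (add_le_add ?_ h3)
  rw [enorm_mul, mul_comm, Real.enorm_of_nonneg (inv_nonneg.2 hh.le)]
  exact mul_le_mul' le_rfl enorm_sub_le

/-- Interpolation in the sup norm. -/
lemma abs_deriv_le {f f' f'' : ℝ → ℝ} (hf'' : Continuous f'')
    (hd : ∀ y, 0 < y → HasDerivAt f (f' y) y) (hd' : ∀ y, 0 < y → HasDerivAt f' (f'' y) y)
    {h S L : ℝ} (hh : 0 < h) (hS : ∀ y, 0 < y → |f y| ≤ S) (hL : ∀ y, 0 < y → |f'' y| ≤ L)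
    {y : ℝ} (hy : 0 < y) : |f' y| ≤ 2 * S / h + L * h := by
  have hS0 : 0 ≤ S := (abs_nonneg _).trans (hS y hy)
  have hL0 : 0 ≤ L := (abs_nonneg _).trans (hL y hy)
  refine abs_le_of_enorm_le (by positivity) ((enorm_deriv_le hf'' hd hd' hh hy).trans ?_)
  have h1 : ∫⁻ r in Ioc 0 h, ‖f'' (y + r)‖ₑ ≤ ∫⁻ r in Ioc 0 h, ENNReal.ofReal L :=
    setLIntegral_mono_ae' measurableSet_Ioc (Eventually.of_forall fun r hr =>
      enorm_le_ofReal (hL _ (by linarith [hr.1])))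
  rw [setLIntegral_const, Real.volume_Ioc, sub_zero, ← ENNReal.ofReal_mul hL0] at h1
  rw [ENNReal.ofReal_add (by positivity) (by positivity)]
  refine add_le_add ?_ h1
  have h2 := add_le_add (enorm_le_ofReal (hS (y + h) (by linarith))) (enorm_le_ofReal (hS y hy))
  rw [← ENNReal.ofReal_add hS0 hS0] at h2
  refine (mul_le_mul' le_rfl h2).trans_eq ?_
  rw [← ENNReal.ofReal_mul (by positivity)]
  congr 1
  field_simp
  ring

lemma setLIntegral_comp_add_le (f : ℝ → ℝ≥0∞) {h : ℝ} (hh : 0 ≤ h) :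
    ∫⁻ y in Ioi (0 : ℝ), f (y + h) ≤ ∫⁻ y in Ioi (0 : ℝ), f y := by
  rw [← lintegral_indicator measurableSet_Ioi, ← lintegral_indicator measurableSet_Ioi,
    ← lintegral_add_right_eq_self ((Ioi 0).indicator f) h]
  refine lintegral_mono fun y => ?_
  by_cases hy : 0 < y
  · rw [indicator_of_mem (show y ∈ Ioi 0 from hy),
      indicator_of_mem (show y + h ∈ Ioi 0 from by simp only [mem_Ioi]; linarith)]
  · rw [indicator_of_notMem (show y ∉ Ioi 0 from hy)]
    exact zero_le

/-- Interpolation in `L¹`. -/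
lemma lintegral_deriv_le {f f' f'' : ℝ → ℝ} (hf : Continuous f) (hf'' : Continuous f'')
    (hd : ∀ y, 0 < y → HasDerivAt f (f' y) y) (hd' : ∀ y, 0 < y → HasDerivAt f' (f'' y) y)
    {h : ℝ} (hh : 0 < h) :
    ∫⁻ y in Ioi (0 : ℝ), ‖f' y‖ₑ ≤ ENNReal.ofReal (2 / h) * (∫⁻ y in Ioi (0 : ℝ), ‖f y‖ₑ) +
      ENNReal.ofReal h * ∫⁻ y in Ioi (0 : ℝ), ‖f'' y‖ₑ := by
  have m1 : Measurable fun y => ‖f (y + h)‖ₑ :=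
    (hf.comp (by fun_prop : Continuous fun y => y + h)).measurable.enorm
  have m3 : Measurable fun y => ENNReal.ofReal h⁻¹ * (‖f (y + h)‖ₑ + ‖f y‖ₑ) :=
    (m1.add hf.measurable.enorm).const_mul _
  have m2 : Measurable fun p : ℝ × ℝ => ‖f'' (p.1 + p.2)‖ₑ :=
    (hf''.comp (by fun_prop : Continuous fun p : ℝ × ℝ => p.1 + p.2)).measurable.enorm
  calc _ ≤ ∫⁻ y in Ioi (0 : ℝ), (ENNReal.ofReal h⁻¹ * (‖f (y + h)‖ₑ + ‖f y‖ₑ) +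
        ∫⁻ r in Ioc 0 h, ‖f'' (y + r)‖ₑ) :=
        setLIntegral_mono_ae' measurableSet_Ioi (Eventually.of_forall fun y hy =>
          enorm_deriv_le hf'' hd hd' hh hy)
    _ = ENNReal.ofReal h⁻¹ * ((∫⁻ y in Ioi (0 : ℝ), ‖f (y + h)‖ₑ) + ∫⁻ y in Ioi (0 : ℝ), ‖f y‖ₑ) +
        ∫⁻ r in Ioc 0 h, ∫⁻ y in Ioi (0 : ℝ), ‖f'' (y + r)‖ₑ := by
        rw [lintegral_add_left m3,
          lintegral_const_mul' _ _ ENNReal.ofReal_ne_top, lintegral_add_left m1,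
          lintegral_lintegral_swap m2.aemeasurable]
    _ ≤ ENNReal.ofReal h⁻¹ * ((∫⁻ y in Ioi (0 : ℝ), ‖f y‖ₑ) + ∫⁻ y in Ioi (0 : ℝ), ‖f y‖ₑ) +
        ∫⁻ r in Ioc 0 h, ∫⁻ y in Ioi (0 : ℝ), ‖f'' y‖ₑ := by
        refine add_le_add (mul_le_mul' le_rfl (add_le_add
          (setLIntegral_comp_add_le (fun y => ‖f y‖ₑ) hh.le) le_rfl)) ?_
        exact setLIntegral_mono_ae' measurableSet_Ioc (Eventually.of_forall fun r hr =>
          setLIntegral_comp_add_le (fun y => ‖f'' y‖ₑ) hr.1.le)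
    _ = _ := by
        rw [setLIntegral_const, Real.volume_Ioc, sub_zero, ← two_mul, ← mul_assoc,
          mul_comm (ENNReal.ofReal h⁻¹), div_eq_mul_inv, ENNReal.ofReal_mul (by norm_num),
          mul_comm (ENNReal.ofReal h)]
        simp

/-- If a family tends to `0` uniformly and its second derivatives are bounded, then its first
derivatives tend to `0` uniformly. -/
lemma tendsto_iSup_deriv {ι : Type*} {l : Filter ι} {f f' f'' : ι → ℝ → ℝ}
    (hf' : ∀ i, Continuous (f' i)) (hf'' : ∀ i, Continuous (f'' i))
    (hd : ∀ i y, 0 < y → HasDerivAt (f i) (f' i y) y)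
    (hd' : ∀ᶠ i in l, ∀ y, 0 < y → HasDerivAt (f' i) (f'' i y) y)
    {L : ℝ} (hL : ∀ᶠ i in l, ∀ y, 0 < y → |f'' i y| ≤ L)
    (h : Tendsto (fun i => ⨆ y ∈ Ici (0 : ℝ), ‖f i y‖ₑ) l (𝓝 0)) :
    Tendsto (fun i => ⨆ y ∈ Ici (0 : ℝ), ‖f' i y‖ₑ) l (𝓝 0) := by
  wlog hL0 : 0 ≤ L generalizing L
  · refine this (L := 0) ?_ le_rfl
    filter_upwards [hL] with i hi y hy
    exact (hi y hy).trans (not_le.1 hL0).le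
  rw [ENNReal.tendsto_nhds_zero] at h ⊢
  intro ε hε
  obtain ⟨e, he, hle⟩ : ∃ e : ℝ, 0 < e ∧ ENNReal.ofReal e ≤ ε := by
    rcases eq_or_ne ε ⊤ with rfl | h1
    · exact ⟨1, one_pos, le_top⟩
    · exact ⟨ε.toReal, ENNReal.toReal_pos hε.ne' h1, (ENNReal.ofReal_toReal h1).le⟩
  -- With step r and sup norm at most er/4, the interpolation bound 2S/r + Lr is at most e/2 + e/2.
  set r := e / (2 * (L + 1)) with hr
  have hr0 : 0 < r := by positivity
  filter_upwards [hL, hd', h (ENNReal.ofReal (e * r / 4)) (by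
    rw [gt_iff_lt, ENNReal.ofReal_pos]; positivity)] with i hi hdi hs
  have hs' : ∀ y, 0 < y → |f i y| ≤ e * r / 4 := fun y hy =>
    abs_le_of_enorm_le (by positivity) ((le_iSup₂ (f := fun y (_ : y ∈ Ici (0 : ℝ)) => ‖f i y‖ₑ)
      y hy.le).trans hs)
  have hb : ∀ y, 0 < y → |f' i y| ≤ e := fun y hy => by
    refine (abs_deriv_le (hf'' i) (hd i) hdi hr0 hs' hi hy).trans ?_
    have h1 : 2 * (e * r / 4) / r = e / 2 := by field_simp; ring
    have h2 : L * r ≤ e / 2 := by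
      rw [hr, ← mul_div_assoc, div_le_iff₀ (by positivity)]
      nlinarith
    linarith
  refine (iSup₂_le fun y hy => ?_).trans hle
  refine enorm_le_ofReal ?_
  have hc : closure (Ioi (0 : ℝ)) ⊆ {y | |f' i y| ≤ e} :=
    closure_minimal (fun y hy => hb y hy) (isClosed_le (hf' i).abs continuous_const)
  rw [closure_Ioi] at hc
  exact hc hy

/-- If a family tends to `0` in `L¹` and its second derivatives are bounded in `L¹`, then its first
derivatives tend to `0` in `L¹`. -/
lemma tendsto_lintegral_deriv {ι : Type*} {l : Filter ι} {f f' f'' : ι → ℝ → ℝ}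
    (hf : ∀ i, Continuous (f i)) (hf'' : ∀ i, Continuous (f'' i))
    (hd : ∀ i y, 0 < y → HasDerivAt (f i) (f' i y) y)
    (hd' : ∀ i y, 0 < y → HasDerivAt (f' i) (f'' i y) y)
    {L : ℝ≥0∞} (hLt : L ≠ ⊤) (hL : ∀ᶠ i in l, ∫⁻ y in Ioi (0 : ℝ), ‖f'' i y‖ₑ ≤ L)
    (h : Tendsto (fun i => ∫⁻ y in Ioi (0 : ℝ), ‖f i y‖ₑ) l (𝓝 0)) :
    Tendsto (fun i => ∫⁻ y in Ioi (0 : ℝ), ‖f' i y‖ₑ) l (𝓝 0) := by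
  rw [ENNReal.tendsto_nhds_zero]
  intro ε hε
  have h1 : Tendsto (fun r : ℝ => ENNReal.ofReal r * L) (𝓝[>] 0) (𝓝 0) := by
    have := ENNReal.Tendsto.mul_const ((ENNReal.continuous_ofReal.tendsto 0).mono_left
      (nhdsWithin_le_nhds (s := Ioi 0))) (Or.inr hLt) (b := L)
    simpa using this
  obtain ⟨r, hr, hr0⟩ := ((ENNReal.tendsto_nhds_zero.1 h1 (ε / 2) (ENNReal.half_pos hε.ne')).and
    self_mem_nhdsWithin).exists
  have h2 : Tendsto (fun i => ENNReal.ofReal (2 / r) * ∫⁻ y in Ioi (0 : ℝ), ‖f i y‖ₑ) l (𝓝 0) := by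
    simpa using ENNReal.Tendsto.const_mul h (Or.inr ENNReal.ofReal_ne_top)
  filter_upwards [hL, ENNReal.tendsto_nhds_zero.1 h2 (ε / 2) (ENNReal.half_pos hε.ne')] with i hi h3
  refine (lintegral_deriv_le (hf i) (hf'' i) (hd i) (hd' i) hr0).trans ?_
  rw [← ENNReal.add_halves ε]
  exact add_le_add h3 ((mul_le_mul' le_rfl hi).trans hr)

/-! ### Bounded and integrable fields -/

/-- Bounded continuous functions of `(t, y)`. -/
structure BoundedField (u : ℝ → ℝ → ℝ) : Prop where
  cont : Continuous (Function.uncurry u)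
  bdd : ∃ M, ∀ t y, |u t y| ≤ M

/-- Bounded continuous functions of `(t, y)` whose time slices are bounded in `L¹`. -/
def IntegrableField (u : ℝ → ℝ → ℝ) : Prop := ∃ M, BddField M u

/-- `f'` is the derivative of `f` with respect to the second variable, on the open half-line. -/
def YDeriv (f f' : ℝ → ℝ → ℝ) : Prop := ∀ t y, 0 < y → HasDerivAt (f t) (f' t y) y

lemma IntegrableField.bounded {u : ℝ → ℝ → ℝ} (h : IntegrableField u) : BoundedField u :=
  h.elim fun M hM => ⟨hM.cont, M, hM.bdd⟩

section

variable {u v : ℝ → ℝ → ℝ}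

lemma BoundedField.add (hu : BoundedField u) (hv : BoundedField v) :
    BoundedField fun t y => u t y + v t y := by
  obtain ⟨hc, M, hM⟩ := hu
  obtain ⟨hc', M', hM'⟩ := hv
  exact ⟨hc.add hc', M + M', fun t y => (abs_add_le _ _).trans (add_le_add (hM t y) (hM' t y))⟩

lemma BoundedField.neg (hu : BoundedField u) : BoundedField fun t y => -u t y := by
  obtain ⟨hc, M, hM⟩ := hu
  exact ⟨hc.neg, M, fun t y => by rw [abs_neg]; exact hM t y⟩

lemma BoundedField.sub (hu : BoundedField u) (hv : BoundedField v) :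
    BoundedField fun t y => u t y - v t y := by
  simpa only [sub_eq_add_neg] using hu.add hv.neg

lemma BoundedField.mul (hu : BoundedField u) (hv : BoundedField v) :
    BoundedField fun t y => u t y * v t y := by
  obtain ⟨hc, M, hM⟩ := hu
  obtain ⟨hc', M', hM'⟩ := hv
  refine ⟨hc.mul hc', M * M', fun t y => ?_⟩
  rw [abs_mul]
  exact mul_le_mul (hM t y) (hM' t y) (abs_nonneg _) ((abs_nonneg _).trans (hM t y))

lemma BoundedField.const_mul (c : ℝ) (hu : BoundedField u) : BoundedField fun t y => c * u t y :=
  BoundedField.mul (u := fun _ _ => c) ⟨continuous_const, |c|, fun _ _ => le_rfl⟩ hu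

lemma BoundedField.sq (hu : BoundedField u) : BoundedField fun t y => u t y ^ 2 := by
  simpa only [pow_two] using hu.mul hu

lemma IntegrableField.add (hu : IntegrableField u) (hv : IntegrableField v) :
    IntegrableField fun t y => u t y + v t y := by
  obtain ⟨M, hu⟩ := hu
  obtain ⟨M', hv⟩ := hv
  refine ⟨M + M', hu.cont.add hv.cont,
    fun t y => (abs_add_le _ _).trans (add_le_add (hu.bdd t y) (hv.bdd t y)), fun t => ?_⟩
  have hm : Measurable fun y => ‖u t y‖ₑ := (continuous_slice hu.cont t).measurable.enorm
  rw [ENNReal.ofReal_add hu.nonneg hv.nonneg]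
  refine le_trans ?_ (add_le_add (hu.int t) (hv.int t))
  rw [← lintegral_add_left hm]
  exact lintegral_mono fun y => enorm_add_le _ _

lemma IntegrableField.neg (hu : IntegrableField u) : IntegrableField fun t y => -u t y := by
  obtain ⟨M, hu⟩ := hu
  refine ⟨M, hu.cont.neg, fun t y => by rw [abs_neg]; exact hu.bdd t y, fun t => ?_⟩
  simp_rw [enorm_neg]
  exact hu.int t

lemma IntegrableField.sub (hu : IntegrableField u) (hv : IntegrableField v) :
    IntegrableField fun t y => u t y - v t y := by
  simpa only [sub_eq_add_neg] using hu.add hv.neg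

lemma IntegrableField.mul (hu : IntegrableField u) (hv : BoundedField v) :
    IntegrableField fun t y => u t y * v t y := by
  obtain ⟨M, hu⟩ := hu
  obtain ⟨hc, M', hM'⟩ := hv
  have h0 : 0 ≤ M' := (abs_nonneg _).trans (hM' 0 0)
  refine ⟨M' * M, hu.cont.mul hc, fun t y => ?_, fun t => ?_⟩
  · rw [abs_mul, mul_comm M']
    exact mul_le_mul (hu.bdd t y) (hM' t y) (abs_nonneg _) hu.nonneg
  · rw [ENNReal.ofReal_mul h0]
    exact (lintegral_enorm_mul_le (hM' t)).trans (mul_le_mul' le_rfl (hu.int t))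

lemma IntegrableField.const_mul (c : ℝ) (hu : IntegrableField u) :
    IntegrableField fun t y => c * u t y := by
  simpa only [mul_comm] using hu.mul (v := fun _ _ => c)
    ⟨continuous_const, |c|, fun _ _ => le_rfl⟩

lemma IntegrableField.sq (hu : IntegrableField u) : IntegrableField fun t y => u t y ^ 2 := by
  simpa only [pow_two] using hu.mul hu.bounded

lemma IntegrableField.prim (hu : IntegrableField u) : BoundedField (prim u) :=
  hu.elim fun M hM => ⟨continuous_prim hM.cont, M, hM.abs_prim_le⟩

lemma continuous_min_left {f : ℝ → ℝ → ℝ} (hf : Continuous (Function.uncurry f)) (T : ℝ) :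
    Continuous (Function.uncurry fun t y => f (min t T) y) :=
  hf.comp (by fun_prop : Continuous fun p : ℝ × ℝ => (min p.1 T, p.2))

lemma BoundedField.duhamel (hu : BoundedField u) {m : ℕ} (hm : m ≤ 3) (i : ℕ) (T : ℝ) :
    BoundedField fun t y => duhamel m i u (min t T) y := by
  obtain ⟨hc, M, hM⟩ := hu
  have hM0 : 0 ≤ M := (abs_nonneg _).trans (hM 0 0)
  exact ⟨continuous_min_left (continuous_duhamel hm i hc hM) T, opC m * scaleInt m T * M,
    fun t y => (abs_duhamel_le hm i (fun s _ => hM s) y).trans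
      (mul_le_mul_of_nonneg_right (opC_mul_scaleInt_le hm (min_le_right _ _)) hM0)⟩

lemma IntegrableField.duhamel (hu : IntegrableField u) {m : ℕ} (hm : m ≤ 3) (i : ℕ) (T : ℝ) :
    IntegrableField fun t y => duhamel m i u (min t T) y := by
  obtain ⟨M, hu⟩ := hu
  have hM0 := hu.nonneg
  refine ⟨opC m * scaleInt m T * M, continuous_min_left (continuous_duhamel hm i hu.cont hu.bdd) T,
    fun t y => (abs_duhamel_le hm i (fun s _ => hu.bdd s) y).trans
      (mul_le_mul_of_nonneg_right (opC_mul_scaleInt_le hm (min_le_right _ _)) hM0), fun t => ?_⟩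
  refine (lintegral_duhamel_le_const hm i hu.cont hu.bdd (fun s _ => hu.int s)).trans ?_
  rw [← ENNReal.ofReal_mul (mul_nonneg (opC_nonneg m) (scaleInt_nonneg m _))]
  exact ENNReal.ofReal_le_ofReal
    (mul_le_mul_of_nonneg_right (opC_mul_scaleInt_le hm (min_le_right _ _)) hM0)

lemma BoundedField.hasDerivAt_duhamel (hu : BoundedField u) {m : ℕ} (hm : m ≤ 2) (i : ℕ) (t : ℝ)
    {y : ℝ} (hy : 0 < y) :
    HasDerivAt (Prandtl.duhamel m i u t) (-Prandtl.duhamel (m + 1) (i + 1) u t y) y :=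
  hu.bdd.elim fun _ hM => Prandtl.hasDerivAt_duhamel hm i hu.cont hM t hy

lemma BoundedField.duhamel_succ (hu : BoundedField u) (hv : BoundedField v) (hd : YDeriv u v)
    (m i : ℕ) (h0 : ∀ s, osc (m + 3 * i) 0 * u s 0 = 0) (t y : ℝ) :
    Prandtl.duhamel (m + 1) i u t y = -Prandtl.duhamel m i v t y :=
  hu.bdd.elim fun _ hM => hv.bdd.elim fun _ hM' =>
    Prandtl.duhamel_succ m i hu.cont hM hv.cont hM' hd h0 t y

end

/-! ### The initial datum -/

/-- `g 0` is a clamped initial datum, with derivatives `g k`, extended to the line by constants. -/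
structure InitialData (B : ℝ) (g : ℕ → ℝ → ℝ) : Prop where
  cont : ∀ k ≤ 6, Continuous (g k)
  bdd : ∀ k ≤ 6, ∀ y, |g k y| ≤ B
  clamp : ∀ k ≤ 6, ∀ y, g k (max y 0) = g k y
  deriv : ∀ k < 6, ∀ y, 0 < y → HasDerivAt (g k) (g (k + 1) y) y
  zero : ∀ k, k = 0 ∨ k = 1 ∨ k = 4 ∨ k = 5 → g k 0 = 0
  int : ∀ k ≤ 4, ∫⁻ y in Ioi (0 : ℝ), ‖g k y‖ₑ ≤ ENNReal.ofReal B

section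

variable {B : ℝ} {g : ℕ → ℝ → ℝ} (hg : InitialData B g)
include hg

lemma InitialData.nonneg : 0 ≤ B := (abs_nonneg _).trans (hg.bdd 0 (by norm_num) 0)

/-- The condition under which the semigroup acting on the k-th derivative is continuous at t = 0:
the orders 2, 3, 6 need no compatibility, the others have it. -/
lemma InitialData.mod_or_zero {k : ℕ} (hk : k ≤ 6) : k % 4 = 2 ∨ k % 4 = 3 ∨ g k 0 = 0 := by
  have := hg.zero k
  interval_cases k <;> simp_all

/-- The boundary term of the integration by parts that passes from order k to k + 1. The
eigenfunction factor vanishes for k = 2, 3; for k = 0, 1, 4, 5 the compatibility conditions on the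
datum are used. -/
lemma InitialData.osc_mul {k : ℕ} (hk : k < 6) : osc (0 + 3 * (k + 1)) 0 * g k 0 = 0 := by
  have := hg.zero k
  by_cases h : k = 2 ∨ k = 3
  · rw [osc_at_zero (by omega), zero_mul]
  · rw [this (by omega), mul_zero]

lemma InitialData.continuous_heat {k : ℕ} (hk : k ≤ 6) :
    Continuous (Function.uncurry (heat k (g k))) :=
  Prandtl.continuous_heat k (hg.cont k hk) (hg.bdd k hk) (hg.clamp k hk) (hg.mod_or_zero hk)

lemma InitialData.heat {k : ℕ} (hk : k ≤ 6) (T : ℝ) :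
    BoundedField fun t y => heat k (g k) (min t T) y :=
  ⟨continuous_min_left (hg.continuous_heat hk) T, (opC 0 + 1) * B,
    fun t y => abs_heat_le k (hg.bdd k hk) (min t T) y⟩

lemma InitialData.heat_integrable {k : ℕ} (hk : k ≤ 4) (T : ℝ) :
    IntegrableField fun t y => Prandtl.heat k (g k) (min t T) y := by
  have h0 := opC_nonneg 0
  refine ⟨(opC 0 + 1) * B, (hg.heat (hk.trans (by norm_num)) T).cont,
    fun t y => abs_heat_le k (hg.bdd k (by omega)) (min t T) y, fun t => ?_⟩
  refine (lintegral_heat_le k (hg.cont k (by omega)) _).trans ?_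
  rw [ENNReal.ofReal_mul (by positivity)]
  exact mul_le_mul' le_rfl (hg.int k hk)

lemma InitialData.hasDerivAt_heat {k : ℕ} (hk : k < 6) (t : ℝ) {y : ℝ} (hy : 0 < y) :
    HasDerivAt (Prandtl.heat k (g k) t) (Prandtl.heat (k + 1) (g (k + 1)) t y) y := by
  rcases le_or_gt t 0 with ht | ht
  · have e : ∀ i f, Prandtl.heat i f t = f := fun i f => by
      funext z
      exact if_pos ht
    rw [e, e]
    exact hg.deriv k hk y hy
  · have h := hasDerivAt_greenOp 0 k ht hy (hg.cont k hk.le) (hg.bdd k hk.le)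
    rw [greenOp_succ 0 (k + 1) ht y (hg.cont k hk.le) (hg.bdd k hk.le) (hg.cont (k + 1) hk)
      (hg.bdd (k + 1) hk) (hg.deriv k hk) (hg.osc_mul hk), neg_neg,
      ← heat_of_pos _ _ ht] at h
    have e : Prandtl.heat k (g k) t = greenOp 0 k t (g k) := by
      funext z
      exact heat_of_pos _ _ ht z
    rwa [e]

lemma InitialData.heat_max {k : ℕ} (hk : k ≤ 6) (t y : ℝ) :
    Prandtl.heat k (g k) t (max y 0) = Prandtl.heat k (g k) t y := by
  unfold Prandtl.heat
  rw [hg.clamp k hk, greenOp_max]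

/-- One step of the bootstrap. -/
lemma InitialData.yDeriv_step {k : ℕ} (hk : k < 6) {F F' : ℝ → ℝ → ℝ} (hF : BoundedField F)
    (hF' : BoundedField F') (hd : YDeriv F F') (h0 : ∀ s, osc (2 + 3 * (k + 1)) 0 * F s 0 = 0)
    (T : ℝ) :
    YDeriv (fun t y => Prandtl.heat k (g k) (min t T) y + duhamel 2 k F (min t T) y)
      fun t y => Prandtl.heat (k + 1) (g (k + 1)) (min t T) y +
        duhamel 2 (k + 1) F' (min t T) y := by
  intro t y hy
  have h := (hg.hasDerivAt_heat hk (min t T) hy).add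
    (hF.hasDerivAt_duhamel le_rfl k (min t T) hy)
  rwa [hF.duhamel_succ hF' hd 2 (k + 1) h0, neg_neg] at h

end

/-! ### The nonlinearity and its derivatives -/

/-- The nonlinearity `v₀² - v₁ ∂_y⁻¹ v₀` and its derivatives, as functions of the derivatives
`v k` of `v 0`. -/
noncomputable def forcing (v : ℕ → ℝ → ℝ → ℝ) : ℕ → ℝ → ℝ → ℝ
  | 0 => fun t y => v 0 t y ^ 2 - v 1 t y * prim (v 0) t y
  | 1 => fun t y => v 0 t y * v 1 t y - v 2 t y * prim (v 0) t y
  | 2 => fun t y => v 1 t y ^ 2 - v 3 t y * prim (v 0) t y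
  | 3 => fun t y => 2 * (v 1 t y * v 2 t y) - v 4 t y * prim (v 0) t y - v 3 t y * v 0 t y
  | _ => fun t y => 2 * v 2 t y ^ 2 + v 1 t y * v 3 t y - 2 * (v 0 t y * v 4 t y) -
      v 5 t y * prim (v 0) t y

section

variable {v : ℕ → ℝ → ℝ → ℝ} {j : ℕ}

lemma forcing_bounded (h0 : IntegrableField (v 0)) (hj : j ≤ 4)
    (hv : ∀ k ≤ j + 1, BoundedField (v k)) : BoundedField (forcing v j) := by
  have hA := h0.prim
  interval_cases j
  · exact (hv 0 (by norm_num)).sq.sub ((hv 1 (by norm_num)).mul hA)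
  · exact ((hv 0 (by norm_num)).mul (hv 1 (by norm_num))).sub ((hv 2 (by norm_num)).mul hA)
  · exact (hv 1 (by norm_num)).sq.sub ((hv 3 (by norm_num)).mul hA)
  · exact ((((hv 1 (by norm_num)).mul (hv 2 (by norm_num))).const_mul 2).sub
      ((hv 4 (by norm_num)).mul hA)).sub ((hv 3 (by norm_num)).mul (hv 0 (by norm_num)))
  · exact ((((hv 2 (by norm_num)).sq.const_mul 2).add
      ((hv 1 (by norm_num)).mul (hv 3 (by norm_num)))).sub
      (((hv 0 (by norm_num)).mul (hv 4 (by norm_num))).const_mul 2)).sub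
      ((hv 5 (by norm_num)).mul hA)

lemma forcing_integrable (hj : j ≤ 3) (hv : ∀ k ≤ j + 1, IntegrableField (v k)) :
    IntegrableField (forcing v j) := by
  have hA := (hv 0 (by norm_num)).prim
  interval_cases j
  · exact (hv 0 (by norm_num)).sq.sub ((hv 1 (by norm_num)).mul hA)
  · exact ((hv 0 (by norm_num)).mul (hv 1 (by norm_num)).bounded).sub ((hv 2 (by norm_num)).mul hA)
  · exact (hv 1 (by norm_num)).sq.sub ((hv 3 (by norm_num)).mul hA)
  · exact ((((hv 1 (by norm_num)).mul (hv 2 (by norm_num)).bounded).const_mul 2).sub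
      ((hv 4 (by norm_num)).mul hA)).sub ((hv 3 (by norm_num)).mul (hv 0 (by norm_num)).bounded)

lemma forcing_yDeriv (hc : Continuous (Function.uncurry (v 0))) (hj : j < 4)
    (hd : ∀ k ≤ j + 1, YDeriv (v k) (v (k + 1))) :
    YDeriv (forcing v j) (forcing v (j + 1)) := by
  intro t y hy
  have hA := hasDerivAt_prim hc t hy
  have h0 := hd 0 (by omega) t y hy
  have h1 := hd 1 (by omega) t y hy
  interval_cases j
  · refine ((h0.pow 2).sub (h1.mul hA)).congr_deriv ?_
    simp only [forcing]
    ring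
  · have h2 := hd 2 (by omega) t y hy
    refine ((h0.mul h1).sub (h2.mul hA)).congr_deriv ?_
    simp only [forcing]
    ring
  · have h3 := hd 3 (by omega) t y hy
    refine ((h1.pow 2).sub (h3.mul hA)).congr_deriv ?_
    simp only [forcing]
    ring
  · have h2 := hd 2 (by omega) t y hy
    have h3 := hd 3 (by omega) t y hy
    have h4 := hd 4 (by omega) t y hy
    refine ((((h1.mul h2).const_mul 2).sub (h4.mul hA)).sub (h3.mul h0)).congr_deriv ?_
    simp only [forcing]
    ring

lemma prim_zero (u : ℝ → ℝ → ℝ) (t : ℝ) : prim u t 0 = 0 := by simp [prim]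

/-- These zeros kill the boundary terms in the bootstrap steps producing the third and fourth
derivatives, where the eigenfunction factor does not vanish. -/
lemma forcing_zero_left (h : ∀ t, v 0 t 0 = 0) (hj : j ≤ 1) (t : ℝ) : forcing v j t 0 = 0 := by
  interval_cases j <;> simp [forcing, h, prim_zero]

lemma forcing_max (hv : ∀ k ≤ 6, ∀ t y, v k t (max y 0) = v k t y) (hj : j ≤ 4) (t y : ℝ) :
    forcing v j t (max y 0) = forcing v j t y := by
  have hA : prim (v 0) t (max y 0) = prim (v 0) t y := by simp [prim]
  have h := fun k (hk : k ≤ 6) => hv k hk t y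
  interval_cases j <;> simp only [forcing, hA, h 0 (by norm_num),
    h 1 (by norm_num), h 2 (by norm_num), h 3 (by norm_num), h 4 (by norm_num), h 5 (by norm_num)]

/-- The conservative and the nonconservative form of the nonlinearity agree. -/
lemma duhamel_source_add_duhamel_flux {v : ℕ → ℝ → ℝ → ℝ} (h0 : IntegrableField (v 0))
    (h1 : BoundedField (v 1)) (hd : YDeriv (v 0) (v 1)) (m i : ℕ) (hm : m ≤ 3)
    (hi : (m + 3 * i) % 4 = 0 ∨ (m + 3 * i) % 4 = 1) (t y : ℝ) :
    duhamel m i (source (v 0)) t y + duhamel (m + 1) i (flux (v 0)) t y =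
      duhamel m i (forcing v 0) t y := by
  have hA := h0.prim
  have b0 := h0.bounded
  have hs : BoundedField (source (v 0)) := b0.sq.const_mul 2
  have hf : BoundedField (flux (v 0)) := b0.mul hA
  have hf' : BoundedField fun t y => v 1 t y * prim (v 0) t y + v 0 t y * v 0 t y :=
    (h1.mul hA).add (b0.mul b0)
  rw [hf.duhamel_succ hf' (fun t y hy => (hd t y hy).mul (hasDerivAt_prim b0.cont t hy)) m i
    (fun s => by rw [osc_at_zero hi, zero_mul]), ← sub_eq_add_neg]
  obtain ⟨M, hM⟩ := hs.bdd
  obtain ⟨M', hM'⟩ := hf'.bdd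
  rw [← duhamel_sub hm i hs.cont hM hf'.cont hM']
  congr 1
  funext t y
  simp only [source, forcing]
  ring

end

/-! ### Regularity of mild solutions -/

/-- Mild solutions with their derivatives `v k`. -/
structure RegularSolution (T B : ℝ) (g : ℕ → ℝ → ℝ) (v : ℕ → ℝ → ℝ → ℝ) : Prop where
  data : InitialData B g
  bounded : ∀ k ≤ 6, BoundedField (v k)
  integrable : ∀ k ≤ 4, IntegrableField (v k)
  deriv : ∀ k < 6, YDeriv (v k) (v (k + 1))
  clamped : ∀ t, v 0 t 0 = 0 ∧ v 1 t 0 = 0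
  clamp : ∀ k ≤ 6, ∀ t y, v k t (max y 0) = v k t y
  eq_zero : ∀ t y, v 0 t y = heat 0 (g 0) (min t T) y + duhamel 0 0 (forcing v 0) (min t T) y
  eq_four : ∀ t y, v 4 t y = heat 4 (g 4) (min t T) y + duhamel 2 4 (forcing v 2) (min t T) y
  eq_five : ∀ t y, v 5 t y = heat 5 (g 5) (min t T) y + duhamel 2 5 (forcing v 3) (min t T) y
  eq_six : ∀ t y, v 6 t y = heat 6 (g 6) (min t T) y + duhamel 2 6 (forcing v 4) (min t T) y

lemma greenOp_at_zero {m i : ℕ} (hi : i % 4 = 0 ∨ i % 4 = 1) (t : ℝ) (f : ℝ → ℝ) :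
    greenOp m i t f 0 = 0 := by
  have h : ∀ η, greenK m i t 0 η = 0 := fun η => by
    simp [greenK, osc_at_zero hi]
  simp [greenOp, h]

lemma duhamel_at_zero {m i : ℕ} (hi : i % 4 = 0 ∨ i % 4 = 1) (f : ℝ → ℝ → ℝ) (t : ℝ) :
    duhamel m i f t 0 = 0 := by
  simp [duhamel, greenOp_at_zero hi]

lemma heat_at_zero {i : ℕ} (hi : i % 4 = 0 ∨ i % 4 = 1) {f : ℝ → ℝ} (h0 : f 0 = 0) (t : ℝ) :
    heat i f t 0 = 0 := by
  unfold heat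
  split_ifs
  · exact h0
  · exact greenOp_at_zero hi t f

/-- Mild solutions with clamped initial data in `C⁶ ∩ W^{4,1}` are regular. -/
lemma exists_regularSolution {B T : ℝ} {g : ℕ → ℝ → ℝ} (hg : InitialData B g) {M : ℝ}
    {u : ℝ → ℝ → ℝ} (hu : BddField M u) (hm : ∀ t y, u t y = mildMap (g 0) T u t y) :
    ∃ v, v 0 = u ∧ RegularSolution T B g v := by
  have i0 : IntegrableField u := ⟨M, hu⟩
  have hs : IntegrableField (source u) := i0.sq.const_mul 2
  have hf : IntegrableField (flux u) := i0.mul i0.prim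
  -- The first derivative is taken entirely on the kernels, since the flux is not yet known to be
  -- differentiable; two derivatives on its kernel are still integrable in time.
  obtain ⟨u1, hu1⟩ : ∃ u1 : ℝ → ℝ → ℝ, u1 = fun t y => heat 1 (g 1) (min t T) y -
    (duhamel 1 1 (source u) (min t T) y + duhamel 2 1 (flux u) (min t T) y) := ⟨_, rfl⟩
  have i1 : IntegrableField u1 := by
    rw [hu1]
    exact (hg.heat_integrable (by norm_num) T).sub
      ((hs.duhamel (by norm_num) 1 T).add (hf.duhamel (by norm_num) 1 T))
  have d0 : YDeriv u u1 := by
    intro t y hy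
    have h := ((hg.hasDerivAt_heat (k := 0) (by norm_num) (min t T) hy).add
      (hs.bounded.hasDerivAt_duhamel (m := 0) (by norm_num) 0 (min t T) hy)).add
      (hf.bounded.hasDerivAt_duhamel (m := 1) (by norm_num) 0 (min t T) hy)
    have e : u t = fun y => mildMap (g 0) T u t y := funext (hm t)
    rw [e, hu1]
    refine h.congr_deriv ?_
    simp only [zero_add]
    ring
  have z0 : ∀ t, u t 0 = 0 := fun t => by
    rw [hm, mildMap, heat_at_zero (by norm_num) (hg.zero 0 (by norm_num)),
      duhamel_at_zero (by norm_num), duhamel_at_zero (by norm_num)]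
    norm_num
  have z1 : ∀ t, u1 t 0 = 0 := fun t => by
    simp only [hu1]
    rw [heat_at_zero (by norm_num) (hg.zero 1 (by norm_num)),
      duhamel_at_zero (by norm_num), duhamel_at_zero (by norm_num)]
    norm_num
  -- The j-th derivative of the nonlinearity involves v only up to order j + 1. It can therefore be
  -- evaluated on the list of fields constructed so far, padded with zeros, and agrees
  -- definitionally with its value on the final sequence.
  obtain ⟨w2, hw2⟩ : ∃ w : ℝ → ℝ → ℝ, w = fun t y => heat 2 (g 2) (min t T) y +
    duhamel 2 2 (forcing (fun n => [u, u1].getD n 0) 0) (min t T) y := ⟨_, rfl⟩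
  obtain ⟨w3, hw3⟩ : ∃ w : ℝ → ℝ → ℝ, w = fun t y => heat 3 (g 3) (min t T) y +
    duhamel 2 3 (forcing (fun n => [u, u1, w2].getD n 0) 1) (min t T) y := ⟨_, rfl⟩
  obtain ⟨w4, hw4⟩ : ∃ w : ℝ → ℝ → ℝ, w = fun t y => heat 4 (g 4) (min t T) y +
    duhamel 2 4 (forcing (fun n => [u, u1, w2, w3].getD n 0) 2) (min t T) y := ⟨_, rfl⟩
  obtain ⟨w5, hw5⟩ : ∃ w : ℝ → ℝ → ℝ, w = fun t y => heat 5 (g 5) (min t T) y +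
    duhamel 2 5 (forcing (fun n => [u, u1, w2, w3, w4].getD n 0) 3) (min t T) y := ⟨_, rfl⟩
  obtain ⟨w6, hw6⟩ : ∃ w : ℝ → ℝ → ℝ, w = fun t y => heat 6 (g 6) (min t T) y +
    duhamel 2 6 (forcing (fun n => [u, u1, w2, w3, w4, w5].getD n 0) 4) (min t T) y := ⟨_, rfl⟩
  set v : ℕ → ℝ → ℝ → ℝ := fun n => [u, u1, w2, w3, w4, w5, w6].getD n 0 with hv
  have e2 : v 2 = fun t y => heat 2 (g 2) (min t T) y + duhamel 2 2 (forcing v 0) (min t T) y := hw2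
  have e3 : v 3 = fun t y => heat 3 (g 3) (min t T) y + duhamel 2 3 (forcing v 1) (min t T) y := hw3
  have e4 : v 4 = fun t y => heat 4 (g 4) (min t T) y + duhamel 2 4 (forcing v 2) (min t T) y := hw4
  have e5 : v 5 = fun t y => heat 5 (g 5) (min t T) y + duhamel 2 5 (forcing v 3) (min t T) y := hw5
  have e6 : v 6 = fun t y => heat 6 (g 6) (min t T) y + duhamel 2 6 (forcing v 4) (min t T) y := hw6
  have e0 : v 0 = u := rfl
  have e1 : v 1 = fun t y => heat 1 (g 1) (min t T) y - (duhamel 1 1 (source (v 0)) (min t T) y +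
    duhamel 2 1 (flux (v 0)) (min t T) y) := hu1
  have hm : ∀ t y, v 0 t y = mildMap (g 0) T (v 0) t y := hm
  have z1 : ∀ t, v 1 t 0 = 0 := z1
  have i0 : IntegrableField (v 0) := i0
  have i1 : IntegrableField (v 1) := i1
  have d0 : YDeriv (v 0) (v 1) := d0
  have z0 : ∀ t, v 0 t 0 = 0 := z0
  clear_value v
  have f0 : IntegrableField (forcing v 0) := forcing_integrable (by norm_num) fun k hk => by
    interval_cases k <;> assumption
  have i2 : IntegrableField (v 2) := by
    rw [e2]
    exact (hg.heat_integrable (by norm_num) T).add (f0.duhamel (by norm_num) 2 T)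
  have f1 : IntegrableField (forcing v 1) := forcing_integrable (by norm_num) fun k hk => by
    interval_cases k <;> assumption
  have i3 : IntegrableField (v 3) := by
    rw [e3]
    exact (hg.heat_integrable (by norm_num) T).add (f1.duhamel (by norm_num) 3 T)
  have f2 : IntegrableField (forcing v 2) := forcing_integrable (by norm_num) fun k hk => by
    interval_cases k <;> assumption
  have i4 : IntegrableField (v 4) := by
    rw [e4]
    exact (hg.heat_integrable (by norm_num) T).add (f2.duhamel (by norm_num) 4 T)
  have f3 : IntegrableField (forcing v 3) := forcing_integrable (by norm_num) fun k hk => by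
    interval_cases k <;> assumption
  have b5 : BoundedField (v 5) := by
    rw [e5]
    exact (hg.heat (by norm_num) T).add (f3.bounded.duhamel (by norm_num) 5 T)
  have f4 : BoundedField (forcing v 4) := forcing_bounded i0 (by norm_num) fun k hk => by
    interval_cases k
    exacts [i0.bounded, i1.bounded, i2.bounded, i3.bounded, i4.bounded, b5]
  have b6 : BoundedField (v 6) := by
    rw [e6]
    exact (hg.heat (by norm_num) T).add (f4.duhamel (by norm_num) 6 T)
  have d1 : YDeriv (v 1) (v 2) := by
    intro t y hy
    have h := (hg.hasDerivAt_heat (k := 1) (by norm_num) (min t T) hy).sub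
      (f0.bounded.hasDerivAt_duhamel (m := 1) (by norm_num) 1 (min t T) hy)
    -- Once the first derivative is available, the flux term is integrated by parts and merges with
    -- the source. Only one derivative remains on the kernel, which leaves room for a second.
    have e : v 1 t = heat 1 (g 1) (min t T) - duhamel 1 1 (forcing v 0) (min t T) := by
      funext z
      rw [e1, Pi.sub_apply, ← duhamel_source_add_duhamel_flux i0 i1.bounded d0 1 1 (by norm_num)
        (by norm_num) (min t T) z]
    rw [e, e2]
    refine h.congr_deriv ?_
    simp only [Nat.reduceAdd]
    ring
  have zf : ∀ j ≤ 1, ∀ s, forcing v j s 0 = 0 := fun j hj s => forcing_zero_left z0 hj s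
  have df0 : YDeriv (forcing v 0) (forcing v 1) :=
    forcing_yDeriv i0.bounded.cont (by norm_num) fun k hk => by interval_cases k <;> assumption
  -- The eigenfunction index here is 11 ≡ 3, and 14 ≡ 2 in the next step, so the forcing must vanish
  -- at 0. In the last two steps the indices 17 ≡ 1 and 20 ≡ 0 need no condition.
  have d2 : YDeriv (v 2) (v 3) := by
    rw [e2, e3]
    exact hg.yDeriv_step (by norm_num) f0.bounded f1.bounded df0
      (fun s => by rw [zf 0 (by norm_num), mul_zero]) T
  have df1 : YDeriv (forcing v 1) (forcing v 2) :=
    forcing_yDeriv i0.bounded.cont (by norm_num) fun k hk => by interval_cases k <;> assumption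
  have d3 : YDeriv (v 3) (v 4) := by
    rw [e3, e4]
    exact hg.yDeriv_step (by norm_num) f1.bounded f2.bounded df1
      (fun s => by rw [zf 1 (by norm_num), mul_zero]) T
  have df2 : YDeriv (forcing v 2) (forcing v 3) :=
    forcing_yDeriv i0.bounded.cont (by norm_num) fun k hk => by interval_cases k <;> assumption
  have d4 : YDeriv (v 4) (v 5) := by
    rw [e4, e5]
    exact hg.yDeriv_step (by norm_num) f2.bounded f3.bounded df2
      (fun s => by rw [osc_at_zero (by norm_num), zero_mul]) T
  have df3 : YDeriv (forcing v 3) (forcing v 4) :=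
    forcing_yDeriv i0.bounded.cont (by norm_num) fun k hk => by interval_cases k <;> assumption
  have d5 : YDeriv (v 5) (v 6) := by
    rw [e5, e6]
    exact hg.yDeriv_step (by norm_num) f3.bounded f4 df3
      (fun s => by rw [osc_at_zero (by norm_num), zero_mul]) T
  refine ⟨v, e0, hg, fun k hk => ?_, fun k hk => ?_, fun k hk => ?_, fun t => ⟨z0 t, z1 t⟩,
    fun k hk t y => ?_, fun t y => ?_, fun t y => congrFun₂ e4 t y, fun t y => congrFun₂ e5 t y,
    fun t y => congrFun₂ e6 t y⟩
  · interval_cases k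
    exacts [i0.bounded, i1.bounded, i2.bounded, i3.bounded, i4.bounded, b5, b6]
  · interval_cases k <;> assumption
  · interval_cases k <;> assumption
  · have hh := fun k (hk : k ≤ 6) => hg.heat_max hk (min t T) y
    interval_cases k
    · rw [hm, hm, mildMap, mildMap, hh 0 hk, duhamel_max, duhamel_max]
    · simp only [e1, hh 1 hk, duhamel_max]
    · simp only [e2, hh 2 hk, duhamel_max]
    · simp only [e3, hh 3 hk, duhamel_max]
    · simp only [e4, hh 4 hk, duhamel_max]
    · simp only [e5, hh 5 hk, duhamel_max]
    · simp only [e6, hh 6 hk, duhamel_max]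
  · rw [hm, mildMap, add_assoc, ← duhamel_source_add_duhamel_flux i0 i1.bounded d0 0 0 (by norm_num)
      (by norm_num) (min t T) y]

/-! ### The equation -/

section

variable {h : ℕ → ℝ → ℝ} {B : ℝ} (hc : ∀ k ≤ 4, Continuous (h k)) (hB : ∀ k ≤ 4, ∀ y, |h k y| ≤ B)
  (hd : ∀ k < 4, ∀ y, 0 < y → HasDerivAt (h k) (h (k + 1) y) y) (h0 : h 0 0 = 0) (h1 : h 1 0 = 0)
include hc hB hd h0 h1

/-- Symmetry of ∂_y⁴ under the clamped conditions. Of the four boundary terms, two vanish because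
the function and its first derivative are zero at 0, the other two because the eigenfunction is
clamped. -/
lemma greenOp_four {t : ℝ} (ht : 0 < t) (y : ℝ) :
    greenOp 4 0 t (h 0) y = greenOp 0 0 t (h 4) y := by
  have step : ∀ m k, k < 4 → osc (m + 3 * 0) 0 * h k 0 = 0 →
      greenOp (m + 1) 0 t (h k) y = -greenOp m 0 t (h (k + 1)) y := fun m k hk ho =>
    greenOp_succ m 0 ht y (hc k hk.le) (hB k hk.le) (hc (k + 1) hk) (hB (k + 1) hk) (hd k hk) ho
  rw [step 3 0 (by norm_num) (by rw [h0, mul_zero]), step 2 1 (by norm_num) (by rw [h1, mul_zero]),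
    step 1 2 (by norm_num) (by rw [osc_at_zero (by norm_num), zero_mul]),
    step 0 3 (by norm_num) (by rw [osc_at_zero (by norm_num), zero_mul])]
  ring

lemma hasDerivAt_greenOp_fixed {t : ℝ} (ht : 0 < t) (y : ℝ) :
    HasDerivAt (fun r => greenOp 0 0 r (h 0) y) (-greenOp 0 0 t (h 4) y) t := by
  -- The formula with reversed time is applied with final time 2t at s = t, where the elapsed time
  -- is t; composing with r ↦ 2t - r restores the direction of time.
  have e := hasDerivAt_greenOp_time 0 0 (t := 2 * t) (s := t) (y := y) (b := fun _ => h 0)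
    (b' := fun _ _ => 0) (B' := 0) (by linarith) (fun _ => hc 0 (by norm_num))
    (fun _ => hB 0 (by norm_num)) (fun _ => continuous_const) (fun _ _ => by simp) univ_mem
    (fun _ _ z _ => hasDerivAt_const _ _)
  have e0 : greenOp 0 0 (2 * t - t) (fun _ => 0) y = 0 := by simp [greenOp]
  have e1 : 2 * t - t = t := by ring
  rw [e0, add_zero, e1, zero_add, greenOp_four hc hB hd h0 h1 ht] at e
  have e2 : HasDerivAt (fun r => 2 * t - r) (-1) t := by
    simpa using (hasDerivAt_id t).const_sub (2 * t)
  have e3 := HasDerivAt.comp t (h₂ := fun s => greenOp 0 0 (2 * t - s) (h 0) y)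
    (h := fun r => 2 * t - r) (by simpa only [e1] using e) e2
  refine (e3.congr_deriv (by ring)).congr_of_eventuallyEq (Eventually.of_forall fun r => ?_)
  simp [Function.comp]

/-- The fundamental theorem of calculus for the semigroup; its continuity at time zero allows the
integration to start at 0. -/
lemma integral_greenOp_fixed (hm : ∀ y, h 0 (max y 0) = h 0 y) {t : ℝ} (ht : 0 ≤ t) (y : ℝ) :
    ∫ r in (0 : ℝ)..t, greenOp 0 0 r (h 4) y = h 0 y - heat 0 (h 0) t y := by
  have hi : IntervalIntegrable (fun r => -greenOp 0 0 r (h 4) y) volume 0 t := by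
    rw [intervalIntegrable_iff_integrableOn_Ioc_of_le ht]
    exact (integrableOn_greenOp_sub (m := 0) (by norm_num) 0 (f := fun _ => h 4)
      ((hc 4 le_rfl).comp continuous_snd) (fun _ => hB 4 le_rfl) 0 t y).neg
  have hcont : Continuous fun r => heat 0 (h 0) r y :=
    (continuous_heat 0 (hc 0 (by norm_num)) (hB 0 (by norm_num)) hm (Or.inr (Or.inr h0))).comp
      (by fun_prop : Continuous fun r : ℝ => (r, y))
  have e := intervalIntegral.integral_eq_sub_of_hasDerivAt_of_le ht hcont.continuousOn
    (fun r hr => (hasDerivAt_greenOp_fixed hc hB hd h0 h1 hr.1 y).congr_of_eventuallyEq (by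
      filter_upwards [lt_mem_nhds hr.1] with s hs
      exact heat_of_pos 0 _ hs y)) hi
  rw [intervalIntegral.integral_neg, heat_zero] at e
  linarith

end

lemma duhamel_eq_integral (m i : ℕ) (f : ℝ → ℝ → ℝ) {t : ℝ} (ht : 0 ≤ t) (y : ℝ) :
    duhamel m i f t y = ∫ s in (0 : ℝ)..t, greenOp m i (t - s) (f s) y := by
  have := intervalIntegral.integral_comp_sub_left (a := 0) (b := t)
    (fun r => greenOp m i r (f (t - r)) y) t
  rw [sub_self, sub_zero] at this
  rw [duhamel, ← intervalIntegral.integral_of_le ht, ← this]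
  simp

lemma setIntegral_indicator_lt {t τ : ℝ} (hτ : τ ∈ Ioc 0 t) (f : ℝ → ℝ) :
    ∫ s in Ioc 0 t, (if s < τ then f s else 0) = ∫ s in (0 : ℝ)..τ, f s := by
  have e : (fun s => if s < τ then f s else 0) = (Iio τ).indicator f := by
    funext s
    simp [indicator]
  rw [e, setIntegral_indicator measurableSet_Iio, intervalIntegral.integral_of_le hτ.1.le,
    integral_Ioc_eq_integral_Ioo]
  congr 2
  ext s
  simp only [mem_inter_iff, mem_Ioc, mem_Iio, mem_Ioo]
  have := hτ.2
  constructor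
  · rintro ⟨⟨h1, h2⟩, h3⟩
    exact ⟨h1, h3⟩
  · rintro ⟨h1, h3⟩
    exact ⟨⟨h1, by linarith⟩, h3⟩

lemma setIntegral_indicator_gt {t s : ℝ} (hs : s ∈ Ioc 0 t) (f : ℝ → ℝ) :
    ∫ τ in Ioc 0 t, (if s < τ then f τ else 0) = ∫ τ in s..t, f τ := by
  have e : (fun τ => if s < τ then f τ else 0) = (Ioi s).indicator f := by
    funext s
    simp [indicator]
  rw [e, setIntegral_indicator measurableSet_Ioi, intervalIntegral.integral_of_le hs.2]
  congr 2
  ext τ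
  simp only [mem_inter_iff, mem_Ioc, mem_Ioi]
  have := hs.1
  constructor
  · rintro ⟨⟨h1, h2⟩, h3⟩
    exact ⟨h3, h2⟩
  · rintro ⟨h1, h3⟩
    exact ⟨⟨by linarith, h3⟩, h1⟩

/-- Fubini on the triangle s < τ < t. The inner integral then runs over the time elapsed since s
with `f s` fixed, where the semigroup identity applies. -/
lemma integral_duhamel_swap {f : ℝ → ℝ → ℝ} {B : ℝ} (hf : Continuous (Function.uncurry f))
    (hB : ∀ s y, |f s y| ≤ B) {t : ℝ} (ht : 0 ≤ t) (y : ℝ) :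
    ∫ τ in (0 : ℝ)..t, duhamel 0 0 f τ y =
      ∫ s in (0 : ℝ)..t, ∫ r in (0 : ℝ)..t - s, greenOp 0 0 r (f s) y := by
  set E : ℝ → ℝ → ℝ := fun τ s => if s < τ then greenOp 0 0 (τ - s) (f s) y else 0 with hE
  have hS : MeasurableSet {p : ℝ × ℝ | p.2 < p.1} := measurableSet_lt measurable_snd measurable_fst
  have hind : Function.uncurry E =
      {p : ℝ × ℝ | p.2 < p.1}.indicator fun p => greenOp 0 0 (p.1 - p.2) (f p.2) y := by
    funext p
    simp [hE, indicator, Function.uncurry]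
  have hmeas : AEStronglyMeasurable (Function.uncurry E) (volume : Measure (ℝ × ℝ)) := by
    rw [hind, aestronglyMeasurable_indicator_iff hS]
    refine ContinuousOn.aestronglyMeasurable ?_ hS
    exact (continuousOn_greenOp 0 0 hf hB).comp (f := fun p : ℝ × ℝ => (p.1 - p.2, p.2, y))
      (by fun_prop) fun p hp => ⟨sub_pos.2 (show p.2 < p.1 from hp), mem_univ _⟩
  have hB0 : 0 ≤ B := (abs_nonneg _).trans (hB 0 0)
  have hint : Integrable (Function.uncurry E)
      ((volume.restrict (Ioc 0 t)).prod (volume.restrict (Ioc 0 t))) := by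
    refine Integrable.of_bound (C := opC 0 * B) ?_ ?_
    · rw [Measure.prod_restrict]
      exact hmeas.restrict
    · refine Eventually.of_forall fun p => ?_
      simp only [hE, Function.uncurry]
      split_ifs with hp
      · have := abs_greenOp_le 0 0 (sub_pos.2 hp) y (hB p.2)
        simpa using this
      · simpa using mul_nonneg (opC_nonneg 0) hB0
  have hsw := integral_integral_swap hint
  rw [intervalIntegral.integral_of_le ht, intervalIntegral.integral_of_le ht]
  calc _ = ∫ τ in Ioc 0 t, ∫ s in Ioc 0 t, E τ s := by
        refine setIntegral_congr_fun measurableSet_Ioc fun τ hτ => ?_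
        rw [duhamel_eq_integral 0 0 f hτ.1.le,
          ← setIntegral_indicator_lt hτ fun s => greenOp 0 0 (τ - s) (f s) y]
    _ = ∫ s in Ioc 0 t, ∫ τ in Ioc 0 t, E τ s := hsw
    _ = _ := by
        refine setIntegral_congr_fun measurableSet_Ioc fun s hs => ?_
        simp only [hE]
        rw [setIntegral_indicator_gt hs fun τ => greenOp 0 0 (τ - s) (f s) y,
          intervalIntegral.integral_comp_sub_right (fun r => greenOp 0 0 r (f s) y) s, sub_self]

lemma integrableOn_greenOp_time {f : ℝ → ℝ → ℝ} {B : ℝ} (hf : Continuous (Function.uncurry f))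
    (hB : ∀ s y, |f s y| ≤ B) (t y : ℝ) :
    IntegrableOn (fun s => greenOp 0 0 (t - s) (f s) y) (Ioo 0 t) := by
  refine Integrable.of_bound (C := opC 0 * B) ?_ ?_
  · have hc : ContinuousOn (fun s => greenOp 0 0 (t - s) (f s) y) (Ioo 0 t) :=
      (continuousOn_greenOp 0 0 hf hB).comp (f := fun s : ℝ => (t - s, s, y)) (by fun_prop)
        fun s hs => ⟨by simpa using hs.2, mem_univ _⟩
    exact hc.aestronglyMeasurable measurableSet_Ioo
  · filter_upwards [ae_restrict_mem measurableSet_Ioo] with s hs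
    have := abs_greenOp_le 0 0 (sub_pos.2 hs.2) y (hB s)
    simpa using this

/-- The Duhamel integral of a smooth clamped function, integrated in time. -/
lemma duhamel_eq_sub {F : ℕ → ℝ → ℝ → ℝ} (hF : ∀ k ≤ 4, BoundedField (F k))
    (hd : ∀ k < 4, YDeriv (F k) (F (k + 1))) (hm : ∀ t y, F 0 t (max y 0) = F 0 t y)
    (h0 : ∀ t, F 0 t 0 = 0) (h1 : ∀ t, F 1 t 0 = 0) {t : ℝ} (ht : 0 ≤ t) (y : ℝ) :
    duhamel 0 0 (F 0) t y =
      (∫ s in (0 : ℝ)..t, F 0 s y) - ∫ s in (0 : ℝ)..t, duhamel 0 0 (F 4) s y := by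
  obtain ⟨B, hB⟩ : ∃ B, ∀ k ≤ 4, ∀ s y, |F k s y| ≤ B := by
    choose! M hM using fun k hk => (hF k hk).bdd
    refine ⟨∑ k ∈ Finset.range 5, |M k|, fun k hk s y => (hM k hk s y).trans ((le_abs_self _).trans
      (Finset.single_le_sum (f := fun k => |M k|) (fun _ _ => abs_nonneg _)
        (Finset.mem_range.2 (by omega))))⟩
  have hs : ∀ s ∈ Ioo 0 t, ∫ r in (0 : ℝ)..t - s, greenOp 0 0 r (F 4 s) y =
      F 0 s y - greenOp 0 0 (t - s) (F 0 s) y := fun s hs => by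
    rw [integral_greenOp_fixed (h := fun k => F k s) (fun k hk => continuous_slice (hF k hk).cont s)
      (fun k hk => hB k hk s) (fun k hk => hd k hk s) (h0 s) (h1 s) (hm s) (by linarith [hs.2]),
      heat_of_pos _ _ (by linarith [hs.2])]
  have hi1 : IntegrableOn (fun s => F 0 s y) (Ioo 0 t) :=
    (((hF 0 (by norm_num)).cont.comp (by fun_prop : Continuous fun s : ℝ => (s, y))).integrableOn_Icc
      (a := 0) (b := t)).mono_set Ioo_subset_Icc_self
  have hi2 : IntegrableOn (fun s => greenOp 0 0 (t - s) (F 0 s) y) (Ioo 0 t) :=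
    integrableOn_greenOp_time (hF 0 (by norm_num)).cont (hB 0 (by norm_num)) t y
  rw [integral_duhamel_swap (hF 4 le_rfl).cont (hB 4 le_rfl) ht, duhamel_eq_integral 0 0 _ ht]
  simp only [intervalIntegral.integral_of_le ht, integral_Ioc_eq_integral_Ioo]
  have e : ∫ s in Ioo 0 t, ∫ r in (0 : ℝ)..t - s, greenOp 0 0 r (F 4 s) y =
      ∫ s in Ioo 0 t, (F 0 s y - greenOp 0 0 (t - s) (F 0 s) y) :=
    setIntegral_congr_fun measurableSet_Ioo hs
  rw [e, integral_sub hi1 hi2]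
  ring

namespace RegularSolution

variable {T B : ℝ} {g : ℕ → ℝ → ℝ} {v : ℕ → ℝ → ℝ → ℝ} (hv : RegularSolution T B g v)
include hv

lemma forcing_bounded {j : ℕ} (hj : j ≤ 4) : BoundedField (forcing v j) :=
  Prandtl.forcing_bounded (hv.integrable 0 (by norm_num)) hj fun k hk => hv.bounded k (by omega)

lemma forcing_integrable {j : ℕ} (hj : j ≤ 3) : IntegrableField (forcing v j) :=
  Prandtl.forcing_integrable hj fun k hk => hv.integrable k (by omega)

lemma forcing_yDeriv {j : ℕ} (hj : j < 4) : YDeriv (forcing v j) (forcing v (j + 1)) :=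
  Prandtl.forcing_yDeriv (hv.bounded 0 (by norm_num)).cont hj fun k hk => hv.deriv k (by omega)

lemma duhamel_two_eq {k : ℕ} (j : ℕ) (hj : j ≤ 3)
    (h : (1 + 3 * k) % 4 = 0 ∨ (1 + 3 * k) % 4 = 1) (t y : ℝ) :
    duhamel 2 k (forcing v j) t y = -duhamel 1 k (forcing v (j + 1)) t y :=
  (hv.forcing_bounded (by omega)).duhamel_succ (hv.forcing_bounded (by omega))
    (hv.forcing_yDeriv (by omega)) 1 k (fun s => by rw [osc_at_zero h, zero_mul]) t y

/-- For order four both derivatives remaining on the kernel can be removed, since the indices 13 and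
12 are 1 and 0 modulo 4. The formula becomes that of the original semigroup acting on fourth
derivatives, ready to be integrated in time. -/
lemma eq_four' (t y : ℝ) :
    v 4 t y = heat 0 (g 4) (min t T) y + duhamel 0 0 (forcing v 4) (min t T) y := by
  rw [hv.eq_four, hv.duhamel_two_eq 2 (by norm_num) (by norm_num),
    (hv.forcing_bounded (j := 3) (by norm_num)).duhamel_succ
      (hv.forcing_bounded (j := 4) (by norm_num)) (hv.forcing_yDeriv (by norm_num)) 0 4
      (fun s => by rw [osc_at_zero (by norm_num), zero_mul]), neg_neg,
    ← heat_add_four 0, ← duhamel_add_four 0 0]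

/-- The right-hand side of the equation. -/
lemma rhs_integrable : IntegrableField fun t y => forcing v 0 t y - v 4 t y :=
  (hv.forcing_integrable (by norm_num)).sub (hv.integrable 4 le_rfl)

/-- Integrating the formula for the fourth derivative in time reproduces g 0 minus the free
evolution, and the time integral of the forcing minus the Duhamel term. Adding the mild formula
leaves exactly the integrated equation; the integrand is continuous, so the pointwise equation
follows. -/
lemma eq_integral {t : ℝ} (ht : t ∈ Icc 0 T) (y : ℝ) :
    v 0 t y = g 0 y + ∫ s in (0 : ℝ)..t, (forcing v 0 s y - v 4 s y) := by
  have hc : ∀ {f : ℝ → ℝ → ℝ}, BoundedField f → ∀ a b, IntervalIntegrable (fun s => f s y) volume a b :=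
    fun hf a b => (hf.cont.comp (by fun_prop : Continuous fun s : ℝ => (s, y))).intervalIntegrable _ _
  have hF4 := hv.forcing_bounded (j := 4) le_rfl
  have e4 : ∫ s in (0 : ℝ)..t, v 4 s y = (∫ s in (0 : ℝ)..t, greenOp 0 0 s (g 4) y) +
      ∫ s in (0 : ℝ)..t, duhamel 0 0 (forcing v 4) s y := by
    obtain ⟨M, hM⟩ := hF4.bdd
    have hi1 : IntervalIntegrable (fun r => greenOp 0 0 r (g 4) y) volume 0 t := by
      rw [intervalIntegrable_iff_integrableOn_Ioc_of_le ht.1]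
      exact integrableOn_greenOp_sub (m := 0) (by norm_num) 0 (f := fun _ => g 4)
        ((hv.data.cont 4 (by norm_num)).comp continuous_snd)
        (fun _ => hv.data.bdd 4 (by norm_num)) 0 t y
    have hi2 : IntervalIntegrable (fun s => duhamel 0 0 (forcing v 4) s y) volume 0 t :=
      ((continuous_duhamel (m := 0) (by norm_num) 0 hF4.cont hM).comp
        (by fun_prop : Continuous fun s : ℝ => (s, y))).intervalIntegrable _ _
    rw [← intervalIntegral.integral_add hi1 hi2]
    refine intervalIntegral.integral_congr_ae (Eventually.of_forall fun s hs => ?_)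
    rw [uIoc_of_le ht.1] at hs
    rw [hv.eq_four', min_eq_left (hs.2.trans ht.2), heat_of_pos _ _ hs.1]
  have hg := hv.data
  rw [intervalIntegral.integral_sub (hc (hv.forcing_bounded (by norm_num)) _ _)
    (hc (hv.bounded 4 (by norm_num)) _ _), e4, hv.eq_zero, min_eq_left ht.2,
    duhamel_eq_sub (F := forcing v) (fun k hk => hv.forcing_bounded hk)
      (fun k hk => hv.forcing_yDeriv hk) (forcing_max hv.clamp (by norm_num))
      (forcing_zero_left (fun t => (hv.clamped t).1) (by norm_num))
      (forcing_zero_left (fun t => (hv.clamped t).1) (by norm_num)) ht.1,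
    integral_greenOp_fixed (fun k hk => hg.cont k (by omega)) (fun k hk => hg.bdd k (by omega))
      (fun k hk => hg.deriv k (by omega)) (hg.zero 0 (by norm_num)) (hg.zero 1 (by norm_num))
      (hg.clamp 0 (by norm_num)) ht.1]
  ring

lemma sub_eq_integral {s t : ℝ} (hs : s ∈ Icc 0 T) (ht : t ∈ Icc 0 T) (y : ℝ) :
    v 0 t y - v 0 s y = ∫ r in s..t, (forcing v 0 r y - v 4 r y) := by
  have hc : Continuous fun r => forcing v 0 r y - v 4 r y :=
    hv.rhs_integrable.bounded.cont.comp (by fun_prop : Continuous fun s : ℝ => (s, y))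
  rw [hv.eq_integral hs, hv.eq_integral ht, ← intervalIntegral.integral_add_adjacent_intervals
    (hc.intervalIntegrable 0 s) (hc.intervalIntegrable s t)]
  ring

lemma hasDerivAt {t : ℝ} (ht : t ∈ Ioo 0 T) (y : ℝ) :
    HasDerivAt (fun s => v 0 s y) (forcing v 0 t y - v 4 t y) t := by
  have hc : Continuous fun r => forcing v 0 r y - v 4 r y :=
    hv.rhs_integrable.bounded.cont.comp (by fun_prop : Continuous fun s : ℝ => (s, y))
  have h := (intervalIntegral.integral_hasDerivAt_right (hc.intervalIntegrable 0 t)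
    (hc.stronglyMeasurableAtFilter _ _) hc.continuousAt).const_add (g 0 y)
  refine h.congr_of_eventuallyEq ?_
  filter_upwards [Icc_mem_nhds ht.1 ht.2] with s hs
  exact hv.eq_integral hs y

end RegularSolution

/-! ### Regularity in the function spaces -/

lemma setLIntegral_Ici_eq (f : ℝ → ℝ≥0∞) : ∫⁻ y in Ici (0 : ℝ), f y = ∫⁻ y in Ioi (0 : ℝ), f y :=
  setLIntegral_congr Ioi_ae_eq_Ici.symm

lemma BddField.integrableOn {M : ℝ} {u : ℝ → ℝ → ℝ} (h : BddField M u) (t : ℝ) :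
    IntegrableOn (u t) (Ioi 0) :=
  ⟨(continuous_slice h.cont t).aestronglyMeasurable, (h.int t).trans_lt ENNReal.ofReal_lt_top⟩

lemma lintegral_enorm_sub_le {f g : ℝ → ℝ} (hf : Continuous f) :
    ∫⁻ y in Ioi (0 : ℝ), ‖f y - g y‖ₑ ≤
      (∫⁻ y in Ioi (0 : ℝ), ‖f y‖ₑ) + ∫⁻ y in Ioi (0 : ℝ), ‖g y‖ₑ := by
  rw [← lintegral_add_left hf.measurable.enorm]
  exact lintegral_mono fun y => enorm_sub_le

lemma lintegral_enorm_add_le {f g : ℝ → ℝ} (hf : Continuous f) :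
    ∫⁻ y in Ioi (0 : ℝ), ‖f y + g y‖ₑ ≤
      (∫⁻ y in Ioi (0 : ℝ), ‖f y‖ₑ) + ∫⁻ y in Ioi (0 : ℝ), ‖g y‖ₑ := by
  rw [← lintegral_add_left hf.measurable.enorm]
  exact lintegral_mono fun y => enorm_add_le _ _

lemma lintegral_integral_le {f : ℝ → ℝ → ℝ} {M : ℝ} (hf : BddField M f) (s t : ℝ) :
    ∫⁻ y in Ioi (0 : ℝ), ‖∫ r in s..t, f r y‖ₑ ≤ ENNReal.ofReal (M * |t - s|) := by
  calc _ ≤ ∫⁻ y in Ioi (0 : ℝ), ∫⁻ r in uIoc s t, ‖f r y‖ₑ := by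
        refine lintegral_mono fun y => ?_
        rw [← ofReal_norm, intervalIntegral.norm_intervalIntegral_eq, ofReal_norm]
        exact enorm_integral_le_lintegral_enorm _
    _ = ∫⁻ r in uIoc s t, ∫⁻ y in Ioi (0 : ℝ), ‖f r y‖ₑ := by
        refine lintegral_lintegral_swap ?_
        have hc : Continuous fun p : ℝ × ℝ => f p.2 p.1 := hf.cont.comp continuous_swap
        exact hc.measurable.enorm.aemeasurable
    _ ≤ ∫⁻ r in uIoc s t, ENNReal.ofReal M := lintegral_mono fun r => hf.int r
    _ = _ := by
        rw [setLIntegral_const, ENNReal.ofReal_mul hf.nonneg, uIoc, Real.volume_Ioc]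
        congr 2
        exact max_sub_min_eq_abs s t

lemma tendsto_abs_sub (M s : ℝ) (I : Set ℝ) :
    Tendsto (fun t => ENNReal.ofReal (M * |t - s|)) (𝓝[I] s) (𝓝 0) := by
  have h : Continuous fun t => ENNReal.ofReal (M * |t - s|) :=
    ENNReal.continuous_ofReal.comp (by fun_prop)
  have := (h.tendsto s).mono_left (nhdsWithin_le_nhds (s := I))
  simpa using this

lemma inv_scale_anti {s t : ℝ} (hs : 0 < s) (h : s ≤ t) : (scale t ^ 1)⁻¹ ≤ (scale s ^ 1)⁻¹ := by
  have h1 := scale_pos hs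
  gcongr
  exact scale_mono hs.le h

lemma tendsto_of_tendsto_pos {T : ℝ} {φ : ℝ → ℝ≥0∞} (h0 : φ 0 = 0)
    (h : Tendsto φ (𝓝[>] 0) (𝓝 0)) : Tendsto φ (𝓝[Icc 0 T] 0) (𝓝 0) := by
  have h1 : Tendsto φ (𝓝[≥] 0) (𝓝 0) := by
    rw [← Ioi_insert, nhdsWithin_insert, tendsto_sup]
    exact ⟨by rw [tendsto_pure_left]; intro s hs; rw [h0]; exact mem_of_mem_nhds hs, h⟩
  exact h1.mono_left (nhdsWithin_mono _ Icc_subset_Ici_self)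

lemma heat_zero_add_duhamel {T : ℝ} {g : ℕ → ℝ → ℝ} (k m : ℕ) (f : ℝ → ℝ → ℝ) (hT : 0 < T) (y : ℝ) :
    heat k (g k) (min 0 T) y + duhamel m k f (min 0 T) y = g k y := by
  rw [min_eq_left hT.le, heat_zero, duhamel_of_nonpos _ _ _ le_rfl, add_zero]

namespace RegularSolution

variable {T B : ℝ} {g : ℕ → ℝ → ℝ} {v : ℕ → ℝ → ℝ → ℝ} (hv : RegularSolution T B g v)
include hv

lemma continuous_slice {k : ℕ} (hk : k ≤ 6) (t : ℝ) : Continuous (v k t) :=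
  Prandtl.continuous_slice (hv.bounded k hk).cont t

lemma dy_eq {k : ℕ} (hk : k ≤ 6) (t : ℝ) {y : ℝ} (hy : 0 ≤ y) : dy k (v 0 t) y = v k t y :=
  dy_eq_of_hasDerivAt (v := fun k => v k t) (fun _ hk => hv.continuous_slice hk t)
    (fun k hk => hv.deriv k hk t) hk y hy

lemma dy_sub_eq {k : ℕ} (hk : k ≤ 6) (t s : ℝ) {y : ℝ} (hy : 0 ≤ y) :
    dy k (fun y => v 0 t y - v 0 s y) y = v k t y - v k s y :=
  dy_eq_of_hasDerivAt (v := fun k y => v k t y - v k s y)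
    (fun _ hk => (hv.continuous_slice hk t).sub (hv.continuous_slice hk s))
    (fun k hk y hy => (hv.deriv k hk t y hy).sub (hv.deriv k hk s y hy)) hk y hy

lemma memC {m : ℕ} (hm : m ≤ 6) (t : ℝ) : MemC m (v 0 t) := by
  refine ⟨contDiffOn_of_hasDerivAt (v := fun k => v k t)
    (fun k hk => hv.continuous_slice (hk.trans hm) t)
    (fun k hk => hv.deriv k (hk.trans_le hm) t), fun k hk => ?_⟩
  obtain ⟨M, hM⟩ := (hv.bounded k (hk.trans hm)).bdd
  exact ⟨M, fun y hy => by rw [hv.dy_eq (hk.trans hm) t hy]; exact hM t y⟩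

lemma memBC (I : Set ℝ) : MemBC 6 I (v 0) := by
  refine ⟨fun t _ => hv.memC le_rfl t, fun k hk => ⟨?_, ?_⟩⟩
  · obtain ⟨M, hM⟩ := (hv.bounded k hk).bdd
    exact ⟨M, fun t _ y hy => by rw [hv.dy_eq hk t hy]; exact hM t y⟩
  · exact (hv.bounded k hk).cont.continuousOn.congr fun p hp => hv.dy_eq hk p.1 hp.2

lemma memCC {m : ℕ} (hm : m ≤ 6) {I : Set ℝ} (h : ∀ s ∈ I, ∀ k ≤ m,
    Tendsto (fun t => ⨆ y ∈ Ici (0 : ℝ), ‖v k t y - v k s y‖ₑ) (𝓝[I] s) (𝓝 0)) :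
    MemCC m I (v 0) := by
  refine ⟨fun t _ => hv.memC hm t, fun s hs => ?_⟩
  have h1 : Tendsto (fun t => ∑ k ∈ Finset.range (m + 1), ⨆ y ∈ Ici (0 : ℝ), ‖v k t y - v k s y‖ₑ)
      (𝓝[I] s) (𝓝 (∑ k ∈ Finset.range (m + 1), 0)) :=
    tendsto_finsetSum _ fun k hk => h s hs k (by rw [Finset.mem_range] at hk; omega)
  rw [Finset.sum_const_zero] at h1
  refine h1.congr fun t => Finset.sum_congr rfl fun k hk => ?_
  rw [Finset.mem_range] at hk
  exact iSup_congr fun y => iSup_congr fun hy => by rw [hv.dy_sub_eq (by omega) t s hy]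

lemma memCW {m : ℕ} (hm : m ≤ 4) {I : Set ℝ} (h : ∀ s ∈ I, ∀ k ≤ m,
    Tendsto (fun t => ∫⁻ y in Ioi (0 : ℝ), ‖v k t y - v k s y‖ₑ) (𝓝[I] s) (𝓝 0)) :
    MemCW m I (v 0) := by
  refine ⟨fun t _ k hk => ?_, fun s hs => ?_⟩
  · obtain ⟨M, hM⟩ := hv.integrable k (hk.trans hm)
    rw [integrableOn_Ici_iff_integrableOn_Ioi]
    exact (hM.integrableOn t).congr_fun (fun y hy => (hv.dy_eq (by omega) t (le_of_lt hy)).symm)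
      measurableSet_Ioi
  · have h1 : Tendsto (fun t => ∑ k ∈ Finset.range (m + 1),
        ∫⁻ y in Ioi (0 : ℝ), ‖v k t y - v k s y‖ₑ)
        (𝓝[I] s) (𝓝 (∑ k ∈ Finset.range (m + 1), 0)) :=
      tendsto_finsetSum _ fun k hk => h s hs k (by rw [Finset.mem_range] at hk; omega)
    rw [Finset.sum_const_zero] at h1
    refine h1.congr fun t => Finset.sum_congr rfl fun k hk => ?_
    rw [Finset.mem_range] at hk
    rw [setLIntegral_Ici_eq]
    exact setLIntegral_congr_fun measurableSet_Ioi fun y hy => by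
      rw [hv.dy_sub_eq (by omega) t s (le_of_lt hy)]

/-- Continuity in time of the derivatives of order at most `5`, in the sup norm. -/
lemma tendsto_iSup {k : ℕ} (hk : k ≤ 5) {s : ℝ} (hs : s ∈ Icc 0 T) :
    Tendsto (fun t => ⨆ y ∈ Ici (0 : ℝ), ‖v k t y - v k s y‖ₑ) (𝓝[Icc 0 T] s) (𝓝 0) := by
  induction k with
  | zero =>
    obtain ⟨M, hM⟩ := hv.rhs_integrable
    refine tendsto_of_tendsto_of_tendsto_of_le_of_le' tendsto_const_nhds
      (tendsto_abs_sub M s (Icc 0 T)) (Eventually.of_forall fun _ => zero_le) ?_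
    filter_upwards [self_mem_nhdsWithin] with t ht
    refine iSup₂_le fun y _ => enorm_le_ofReal ?_
    rw [hv.sub_eq_integral hs ht]
    exact intervalIntegral.norm_integral_le_of_norm_le_const (C := M)
      (f := fun r => forcing v 0 r y - v 4 r y) fun r _ => hM.bdd r y
  | succ k ih =>
    obtain ⟨M, hM⟩ := (hv.bounded (k + 2) (by omega)).bdd
    refine tendsto_iSup_deriv (L := M + M) (f := fun t y => v k t y - v k s y)
      (f'' := fun t y => v (k + 2) t y - v (k + 2) s y)
      (fun t => (hv.continuous_slice (by omega) t).sub (hv.continuous_slice (by omega) s))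
      (fun t => (hv.continuous_slice (by omega) t).sub (hv.continuous_slice (by omega) s))
      (fun t y hy => (hv.deriv k (by omega) t y hy).sub (hv.deriv k (by omega) s y hy))
      (Eventually.of_forall fun t y hy =>
        (hv.deriv (k + 1) (by omega) t y hy).sub (hv.deriv (k + 1) (by omega) s y hy))
      (Eventually.of_forall fun t y _ => (abs_sub _ _).trans (add_le_add (hM t y) (hM s y)))
      (ih (by omega))

/-- Continuity in time of the derivatives of order at most `3`, in `L¹`. -/
lemma tendsto_lintegral {k : ℕ} (hk : k ≤ 3) {s : ℝ} (hs : s ∈ Icc 0 T) :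
    Tendsto (fun t => ∫⁻ y in Ioi (0 : ℝ), ‖v k t y - v k s y‖ₑ) (𝓝[Icc 0 T] s) (𝓝 0) := by
  induction k with
  | zero =>
    obtain ⟨M, hM⟩ := hv.rhs_integrable
    refine tendsto_of_tendsto_of_tendsto_of_le_of_le' tendsto_const_nhds
      (tendsto_abs_sub M s (Icc 0 T)) (Eventually.of_forall fun _ => zero_le) ?_
    filter_upwards [self_mem_nhdsWithin] with t ht
    simp_rw [hv.sub_eq_integral hs ht]
    exact lintegral_integral_le hM s t
  | succ k ih =>
    obtain ⟨M, hM⟩ := hv.integrable (k + 2) (by omega)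
    exact tendsto_lintegral_deriv (L := ENNReal.ofReal M + ENNReal.ofReal M)
      (f := fun t y => v k t y - v k s y) (f'' := fun t y => v (k + 2) t y - v (k + 2) s y)
      (fun t => (hv.continuous_slice (by omega) t).sub (hv.continuous_slice (by omega) s))
      (fun t => (hv.continuous_slice (by omega) t).sub (hv.continuous_slice (by omega) s))
      (fun t y hy => (hv.deriv k (by omega) t y hy).sub (hv.deriv k (by omega) s y hy))
      (fun t y hy =>
        (hv.deriv (k + 1) (by omega) t y hy).sub (hv.deriv (k + 1) (by omega) s y hy))
      (by simp) (Eventually.of_forall fun t =>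
        (lintegral_enorm_sub_le (hv.continuous_slice (by omega) t)).trans
          (add_le_add (hM.int t) (hM.int s))) (ih (by omega))

/-- The fifth derivative of the datum need not be integrable. It is replaced by the fourth with one
derivative on the kernel, at the cost t^{-1/4}, which is bounded for t ≥ δ. -/
lemma exists_lintegral_five_le {δ : ℝ} (hδ : 0 < δ) (hT : δ ≤ T) :
    ∃ L : ℝ≥0∞, L ≠ ⊤ ∧ ∀ t, δ ≤ t → ∫⁻ y in Ioi (0 : ℝ), ‖v 5 t y‖ₑ ≤ L := by
  have hg := hv.data
  obtain ⟨M, hM⟩ := (hv.forcing_integrable (j := 3) le_rfl).duhamel (m := 2) (by norm_num) 5 T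
  refine ⟨ENNReal.ofReal (opC 1 * (scale δ ^ 1)⁻¹) * ENNReal.ofReal B + ENNReal.ofReal M,
    by finiteness, fun t ht => ?_⟩
  have hm : δ ≤ min t T := le_min ht hT
  have hp : 0 < min t T := hδ.trans_le hm
  have e : ∀ y, v 5 t y = -greenOp 1 5 (min t T) (g 4) y +
      duhamel 2 5 (forcing v 3) (min t T) y := fun y => by
    rw [hv.eq_five, heat_of_pos _ _ hp, greenOp_succ 0 5 hp y (hg.cont 4 (by norm_num))
      (hg.bdd 4 (by norm_num)) (hg.cont 5 (by norm_num)) (hg.bdd 5 (by norm_num))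
      (hg.deriv 4 (by norm_num)) (hg.osc_mul (by norm_num)), neg_neg]
  simp_rw [e]
  have hc : Continuous fun y => -greenOp 1 5 (min t T) (g 4) y :=
    (continuous_greenOp 1 5 hp (hg.cont 4 (by norm_num)) (hg.bdd 4 (by norm_num))).neg
  refine (lintegral_enorm_add_le hc).trans (add_le_add ?_ (hM.int t))
  simp_rw [enorm_neg]
  refine (lintegral_greenOp_le 1 5 hp (hg.cont 4 (by norm_num))).trans
    (mul_le_mul' (ENNReal.ofReal_le_ofReal ?_) (hg.int 4 le_rfl))
  exact mul_le_mul_of_nonneg_left (inv_scale_anti hδ hm) (opC_nonneg 1)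

lemma tendsto_lintegral_four_of_pos {s : ℝ} (hs : s ∈ Ioc 0 T) :
    Tendsto (fun t => ∫⁻ y in Ioi (0 : ℝ), ‖v 4 t y - v 4 s y‖ₑ) (𝓝[Icc 0 T] s) (𝓝 0) := by
  have hs0 := hs.1
  obtain ⟨L, hLt, hL⟩ := hv.exists_lintegral_five_le (half_pos hs0) (by linarith [hs.2])
  refine tendsto_lintegral_deriv (L := L + L)
    (f := fun t y => v 3 t y - v 3 s y) (f'' := fun t y => v 5 t y - v 5 s y)
    (fun t => (hv.continuous_slice (by norm_num) t).sub (hv.continuous_slice (by norm_num) s))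
    (fun t => (hv.continuous_slice (by norm_num) t).sub (hv.continuous_slice (by norm_num) s))
    (fun t y hy => (hv.deriv 3 (by norm_num) t y hy).sub (hv.deriv 3 (by norm_num) s y hy))
    (fun t y hy => (hv.deriv 4 (by norm_num) t y hy).sub (hv.deriv 4 (by norm_num) s y hy))
    (by finiteness) ?_ (hv.tendsto_lintegral le_rfl (Ioc_subset_Icc_self hs))
  filter_upwards [nhdsWithin_le_nhds (lt_mem_nhds (half_lt_self hs0))] with t ht
  exact (lintegral_enorm_sub_le (hv.continuous_slice (by norm_num) t)).trans
    (add_le_add (hL t ht.le) (hL s (by linarith)))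

/-- No L¹ bound on a fifth derivative is available down to t = 0. Instead the semigroup converges in
L¹ on the fourth derivative of the datum, which vanishes at 0, and the Duhamel term is of size
t^{1/2}. -/
lemma tendsto_lintegral_four_zero (hT : 0 < T) :
    Tendsto (fun t => ∫⁻ y in Ioi (0 : ℝ), ‖v 4 t y - v 4 0 y‖ₑ) (𝓝[Icc 0 T] 0) (𝓝 0) := by
  have hg := hv.data
  refine tendsto_of_tendsto_pos (by simp) ?_
  obtain ⟨M, hM⟩ := hv.forcing_integrable (j := 2) (by norm_num)
  have h1 := tendsto_lintegral_greenOp_sub 4 (hg.cont 4 (by norm_num)) (hg.bdd 4 (by norm_num))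
    (hg.clamp 4 (by norm_num)) (hg.zero 4 (by norm_num))
    ⟨(hg.cont 4 (by norm_num)).aestronglyMeasurable,
      (hg.int 4 le_rfl).trans_lt ENNReal.ofReal_lt_top⟩
  have h2 : Tendsto (fun t => ENNReal.ofReal (opC 2 * scaleInt 2 t) * ENNReal.ofReal M)
      (𝓝[>] 0) (𝓝 0) := by
    have h3 := (tendsto_scaleInt (m := 2) (by norm_num)).const_mul (opC 2)
    rw [mul_zero] at h3
    have h4 := ENNReal.Tendsto.mul_const ((ENNReal.continuous_ofReal.tendsto 0).comp h3)
      (b := ENNReal.ofReal M) (Or.inr ENNReal.ofReal_ne_top)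
    simpa using h4
  refine tendsto_of_tendsto_of_tendsto_of_le_of_le' tendsto_const_nhds
    (by simpa using h1.add h2) (Eventually.of_forall fun _ => zero_le) ?_
  filter_upwards [Ioo_mem_nhdsGT hT] with t ht
  have e : ∀ y, v 4 t y - v 4 0 y =
      (greenOp 0 4 t (g 4) y - g 4 y) + duhamel 2 4 (forcing v 2) t y := fun y => by
    rw [hv.eq_four, hv.eq_four 0, heat_zero_add_duhamel 4 2 _ hT, min_eq_left ht.2.le,
      heat_of_pos _ _ ht.1]
    ring
  simp_rw [e]
  refine (lintegral_enorm_add_le ((continuous_greenOp 0 4 ht.1 (hg.cont 4 (by norm_num))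
    (hg.bdd 4 (by norm_num))).sub (hg.cont 4 (by norm_num)))).trans (add_le_add le_rfl ?_)
  exact lintegral_duhamel_le_const (by norm_num) 4 hM.cont hM.bdd fun s _ => hM.int s

lemma memCW_four (hT : 0 < T) : MemCW 4 (Icc 0 T) (v 0) := by
  refine hv.memCW le_rfl fun s hs k hk => ?_
  rcases hk.eq_or_lt with rfl | hk
  · rcases hs.1.eq_or_lt with rfl | h0
    · exact hv.tendsto_lintegral_four_zero hT
    · exact hv.tendsto_lintegral_four_of_pos ⟨h0, hs.2⟩
  · exact hv.tendsto_lintegral (by omega) hs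

lemma memCC_five : MemCC 5 (Icc 0 T) (v 0) :=
  hv.memCC (by norm_num) fun _ hs _ hk => hv.tendsto_iSup hk hs

/-- For positive times smoothing gives a seventh derivative, bounded away from t = 0, so the
interpolation argument reaches order six. -/
lemma tendsto_iSup_six_of_pos {s : ℝ} (hs : s ∈ Ioc 0 T) :
    Tendsto (fun t => ⨆ y ∈ Ici (0 : ℝ), ‖v 6 t y - v 6 s y‖ₑ) (𝓝[Icc 0 T] s) (𝓝 0) := by
  have hg := hv.data
  have hs0 := hs.1
  have hF := hv.forcing_bounded (j := 4) le_rfl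
  -- The seventh derivative for t ≥ s/2. Earlier times are replaced by s/2, so that continuity in y
  -- and the bound hold for all t, although the derivative relation holds only for t ≥ s/2.
  set w : ℝ → ℝ → ℝ := fun t y => -greenOp 1 7 (min (max t (s / 2)) T) (g 6) y -
    duhamel 3 7 (forcing v 4) (min (max t (s / 2)) T) y with hw
  have hle : ∀ t, s / 2 ≤ min (max t (s / 2)) T :=
    fun t => le_min (le_max_right _ _) (by linarith [hs.2])
  have hpos : ∀ t, 0 < min (max t (s / 2)) T := fun t => (half_pos hs0).trans_le (hle t)
  obtain ⟨M, hM⟩ := (hF.duhamel (m := 3) le_rfl 7 T).bdd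
  obtain ⟨M', hM'⟩ := hF.bdd
  have hwc : ∀ t, Continuous (w t) := fun t =>
    (continuous_greenOp 1 7 (hpos t) (hg.cont 6 le_rfl) (hg.bdd 6 le_rfl)).neg.sub
      (Prandtl.continuous_slice (continuous_duhamel le_rfl 7 hF.cont hM') _)
  have hwb : ∀ t y, |w t y| ≤ opC 1 * (scale (s / 2) ^ 1)⁻¹ * B + M := fun t y => by
    refine (abs_sub _ _).trans (add_le_add ?_ (hM _ y))
    rw [abs_neg]
    refine (abs_greenOp_le 1 7 (hpos t) y (hg.bdd 6 le_rfl)).trans ?_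
    refine mul_le_mul_of_nonneg_right (mul_le_mul_of_nonneg_left ?_ (opC_nonneg 1)) hg.nonneg
    exact inv_scale_anti (half_pos hs0) (hle t)
  have hwd : ∀ t, s / 2 ≤ t → ∀ y, 0 < y → HasDerivAt (v 6 t) (w t y) y := fun t ht y hy => by
    have hp : 0 < min t T := by simpa [max_eq_left ht] using hpos t
    have h := (hasDerivAt_greenOp 0 6 hp hy (hg.cont 6 le_rfl) (hg.bdd 6 le_rfl)).add
      (hF.hasDerivAt_duhamel le_rfl 6 (min t T) hy)
    have e : v 6 t = greenOp 0 6 (min t T) (g 6) + duhamel 2 6 (forcing v 4) (min t T) := by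
      funext z
      rw [hv.eq_six, heat_of_pos _ _ hp, Pi.add_apply]
    rw [e]
    refine h.congr_deriv ?_
    simp only [hw, max_eq_left ht]
    ring
  refine tendsto_iSup_deriv (f := fun t y => v 5 t y - v 5 s y)
    (f'' := fun t y => w t y - w s y)
    (fun t => (hv.continuous_slice le_rfl t).sub (hv.continuous_slice le_rfl s))
    (fun t => (hwc t).sub (hwc s))
    (fun t y hy => (hv.deriv 5 (by norm_num) t y hy).sub (hv.deriv 5 (by norm_num) s y hy))
    ?_ (Eventually.of_forall fun t y _ => (abs_sub _ _).trans (add_le_add (hwb t y) (hwb s y)))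
    (hv.tendsto_iSup le_rfl (Ioc_subset_Icc_self hs))
  filter_upwards [nhdsWithin_le_nhds (lt_mem_nhds (half_lt_self hs0))] with t ht y hy
  exact (hwd t ht.le y hy).sub (hwd s (by linarith) y hy)

lemma tendsto_iSup_six_zero (hT : 0 < T) (hu : UniformContinuous (g 6)) :
    Tendsto (fun t => ⨆ y ∈ Ici (0 : ℝ), ‖v 6 t y - v 6 0 y‖ₑ) (𝓝[Icc 0 T] 0) (𝓝 0) := by
  have hg := hv.data
  refine tendsto_of_tendsto_pos (by simp) ?_
  obtain ⟨M, hM⟩ := (hv.forcing_bounded (j := 4) le_rfl).bdd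
  rw [ENNReal.tendsto_nhds_zero]
  intro ε hε
  obtain ⟨e, he, hle⟩ : ∃ e : ℝ, 0 < e ∧ ENNReal.ofReal e ≤ ε := by
    rcases eq_or_ne ε ⊤ with rfl | h1
    · exact ⟨1, one_pos, le_top⟩
    · exact ⟨ε.toReal, ENNReal.toReal_pos hε.ne' h1, (ENNReal.ofReal_toReal h1).le⟩
  obtain ⟨δ, hδ, hδe⟩ := exists_abs_greenOp_sub_le 6 (by norm_num) hu (hg.bdd 6 le_rfl)
    (half_pos he)
  have h3 : Tendsto (fun t => opC 2 * scaleInt 2 t * M) (𝓝[>] 0) (𝓝 0) := by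
    simpa using ((tendsto_scaleInt (m := 2) (by norm_num)).const_mul (opC 2)).mul_const M
  filter_upwards [Ioo_mem_nhdsGT hT, Ioo_mem_nhdsGT hδ, h3.eventually (gt_mem_nhds (half_pos he))]
    with t ht htδ hts
  refine (iSup₂_le fun y hy => enorm_le_ofReal ?_).trans hle
  have e6 : v 6 t y - v 6 0 y =
      (greenOp 0 6 t (g 6) y - g 6 y) + duhamel 2 6 (forcing v 4) t y := by
    rw [hv.eq_six, hv.eq_six 0, heat_zero_add_duhamel 6 2 _ hT, min_eq_left ht.2.le,
      heat_of_pos _ _ ht.1]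
    ring
  have h4 := abs_duhamel_le (m := 2) (by norm_num) 6 (t := t) (fun s _ => hM s) y
  rw [e6]
  linarith [abs_add_le (greenOp 0 6 t (g 6) y - g 6 y) (duhamel 2 6 (forcing v 4) t y),
    hδe t ht.1 htδ.2 y hy]

lemma memCC_six_of_pos : MemCC 6 (Ioc 0 T) (v 0) := by
  refine hv.memCC le_rfl fun s hs k hk => Tendsto.mono_left ?_ (nhdsWithin_mono _ Ioc_subset_Icc_self)
  rcases hk.eq_or_lt with rfl | hk
  · exact hv.tendsto_iSup_six_of_pos hs
  · exact hv.tendsto_iSup (by omega) (Ioc_subset_Icc_self hs)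

lemma memCC_six (hT : 0 < T) (hu : UniformContinuous (g 6)) : MemCC 6 (Icc 0 T) (v 0) := by
  refine hv.memCC le_rfl fun s hs k hk => ?_
  rcases hk.eq_or_lt with rfl | hk
  · rcases hs.1.eq_or_lt with rfl | h0
    · exact hv.tendsto_iSup_six_zero hT hu
    · exact hv.tendsto_iSup_six_of_pos ⟨h0, hs.2⟩
  · exact hv.tendsto_iSup (by omega) hs

lemma tendsto_dy_atTop {m : ℕ} (hm : m ≤ 3) (t : ℝ) : Tendsto (dy m (v 0 t)) atTop (𝓝 0) := by
  obtain ⟨M, hM⟩ := hv.integrable m (by omega)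
  obtain ⟨M', hM'⟩ := hv.integrable (m + 1) (by omega)
  refine (tendsto_zero_of_hasDerivAt_of_integrableOn_Ioi (a := 0)
    (fun y hy => hv.deriv m (by omega) t y hy) (hM'.integrableOn t) (hM.integrableOn t)).congr' ?_
  filter_upwards [eventually_ge_atTop 0] with y hy
  exact (hv.dy_eq (by omega) t hy).symm

lemma isSolution (hT : 0 < T) {a₀ : ℝ → ℝ} (h : ∀ y, 0 ≤ y → g 0 y = a₀ y) :
    IsSolution T a₀ (v 0) where
  equation t ht y hy := by
    refine (hv.hasDerivAt ht y).congr_deriv ?_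
    have hy : 0 < y := hy
    rw [hv.dy_eq (by norm_num) t hy.le, hv.dy_eq (by norm_num) t hy.le]
    simp only [forcing, prim, max_eq_left hy.le]
    ring
  initial y hy := by
    rw [hv.eq_integral ⟨le_rfl, hT.le⟩, intervalIntegral.integral_same, add_zero, h y hy]
  clamped t _ := ⟨(hv.clamped t).1, by rw [hv.dy_eq (by norm_num) t le_rfl]; exact (hv.clamped t).2⟩
  decay t _ m hm := hv.tendsto_dy_atTop hm t

end RegularSolution

/-! ### Classical solutions are mild -/

/-- The clamped initial datum and its derivatives. -/
noncomputable def extend (a : ℝ → ℝ) (k : ℕ) (y : ℝ) : ℝ := dy k a (max y 0)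

lemma exists_initialData {a₀ : ℝ → ℝ} (hC : MemC 6 a₀) (hW : MemW 4 a₀)
    (h0 : ∀ m ∈ ({0, 1, 4, 5} : Set ℕ), dy m a₀ 0 = 0) : ∃ B, InitialData B (extend a₀) := by
  choose! M hM using hC.2
  set L : ℕ → ℝ := fun k => (∫⁻ y in Ioi (0 : ℝ), ‖extend a₀ k y‖ₑ).toReal with hL
  have hfin : ∀ k ≤ 4, ∫⁻ y in Ioi (0 : ℝ), ‖extend a₀ k y‖ₑ ≠ ⊤ := fun k hk => by
    have h := ((hW k hk).mono_set Ioi_subset_Ici_self).2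
    refine (lt_of_le_of_lt (le_of_eq ?_) h).ne
    exact setLIntegral_congr_fun measurableSet_Ioi fun y hy => by
      rw [extend, max_eq_left (le_of_lt hy)]
  have hle : ∀ k ≤ 6, |M k| + L k ≤ ∑ k ∈ Finset.range 7, (|M k| + L k) := fun k hk =>
    Finset.single_le_sum (f := fun k => |M k| + L k)
      (fun k _ => add_nonneg (abs_nonneg _) ENNReal.toReal_nonneg) (Finset.mem_range.2 (by omega))
  refine ⟨∑ k ∈ Finset.range 7, (|M k| + L k), fun k hk => continuous_dy_max hC.1 hk,
    fun k hk y => ?_, fun k hk y => ?_, fun k hk y hy => hasDerivAt_dy hC.1 hk hy,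
    fun k hk => ?_, fun k hk => ?_⟩
  · have h1 : 0 ≤ L k := ENNReal.toReal_nonneg
    have h2 : |extend a₀ k y| ≤ M k := hM k hk _ (mem_Ici.2 (le_max_right _ _))
    linarith [le_abs_self (M k), hle k hk]
  · simp [extend]
  · rw [extend, max_self]
    exact h0 k (by simpa using hk)
  · rw [← ENNReal.ofReal_toReal (hfin k hk)]
    refine ENNReal.ofReal_le_ofReal (le_trans ?_ (hle k (by omega)))
    exact le_add_of_nonneg_left (abs_nonneg _)

/-- Norm continuity bounds the L¹ norm near each time, and compactness of [0, T] makes the bound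
uniform. -/
lemma exists_lintegral_le_of_memCW {T : ℝ} {b : ℝ → ℝ → ℝ} (h : MemCW 4 (Icc 0 T) b)
    (hc : ∀ t ∈ Icc 0 T, ContinuousOn (b t) (Ici 0)) :
    ∃ L : ℝ≥0∞, L ≠ ⊤ ∧ ∀ t ∈ Icc 0 T, ∫⁻ y in Ici (0 : ℝ), ‖b t y‖ₑ ≤ L := by
  refine isCompact_Icc.induction_on
    (p := fun S => ∃ L : ℝ≥0∞, L ≠ ⊤ ∧ ∀ t ∈ S, ∫⁻ y in Ici (0 : ℝ), ‖b t y‖ₑ ≤ L)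
    ⟨0, by simp, by simp⟩ ?_ ?_ ?_
  · rintro S S' hS ⟨L, hL, hb⟩
    exact ⟨L, hL, fun t ht => hb t (hS ht)⟩
  · rintro S S' ⟨L, hL, hb⟩ ⟨L', hL', hb'⟩
    refine ⟨max L L', by simp [hL, hL'], fun t ht => ?_⟩
    rcases ht with ht | ht
    exacts [(hb t ht).trans (le_max_left _ _), (hb' t ht).trans (le_max_right _ _)]
  · intro s hs
    have hev := (h.2 s hs).eventually (gt_mem_nhds (zero_lt_one' ℝ≥0∞))
    refine ⟨_, inter_mem hev self_mem_nhdsWithin, 1 + ∫⁻ y in Ici (0 : ℝ), ‖b s y‖ₑ, ?_, ?_⟩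
    · have h1 : ∫⁻ y in Ici (0 : ℝ), ‖b s y‖ₑ < ⊤ := by
        have := (h.1 s hs 0 (by norm_num)).2
        rwa [dy_zero] at this
      finiteness
    · rintro t ⟨ht, htI⟩
      have h1 : ∫⁻ y in Ici (0 : ℝ), ‖b t y - b s y‖ₑ ≤ 1 := by
        refine le_trans ?_ (le_of_lt ht)
        have := Finset.single_le_sum (s := Finset.range (4 + 1))
          (f := fun k => ∫⁻ y in Ici (0 : ℝ), ‖dy k (fun y => b t y - b s y) y‖ₑ)
          (fun _ _ => zero_le) (show 0 ∈ Finset.range (4 + 1) by simp)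
        simpa only [dy_zero, normW] using this
      refine le_trans ?_ (add_le_add h1 le_rfl)
      have hm : AEMeasurable (fun y => ‖b t y - b s y‖ₑ) (volume.restrict (Ici 0)) :=
        (((hc t htI).sub (hc s hs)).aemeasurable measurableSet_Ici).enorm
      rw [← lintegral_add_left' hm]
      refine lintegral_mono fun y => ?_
      have := enorm_add_le (b t y - b s y) (b s y)
      rwa [sub_add_cancel] at this

section

variable {T : ℝ} {w : ℕ → ℝ → ℝ → ℝ} (hw : ∀ k ≤ 4, BoundedField (w k))
  (hi : IntegrableField (w 0)) (hd : ∀ k < 4, YDeriv (w k) (w (k + 1)))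
  (hm : ∀ t y, w 0 t (max y 0) = w 0 t y) (h0 : ∀ t, w 0 t 0 = 0) (h1 : ∀ t, w 1 t 0 = 0)
  (ht : ∀ t ∈ Ioo 0 T, ∀ y, 0 < y →
    HasDerivAt (fun s => w 0 s y) (forcing w 0 t y - w 4 t y) t)
include hw hi hd hm h0 h1 ht

/-- The Duhamel formula for classical solutions. -/
lemma eq_duhamel_of_hasDerivAt {t : ℝ} (htT : t ∈ Icc 0 T) (y : ℝ) :
    w 0 t y = heat 0 (w 0 0) t y + duhamel 0 0 (forcing w 0) t y := by
  rcases htT.1.eq_or_lt with rfl | htpos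
  · rw [heat_zero, duhamel_of_nonpos _ _ _ le_rfl, add_zero]
  obtain ⟨B, hB⟩ : ∃ B, ∀ k ≤ 4, ∀ s y, |w k s y| ≤ B := by
    choose! M hM using fun k hk => (hw k hk).bdd
    refine ⟨∑ k ∈ Finset.range 5, |M k|, fun k hk s y => (hM k hk s y).trans ((le_abs_self _).trans
      (Finset.single_le_sum (f := fun k => |M k|) (fun _ _ => abs_nonneg _)
        (Finset.mem_range.2 (by omega))))⟩
  have hF : BoundedField (forcing w 0) :=
    forcing_bounded hi (by norm_num) fun k hk => hw k (by omega)
  have hR := hF.sub (hw 4 le_rfl)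
  obtain ⟨C, hC⟩ := hR.bdd
  obtain ⟨C', hC'⟩ := hF.bdd
  have hC0 : 0 ≤ C := (abs_nonneg _).trans (hC 0 0)
  -- The time derivative is bounded by `C`, so w is Lipschitz in time uniformly in z. This gives
  -- continuity of φ at the final time, where the kernel degenerates.
  have hlip : ∀ s ∈ Ioo 0 t, ∀ z, |w 0 s z - w 0 t z| ≤ C * (t - s) := by
    intro s hs
    have hpos : ∀ z, 0 < z → |w 0 s z - w 0 t z| ≤ C * (t - s) := fun z hz => by
      have hcz : Continuous fun s => w 0 s z :=
        (hw 0 (by norm_num)).cont.comp (by fun_prop : Continuous fun s : ℝ => (s, z))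
      obtain ⟨ξ, hξ, he⟩ := exists_hasDerivAt_eq_slope (fun s => w 0 s z) _ hs.2 hcz.continuousOn
        fun r hr => ht r ⟨hs.1.trans hr.1, hr.2.trans_le htT.2⟩ z hz
      have hst : 0 < t - s := sub_pos.2 hs.2
      have h2 := hC ξ z
      rw [he, abs_div, abs_of_pos hst, div_le_iff₀ hst] at h2
      rwa [abs_sub_comm]
    intro z
    rcases le_or_gt z 0 with hz | hz
    · rw [← hm, ← hm t, max_eq_right hz, h0, h0, sub_zero, abs_zero]
      exact mul_nonneg hC0 (by linarith [hs.2])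
    · exact hpos z hz
  -- Duhamel's interpolation between the free evolution of the initial value (s = 0) and the
  -- solution (s = t). The fourth-order terms cancel in its derivative, leaving the semigroup
  -- applied to the forcing.
  set φ : ℝ → ℝ := fun s => heat 0 (w 0 s) (t - s) y with hφ
  have hφe : ∀ s, s < t → φ s = greenOp 0 0 (t - s) (w 0 s) y :=
    fun s hs => heat_of_pos _ _ (sub_pos.2 hs) y
  have hcw : ∀ k ≤ 4, ∀ s, Continuous (w k s) := fun k hk s => continuous_slice (hw k hk).cont s
  have hcont : ContinuousOn φ (Icc 0 t) := by
    intro s hs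
    rcases hs.2.eq_or_lt with rfl | hst
    · have hh : Tendsto (fun r => heat 0 (w 0 s) (s - r) y) (𝓝 s) (𝓝 (φ s)) := by
        have hc : Continuous fun r => heat 0 (w 0 s) (s - r) y :=
          (continuous_heat 0 (hcw 0 (by norm_num) s) (hB 0 (by norm_num) s) (hm s)
            (Or.inr (Or.inr (h0 s)))).comp (by fun_prop : Continuous fun r : ℝ => (s - r, y))
        exact hc.tendsto s
      have hz : Tendsto (fun r => opC 0 * (C * (s - r))) (𝓝[Icc 0 s] s) (𝓝 0) := by
        have hc : Continuous fun r => opC 0 * (C * (s - r)) := by fun_prop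
        simpa using (hc.tendsto s).mono_left (nhdsWithin_le_nhds (s := Icc 0 s))
      have hdiff : Tendsto (fun r => φ r - heat 0 (w 0 s) (s - r) y) (𝓝[Icc 0 s] s) (𝓝 0) := by
        refine squeeze_zero_norm' ?_ hz
        filter_upwards [self_mem_nhdsWithin, nhdsWithin_le_nhds (lt_mem_nhds htpos)] with r hr hr0
        rcases hr.2.eq_or_lt with rfl | hrs
        · simp [hφ]
        · rw [hφe r hrs, heat_of_pos _ _ (sub_pos.2 hrs), ← greenOp_sub 0 0 (sub_pos.2 hrs) y
            (hcw 0 (by norm_num) r) (hB 0 (by norm_num) r) (hcw 0 (by norm_num) s)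
            (hB 0 (by norm_num) s)]
          have := abs_greenOp_le 0 0 (sub_pos.2 hrs) y (hlip r ⟨hr0, hrs⟩)
          simpa using this
      have := hdiff.add (hh.mono_left nhdsWithin_le_nhds)
      simpa [ContinuousWithinAt] using this
    · have hcon : ContinuousOn (fun r => greenOp 0 0 (t - r) (w 0 r) y) (Iio t) :=
        (continuousOn_greenOp 0 0 (hw 0 (by norm_num)).cont (hB 0 (by norm_num))).comp
          (f := fun r : ℝ => (t - r, r, y)) (by fun_prop)
          fun r hr => ⟨sub_pos.2 (show r < t from hr), mem_univ _⟩
      refine ContinuousAt.continuousWithinAt ?_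
      refine (hcon.continuousAt (Iio_mem_nhds hst)).congr ?_
      filter_upwards [gt_mem_nhds hst] with r hr
      exact (hφe r hr).symm
  have hderiv : ∀ s ∈ Ioo 0 t, HasDerivAt φ (greenOp 0 0 (t - s) (forcing w 0 s) y) s := by
    intro s hs
    have hts : 0 < t - s := sub_pos.2 hs.2
    have h := hasDerivAt_greenOp_time 0 0 (y := y) hs.2 (hcw 0 (by norm_num)) (hB 0 (by norm_num))
      (fun s => continuous_slice hR.cont s) hC (Ioo_mem_nhds hs.1 hs.2)
      fun r hr z hz => ht r ⟨hr.1, hr.2.trans_le htT.2⟩ z hz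
    rw [zero_add, greenOp_four (h := fun k => w k s) (fun k hk => hcw k hk s)
      (fun k hk => hB k hk s) (fun k hk => hd k hk s) (h0 s) (h1 s) hts,
      greenOp_sub 0 0 hts y (continuous_slice hF.cont s) (hC' s) (hcw 4 le_rfl s) (hB 4 le_rfl s),
      add_sub_cancel] at h
    refine h.congr_of_eventuallyEq ?_
    filter_upwards [gt_mem_nhds hs.2] with r hr
    exact hφe r hr
  have hint : IntervalIntegrable (fun s => greenOp 0 0 (t - s) (forcing w 0 s) y) volume 0 t := by
    rw [intervalIntegrable_iff_integrableOn_Ioo_of_le htpos.le]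
    exact integrableOn_greenOp_time hF.cont hC' t y
  have e := intervalIntegral.integral_eq_sub_of_hasDerivAt_of_le htpos.le hcont hderiv hint
  rw [← duhamel_eq_integral 0 0 _ htpos.le] at e
  have e1 : φ t = w 0 t y := by simp [hφ, heat_zero]
  have e2 : φ 0 = heat 0 (w 0 0) t y := by simp [hφ]
  rw [e, e1, e2]
  ring

end

lemma exists_mild_of_isSolution {T : ℝ} (hT : 0 < T) {a₀ : ℝ → ℝ} {b : ℝ → ℝ → ℝ}
    (hb : IsSolution T a₀ b) (hbc : MemBC 6 (Icc 0 T) b) (hbw : MemCW 4 (Icc 0 T) b) :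
    ∃ M, ∃ u, BddField M u ∧ (∀ t ∈ Icc 0 T, ∀ y, 0 ≤ y → u t y = b t y) ∧
      ∀ t ∈ Icc 0 T, ∀ y, u t y = mildMap (extend a₀ 0) T u t y := by
  -- The candidate is extended to the plane by clamping time to [0, T] and space to [0, ∞). This
  -- changes neither its values nor, for 0 < t < T and y > 0, its derivatives, and makes it a global
  -- bounded field.
  set c : ℝ → ℝ := fun s => max 0 (min s T) with hc
  have hcI : ∀ s, c s ∈ Icc 0 T := fun s => ⟨le_max_left _ _, max_le hT.le (min_le_right _ _)⟩
  have hce : ∀ s ∈ Icc 0 T, c s = s := fun s hs => by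
    rw [hc]
    simp only [min_eq_left hs.2, max_eq_right hs.1]
  have hcc : Continuous c := by fun_prop
  set w : ℕ → ℝ → ℝ → ℝ := fun k s y => dy k (b (c s)) (max y 0) with hw
  have hwb : ∀ k ≤ 6, BoundedField (w k) := fun k hk => by
    obtain ⟨⟨M, hM⟩, hcont⟩ := hbc.2 k hk
    refine ⟨?_, M, fun s y => hM _ (hcI s) _ (mem_Ici.2 (le_max_right _ _))⟩
    exact hcont.comp_continuous (f := fun p : ℝ × ℝ => (c p.1, max p.2 0))
      (by fun_prop) fun p => ⟨hcI p.1, mem_Ici.2 (le_max_right _ _)⟩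
  have hwd : ∀ k < 6, YDeriv (w k) (w (k + 1)) := fun k hk s y hy =>
    hasDerivAt_dy (hbc.1 _ (hcI s)).1 hk hy
  obtain ⟨L, hLt, hL⟩ := exists_lintegral_le_of_memCW hbw fun t ht => (hbc.1 t ht).1.continuousOn
  have hwi : IntegrableField (w 0) := by
    obtain ⟨hcont, M, hM⟩ := hwb 0 (by norm_num)
    refine ⟨max M L.toReal, hcont, fun s y => (hM s y).trans (le_max_left _ _), fun s => ?_⟩
    refine le_trans ?_ (ENNReal.ofReal_le_ofReal (le_max_right _ _))
    rw [ENNReal.ofReal_toReal hLt]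
    refine le_trans (le_of_eq ?_) (hL _ (hcI s))
    rw [setLIntegral_Ici_eq]
    exact setLIntegral_congr_fun measurableSet_Ioi fun y hy => by
      simp only [hw, dy_zero]
      rw [max_eq_left (le_of_lt hy)]
  have hweq : ∀ t ∈ Icc 0 T, ∀ y, 0 ≤ y → ∀ k, w k t y = dy k (b t) y := fun t ht y hy k => by
    simp only [hw, hce t ht, max_eq_left hy]
  have hm : ∀ t y, w 0 t (max y 0) = w 0 t y := fun t y => by simp [hw]
  have h0 : ∀ t, w 0 t 0 = 0 := fun t => by
    simp only [hw, max_self, dy_zero]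
    exact (hb.clamped _ (hcI t)).1
  have h1 : ∀ t, w 1 t 0 = 0 := fun t => by
    simp only [hw, max_self]
    exact (hb.clamped _ (hcI t)).2
  have ht : ∀ t ∈ Ioo 0 T, ∀ y, 0 < y →
      HasDerivAt (fun s => w 0 s y) (forcing w 0 t y - w 4 t y) t := fun t ht y hy => by
    have htI := Ioo_subset_Icc_self ht
    refine ((hb.equation t ht y hy).congr_deriv ?_).congr_of_eventuallyEq ?_
    · have e : prim (w 0) t y = ∫ η in (0 : ℝ)..y, b t η := by
        rw [prim, max_eq_left hy.le]
        refine intervalIntegral.integral_congr fun η hη => ?_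
        rw [uIcc_of_le hy.le] at hη
        rw [hweq t htI η hη.1, dy_zero]
      simp only [forcing]
      rw [e, hweq t htI y hy.le, hweq t htI y hy.le, hweq t htI y hy.le, dy_zero]
      ring
    · filter_upwards [Icc_mem_nhds ht.1 ht.2] with s hs
      rw [hweq s hs y hy.le, dy_zero]
  have e0 : w 0 0 = extend a₀ 0 := by
    funext y
    have := hb.initial _ (le_max_right y 0)
    simp only [hw, extend, dy_zero, hce 0 ⟨le_rfl, hT.le⟩]
    exact this
  obtain ⟨M, hM⟩ := hwi
  refine ⟨M, w 0, hM, fun t ht y hy => by rw [hweq t ht y hy, dy_zero], fun t htI y => ?_⟩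
  rw [mildMap, add_assoc, min_eq_left htI.2]
  have e := duhamel_source_add_duhamel_flux ⟨M, hM⟩ (hwb 1 (by norm_num)) (hwd 0 (by norm_num))
    0 0 (by norm_num) (by norm_num) t y
  rw [zero_add] at e
  rw [e, ← e0]
  exact eq_duhamel_of_hasDerivAt (fun k hk => hwb k (by omega)) ⟨M, hM⟩
    (fun k hk => hwd k (by omega)) hm h0 h1 ht htI y

end Prandtl

theorem theorem3 (a₀ : ℝ → ℝ)
    (hC : Prandtl.MemC 6 a₀) (hW : Prandtl.MemW 4 a₀)
    (h0 : ∀ m ∈ ({0, 1, 4, 5} : Set ℕ), Prandtl.dy m a₀ 0 = 0) :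
    ∃ T : ℝ, 0 < T ∧ ∃ a : ℝ → ℝ → ℝ,
      Prandtl.IsSolution T a₀ a ∧
      Prandtl.MemBC 6 (Icc 0 T) a ∧
      Prandtl.MemCW 4 (Icc 0 T) a ∧
      Prandtl.MemCC 5 (Icc 0 T) a ∧
      Prandtl.MemCC 6 (Ioc 0 T) a ∧
      (UniformContinuousOn (Prandtl.dy 6 a₀) (Ici 0) → Prandtl.MemCC 6 (Icc 0 T) a) ∧
      ∀ b : ℝ → ℝ → ℝ, Prandtl.IsSolution T a₀ b →
        Prandtl.MemBC 6 (Icc 0 T) b → Prandtl.MemCW 4 (Icc 0 T) b →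
        ∀ t ∈ Icc 0 T, ∀ y ∈ Ici (0 : ℝ), b t y = a t y := by
  obtain ⟨B, hg⟩ := Prandtl.exists_initialData hC hW h0
  obtain ⟨T, hT, M, u, hu, hm⟩ := Prandtl.exists_mild_solution (hg.cont 0 (by norm_num))
    (hg.bdd 0 (by norm_num)) (hg.clamp 0 (by norm_num)) (hg.zero 0 (by norm_num))
    (hg.int 0 (by norm_num))
  obtain ⟨v, rfl, hv⟩ := Prandtl.exists_regularSolution hg hu hm
  refine ⟨T, hT, v 0, hv.isSolution hT fun y hy => ?_, hv.memBC _, hv.memCW_four hT, hv.memCC_five,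
    hv.memCC_six_of_pos, fun huc => hv.memCC_six hT ?_, fun b hb hbc hbw t ht y hy => ?_⟩
  · rw [Prandtl.extend, Prandtl.dy_zero, max_eq_left hy]
  · rw [← uniformContinuousOn_univ]
    refine huc.comp (g := Prandtl.dy 6 a₀) (f := fun y => max y 0) ?_ fun y _ => le_max_right y 0
    exact (LipschitzWith.id.max_const 0).uniformContinuous.uniformContinuousOn
  · obtain ⟨M', w, hw, hwe, hwm⟩ := Prandtl.exists_mild_of_isSolution hT hb hbc hbw
    rw [← hwe t ht y hy]
    -- The two fields have unrelated bounds; uniqueness is applied with their maximum.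
    exact Prandtl.mild_unique (hw.mono (le_max_right M M')) (hu.mono (le_max_left M M'))
      (fun t ht y _ => hwm t ht y) (fun t _ y _ => hm t y) t ht y hy
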